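/- **Syntax.** Fix a set of sorts with a distinguished sort $\mathtt{loc}$; for every sort $s$ a countably infinite set of variables and a finite set of constants (none of sort $\mathtt{loc}$), and a countably infinite universe $\mathfrak U_s$ in which the constants of sort $s$ are interpreted injectively, all these sets being disjoint for distinct sorts. Terms are variables and constants. Fix predicate symbols $p$ with a profile (a sequence of sorts of length $\mathrm{ar}(p)\ge 1$ starting with $\mathtt{loc}$). A *spatial atom* is a points-to atom $x\mapsto(t_1,\dots,t_k)$ or a predicate atom $p(x,t_1,\dots,t_n)$, where $x$ (its *root*) is a variable of sort $\mathtt{loc}$. A *spatial formula* $\phi$ is a finite multiset of spatial atoms (written with $*$, the empty one is $\mathit{emp}$). A *pure formula* $\xi$ is a finite set of equations $t\approx u$ and disequations $t\not\approx u$ between terms of the same sort, both modulo commutativity (written with $\wedge$, the empty one is $\top$); thus pure formulas are taken modulo contraction. A *symbolic heap* is $\phi\curlywedge\xi$. $\mathcal V(\cdot)$ denotes the set of variables, $\mathcal V_{\mathtt{loc}}(\cdot)$ those of sort $\mathtt{loc}$, and $\mathrm{alloc}(\phi)$ the multiset of the roots of the atoms of $\phi$; $\subseteq_m$ is multiset inclusion.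 A *sequent* is $\lambda\vdash_V\gamma$ with symbolic heaps $\lambda,\gamma$ and a finite multiset $V$ of variables of sort $\mathtt{loc}$; it is *equality-free* if no equation occurs in it. **Inductive rules.** An inductive rule is $p(x_1,\dots,x_n)\Leftarrow\lambda$ with distinct variables $x_1,\dots,x_n$ as formal parameters; the other variables of $\lambda$ are existential. It is a *P-rule* if $\lambda$ is $(x_1\mapsto(y_1,\dots,y_k)*q_1(z_1,\vec u_1)*\dots*q_m(z_m,\vec u_m))\curlywedge\xi$, where (i) $\xi$ consists of disequations $u\not\approx v$ with $u\ne v$, $u\in\{x_1,\dots,x_n,y_1,\dots,y_k\}$ and $v\in\{y_1,\dots,y_k\}\setminus\{x_1,\dots,x_n\}$; (ii) $z_1,\dots,z_m$ are pairwise distinct and are exactly the variables of sort $\mathtt{loc}$ among the $y_i$ that are not parameters; (iii) every component of each $\vec u_i$ is a parameter, some $y_j$, or a constant. Let $\mathfrak R$ be a finite set of P-rules. It is *deterministic* if for any two distinct rules $p(\vec x)\Leftarrow(x_1\mapsto\vec y*\phi)\curlywedge\xi$ and $p(\vec x')\Leftarrow(x_1'\mapsto\vec y'*\phi')\curlywedge\xi'$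 of the same predicate (renamed apart), $\vec x\approx\vec x'\wedge\vec y\approx\vec y'\wedge\xi\wedge\xi'$ is unsatisfiable (an equation between tuples of different lengths or different sorts is false). It is *loc-deterministic* if moreover all disequations in its rules are between variables of sort $\mathtt{loc}$. We write $p(\vec t)\Leftarrow_{\mathfrak R}\lambda$ if $\lambda$ is obtained from the body of a rule of $\mathfrak R$ for $p$ by replacing the parameters by $\vec t$ and the existential variables by pairwise distinct variables not in $\vec t$. *Productive* predicates form the least set containing $p$ whenever some rule of $\mathfrak R$ for $p$ has only productive predicates in its body. The set $\mathrm{out}(p)$ of outgoing parameter positions of $p$ is the least one such that $i\in\mathrm{out}(p)$ whenever $\mathfrak R$ has a rule for $p$ whose $i$-th parameter has sort $\mathtt{loc}$ and either occurs in the tuple of a points-to atom $x_1\mapsto(\dots)$ of the body, or is the $j$-th argument of a predicate atom $q(\dots)$ of the body with $j\in\mathrm{out}(q)$. It is assumed that every predicate symbol is productive and that every non-root parameter of sort $\mathtt{loc}$ of every predicate symbol is outgoing. Let $\mathit{width}(\mathfrak R)$ be the maximal arity of the predicate symbols and tuples occurring in $\mathfrak R$. **Semantics.** A store $\mathfrak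 s$ maps variables to elements of the universe of their sort (constants have their fixed value); a heap $\mathfrak h$ is a finite partial function from $\mathfrak U_{\mathtt{loc}}$ to finite tuples of elements. The relation $\models_{\mathfrak R}$ is the least one such that: $(\mathfrak s,\emptyset)\models\mathit{emp}$; $(\mathfrak s,\{\mathfrak s(x)\mapsto(\mathfrak s(t_1),\dots,\mathfrak s(t_k))\})\models x\mapsto(t_1,\dots,t_k)$; $(\mathfrak s,\mathfrak h_1\uplus\mathfrak h_2)\models\phi_1*\phi_2$ if $\mathfrak h_1,\mathfrak h_2$ are disjoint and $(\mathfrak s,\mathfrak h_i)\models\phi_i$; $(\mathfrak s,\mathfrak h)\models p(\vec t)$ if $p(\vec t)\Leftarrow_{\mathfrak R}\lambda$ and $(\mathfrak s',\mathfrak h)\models\lambda$ for some store $\mathfrak s'$ equal to $\mathfrak s$ outside $\mathcal V(\lambda)\setminus\mathcal V(p(\vec t))$; $(\mathfrak s,\mathfrak h)\models\phi\curlywedge\xi$ if $(\mathfrak s,\mathfrak h)\models\phi$ and $\mathfrak s\models\xi$. A *counter-model* of $\lambda\vdash_V\gamma$ is a pair $(\mathfrak s,\mathfrak h)$ with $(\mathfrak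 s,\mathfrak h)\models\lambda$, $(\mathfrak s,\mathfrak h)\not\models\gamma$, $\mathfrak s(x)\notin\mathrm{dom}(\mathfrak h)$ for $x\in V$, and $\mathfrak s(x)\neq\mathfrak s(y)$ whenever $\{x,y\}\subseteq_m V$. A sequent is *valid* if it has no counter-model. **Auxiliary notions.** $\phi\curlywedge\xi\triangleright_V\xi'$ means that every conjunct of $\xi'$ either occurs in $\xi$, or is $t\approx t$, or is $c\not\approx d$ with distinct constants $c,d$, or is $x\not\approx y$ with variables $x,y$ such that $\{x,y\}\subseteq_m\mathrm{alloc}(\phi)+V$ (multiset sum). Write $x\to_\phi y$ (for variables of sort $\mathtt{loc}$) if $\phi$ has an atom $x\mapsto\vec t$ with $y$ in $\vec t$, or an atom $p(t_1,\dots,t_n)$ with $t_1=x$ and $t_i=y$ for some $i\in\mathrm{out}(p)$. A sequent $\phi\curlywedge\xi\vdash_V\psi\curlywedge\zeta$ is an *axiom* if $\phi=\psi$ and $\zeta\subseteq\xi$; or $\xi$ contains some $t\not\approx t$; or $\mathrm{alloc}(\phi)$ has a repeated element; or $\mathrm{alloc}(\phi)\cap V\ne\emptyset$; or $V$ has a repeated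 element. It is an *anti-axiom* if it is not an axiom, $\xi$ contains no equation, $\zeta=\top$, and one of the following holds: some element of $\mathrm{alloc}(\psi)$ is not in $\mathrm{alloc}(\phi)$; $\psi=\mathit{emp}$ and $\phi\ne\mathit{emp}$; some element of $\mathrm{alloc}(\phi)$ outside $\mathrm{alloc}(\psi)$ is not reachable by $\to_\phi^*$ from any element of $\mathrm{alloc}(\psi)$; $V\cap(\mathcal V(\phi)\setminus\mathcal V(\psi))\neq\emptyset$; $\mathcal V_{\mathtt{loc}}(\phi)\setminus(\mathcal V(\psi)\cup\mathrm{alloc}(\phi))\ne\emptyset$. A sequent $\lambda\vdash_V\gamma$ is *narrow* if it is equality-free and $|\mathcal V_{\mathtt{loc}}(\gamma)\setminus(V\cup\mathrm{alloc}(\gamma))|\le\mathit{width}(\mathfrak R)$. **Inference rules** (conclusion $\rightsquigarrow$ premises). In R, E and W the conjuncts $x\approx t$, $\zeta'$ and $\xi'$ acted upon are disjoint from $\xi$, $\zeta$ and $\xi$, respectively, and $\zeta',\xi'\ne\top$. - R: $\phi\curlywedge(\xi\wedge x\approx t)\vdash_V\gamma\ \rightsquigarrow\ (\phi\curlywedge\xi)\{x\leftarrow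 t\}\vdash_{V\{x\leftarrow t\}}\gamma\{x\leftarrow t\}$, with $x$ a variable and $t$ a term. - E: $\lambda\vdash_V\psi\curlywedge(\zeta\wedge\zeta')\ \rightsquigarrow\ \lambda\vdash_V\psi\curlywedge\zeta$, if $\lambda\triangleright_V\zeta'$. - S: $(\phi_1*\phi_2)\curlywedge(\xi_1\wedge\xi_2)\vdash_V(\psi_1*\psi_2)\curlywedge(\zeta_1\wedge\zeta_2)\ \rightsquigarrow\ \phi_1\curlywedge\xi_1\vdash_{V+\mathrm{alloc}(\phi_2)}\psi_1\curlywedge\zeta_1$ and $\phi_2\curlywedge\xi_2\vdash_{V+\mathrm{alloc}(\phi_1)}\psi_2\curlywedge\zeta_2$, if $\phi_1,\phi_2\ne\mathit{emp}$. - U: $(p(\vec t)*\phi)\curlywedge\xi\vdash_V\gamma\ \rightsquigarrow$ one premise $(\phi'*\phi)\curlywedge(\xi'\wedge\xi)\vdash_V\gamma$ for each rule of $\mathfrak R$ for $p$, where $\phi'\curlywedge\xi'$ is the instance of its body on $\vec t$ with existential variables renamed to pairwise distinct variables not occurring in the conclusion. - I: $(x\mapsto\vec y*\phi)\curlywedge\xi\vdash_V(p(x,\vec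 z)*\psi)\curlywedge\zeta\ \rightsquigarrow\ (x\mapsto\vec y*\phi)\curlywedge\xi\vdash_V(x\mapsto\vec y*\psi'\sigma*\psi)\curlywedge\zeta$, if $p(x,\vec z)\Leftarrow_{\mathfrak R}(x\mapsto\vec u*\psi')\curlywedge\zeta'$ and $\sigma$ is a substitution with $\mathrm{dom}(\sigma)\subseteq\vec u\setminus(\{x\}\cup\vec z)$, $\vec u\sigma=\vec y$ and $(x\mapsto\vec y*\phi)\curlywedge\xi\triangleright_V\zeta'\sigma$. - W: $\phi\curlywedge(\xi\wedge\xi')\vdash_V\gamma\ \rightsquigarrow\ \phi\curlywedge\xi\vdash_V\gamma$, if either $\xi'$ is a single disequation and $\phi\curlywedge\top\triangleright_V\xi'$, or there is a variable $x\notin\mathcal V(\phi)\cup\mathcal V(\xi)\cup\mathcal V(\gamma)$ such that all conjuncts of $\xi'$ are of the form $x\not\approx t$ with $t\neq x$. - C: $\phi\curlywedge\xi\vdash_V\gamma\ \rightsquigarrow\ (\phi\curlywedge\xi)\{x\leftarrow y\}\vdash_{V\{x\leftarrow y\}}\gamma\{x\leftarrow y\}$ and $\phi\curlywedge(\xi\wedge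 x\not\approx y)\vdash_V\gamma$, with variables $x,y$ of sort $\mathtt{loc}$. - V: $\lambda\vdash_{V\uplus\{x\}}\gamma\ \rightsquigarrow\ \lambda\vdash_V\gamma$, if $x\notin\mathcal V(\lambda)\cup\mathcal V(\gamma)$. **Strategy.** Let a selection function be given, i.e. a function mapping every nonempty finite set of spatial atoms and every nonempty set of rule applications to one of its elements. Say that a rule application (with the notation above) is *possible* on its conclusion if: (1) its conclusion is neither an axiom nor an anti-axiom and none of its premises is an anti-axiom; (2) for I, $\zeta=\top$ and $\psi=\mathit{emp}$; (3) for U, $\gamma=\beta\curlywedge\top$ where $\beta$ is a single spatial atom whose root is the first component of $\vec t$; (4) for C, $\gamma=\beta\curlywedge\top$ where $\beta$ is a single predicate atom, $x\in\mathrm{alloc}(\phi)$, $y\in\mathcal V(\gamma)\setminus(\mathrm{alloc}(\phi)\cup V)$ and $x\not\approx y$ does not occur in $\xi$; (5) for S, $\xi_1=\xi_2$, $\zeta_1=\zeta_2=\top$, $\psi_1$ is the atom selected in the set of atoms of $\psi_1*\psi_2$, and, if the conclusion is not narrow, the first premise is valid. A rule application is *admissible* if it is possible, no application of a rule of higher priority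 is possible on the same sequent, where $\mathrm W>\mathrm V>\mathrm R>\mathrm E>\mathrm S>\mathrm U>\mathrm C>\mathrm I$, and, unless it is an application of S on a narrow sequent, it is the one selected in the set of all possible applications of the same rule on the same sequent. A *proof tree* is a possibly infinite tree whose nodes are labelled by sequents, in which each node either is a leaf to which no rule is applied or is the conclusion of a rule application whose premises label its children in order; it is *admissible* if all its rule applications are admissible, and *fully expanded* if all its leaves are axioms. **Theorem.** Let $\mathfrak R$ be a finite loc-deterministic set of P-rules satisfying the two assumptions above, and let a selection function be given. Let $\mathcal S=\phi\curlywedge\xi\vdash_V\gamma$ be a valid sequent such that the equations in $\xi$ do not identify two distinct constants (i.e. no two distinct constants are related by the equivalence relation generated by these equations) and $\xi$ contains no trivial equation $t\approx t$ in which $t$ is a constant or is related to a constant by this equivalence relation (in particular, any $\mathcal S$ whose left-hand side contains no equation is allowed). Then 1. $\mathcal S$ admits an admissible fully expanded (possibly infinite) proof tree; 2. if $\mathcal S$ is not an axiom, then some admissible rule application with conclusion $\mathcal S$ has only valid premises. -/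

import Mathlib

universe u

namespace SL

/-! ## Syntax -/

/-- A many-sorted signature together with the fixed universe over which formulas are interpreted.
Families indexed by sorts are automatically disjoint.  A predicate symbol `p` has profile
`loc, argSort p 0, …, argSort p (arity p - 1)`; so it has `arity p + 1` parameters, the first one
(its root) being of sort `loc`. -/
structure Signature where
  Srt : Type u
  loc : Srt
  /-- variables of each sort -/
  Var : Srt → Type u
  /-- constant symbols of each sort -/
  Cst : Srt → Type u
  /-- predicate symbols -/
  Pred : Type u
  arity : Pred → ℕ
  argSort : (p : Pred) → Fin (arity p) → Srt
  /-- the universe of each sort -/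
  Univ : Srt → Type u
  /-- the interpretation of constants -/
  cval : (s : Srt) → Cst s → Univ s
  var_countable : ∀ s, Countable (Var s)
  var_infinite : ∀ s, Infinite (Var s)
  univ_countable : ∀ s, Countable (Univ s)
  univ_infinite : ∀ s, Infinite (Univ s)
  cst_loc_isEmpty : IsEmpty (Cst loc)
  cval_injective : ∀ s, Function.Injective (cval s)

/-- Variables of sort `loc`. -/
abbrev LVar (Sg : Signature) := Sg.Var Sg.loc

/-- Terms of sort `s`. -/
inductive Term (Sg : Signature) (s : Sg.Srt) where
  | var (x : Sg.Var s) : Term Sg s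
  | cst (c : Sg.Cst s) : Term Sg s

/-- Variables of any sort. -/
abbrev AnyVar (Sg : Signature) := Σ s, Sg.Var s

/-- Terms of any sort. -/
abbrev AnyTerm (Sg : Signature) := Σ s, Term Sg s

/-- A variable of any sort, seen as a term. -/
def AnyVar.toTerm {Sg : Signature} (v : AnyVar Sg) : AnyTerm Sg := ⟨v.1, .var v.2⟩

/-- A location variable, seen as a term. -/
def lterm {Sg : Signature} (x : LVar Sg) : AnyTerm Sg := ⟨Sg.loc, .var x⟩

/-- Spatial atoms `x ↦ (t₁,…,tₖ)` and `p(x,t₁,…,tₙ)`. -/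
inductive Atom (Sg : Signature) where
  | pto (x : LVar Sg) (ts : List (AnyTerm Sg)) : Atom Sg
  | pred (p : Sg.Pred) (x : LVar Sg)
      (ts : (i : Fin (Sg.arity p)) → Term Sg (Sg.argSort p i)) : Atom Sg

/-- Equations and disequations between two terms of the same sort, modulo commutativity. -/
inductive PAtom (Sg : Signature) where
  | eq (s : Sg.Srt) (e : Sym2 (Term Sg s)) : PAtom Sg
  | ne (s : Sg.Srt) (e : Sym2 (Term Sg s)) : PAtom Sg

/-- Spatial formulas, modulo associativity and commutativity of `*`; `0` is `emp`. -/
abbrev Spatial (Sg : Signature) := Multiset (Atom Sg)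

/-- Pure formulas, modulo associativity, commutativity and contraction; `∅` is `⊤`. -/
abbrev Pure (Sg : Signature) := Finset (PAtom Sg)

/-- Symbolic heaps: a spatial formula in conjunction with a pure formula. -/
structure SHeap (Sg : Signature) where
  sp : Spatial Sg
  pu : Pure Sg

/-- An inductive rule `head(root, params) ⇐ body`, with pairwise distinct formal parameters. -/
structure Rule (Sg : Signature) where
  head : Sg.Pred
  root : LVar Sg
  params : (i : Fin (Sg.arity head)) → Sg.Var (Sg.argSort head i)
  body : SHeap Sg
  nodup : ((⟨Sg.loc, root⟩ : AnyVar Sg) :: List.ofFn fun i => ⟨_, params i⟩).Nodup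

/-- A sequent `lhs ⊢^V rhs`, where `V` is a multiset of variables of sort `loc`. -/
structure Sequent (Sg : Signature) where
  lhs : SHeap Sg
  V : Multiset (LVar Sg)
  rhs : SHeap Sg

section
variable {Sg : Signature}

def Atom.root : Atom Sg → LVar Sg
  | .pto x _ => x
  | .pred _ x _ => x

/-- The list of terms occurring in an atom, starting with the root. -/
def Atom.terms : Atom Sg → List (AnyTerm Sg)
  | .pto x ts => lterm x :: ts
  | .pred _ x ts => lterm x :: List.ofFn fun i => ⟨_, ts i⟩

def Atom.IsPred : Atom Sg → Prop
  | .pto _ _ => False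
  | .pred _ _ _ => True

def Atom.vars (a : Atom Sg) : Set (AnyVar Sg) := {v | v.toTerm ∈ a.terms}

def PAtom.vars : PAtom Sg → Set (AnyVar Sg)
  | .eq s e => {v | ∃ x : Sg.Var s, v = ⟨s, x⟩ ∧ Term.var x ∈ e}
  | .ne s e => {v | ∃ x : Sg.Var s, v = ⟨s, x⟩ ∧ Term.var x ∈ e}

def spVars (φ : Spatial Sg) : Set (AnyVar Sg) := {v | ∃ a ∈ φ, v ∈ a.vars}

def puVars (ξ : Pure Sg) : Set (AnyVar Sg) := {v | ∃ e ∈ ξ, v ∈ e.vars}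

def SHeap.vars (l : SHeap Sg) : Set (AnyVar Sg) := spVars l.sp ∪ puVars l.pu

def Sequent.vars (S : Sequent Sg) : Set (AnyVar Sg) :=
  S.lhs.vars ∪ S.rhs.vars ∪ {v | ∃ x ∈ S.V, v = ⟨Sg.loc, x⟩}

/-- The multiset of variables allocated by a spatial formula. -/
def alloc (φ : Spatial Sg) : Multiset (LVar Sg) := φ.map Atom.root

/-- The pure formula contains no equation. -/
def EqFree (ξ : Pure Sg) : Prop := ∀ s e, PAtom.eq s e ∉ ξ

def Sequent.EqualityFree (S : Sequent Sg) : Prop := EqFree S.lhs.pu ∧ EqFree S.rhs.pu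

end

/-! ### Substitutions -/

/-- Sort-preserving maps from variables to terms. -/
abbrev Subst (Sg : Signature) := (s : Sg.Srt) → Sg.Var s → Term Sg s

section
variable {Sg : Signature}

/-- There is no constant of sort `loc`: every term of sort `loc` is a variable. -/
def Term.toLVar : Term Sg Sg.loc → LVar Sg
  | .var x => x
  | .cst c => (Sg.cst_loc_isEmpty.false c).elim

def Term.subst (σ : Subst Sg) {s : Sg.Srt} : Term Sg s → Term Sg s
  | .var x => σ s x
  | .cst c => .cst c

def AnyTerm.subst (σ : Subst Sg) (t : AnyTerm Sg) : AnyTerm Sg := ⟨t.1, t.2.subst σ⟩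

def Subst.onLoc (σ : Subst Sg) (x : LVar Sg) : LVar Sg := (σ Sg.loc x).toLVar

def Atom.subst (σ : Subst Sg) : Atom Sg → Atom Sg
  | .pto x ts => .pto (σ.onLoc x) (ts.map (AnyTerm.subst σ))
  | .pred p x ts => .pred p (σ.onLoc x) fun i => (ts i).subst σ

def PAtom.subst (σ : Subst Sg) : PAtom Sg → PAtom Sg
  | .eq s e => .eq s (e.map (Term.subst σ))
  | .ne s e => .ne s (e.map (Term.subst σ))

def spSubst (σ : Subst Sg) (φ : Spatial Sg) : Spatial Sg := φ.map (Atom.subst σ)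

open Classical in
noncomputable def puSubst (σ : Subst Sg) (ξ : Pure Sg) : Pure Sg := ξ.image (PAtom.subst σ)

noncomputable def SHeap.subst (σ : Subst Sg) (l : SHeap Sg) : SHeap Sg :=
  ⟨spSubst σ l.sp, puSubst σ l.pu⟩

open Classical in
/-- The substitution `{x ← t}`. -/
noncomputable def single {s : Sg.Srt} (x : Sg.Var s) (t : Term Sg s) : Subst Sg :=
  Function.update (fun _ => Term.var) s (Function.update Term.var x t)

/-! ### Instances of inductive rules -/

/-- The formal parameters of a rule, root first. -/
def Rule.formals (r : Rule Sg) : List (AnyVar Sg) :=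
  ⟨Sg.loc, r.root⟩ :: List.ofFn fun i => ⟨_, r.params i⟩

/-- The existential variables of a rule. -/
def Rule.exVars (r : Rule Sg) : Set (AnyVar Sg) := {v | v ∈ r.body.vars ∧ v ∉ r.formals}

/-- `RuleInst r A a l`: the symbolic heap `l` is obtained from the body of `r` by replacing the
formal parameters by the arguments of the predicate atom `a`, after renaming the existential
variables of `r` to pairwise distinct variables that are not in `A`. -/
inductive RuleInst (r : Rule Sg) (A : Set (AnyVar Sg)) : Atom Sg → SHeap Sg → Prop where
  | mk (τ : Subst Sg) (x : LVar Sg)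
      (ts : (i : Fin (Sg.arity r.head)) → Term Sg (Sg.argSort r.head i))
      (hroot : τ Sg.loc r.root = .var x)
      (hparams : ∀ i, τ _ (r.params i) = ts i)
      (hfresh : ∀ v ∈ r.exVars, ∃ w, τ v.1 v.2 = .var w ∧ (⟨v.1, w⟩ : AnyVar Sg) ∉ A)
      (hinj : ∀ v ∈ r.exVars, ∀ w ∈ r.exVars,
        (⟨v.1, τ v.1 v.2⟩ : AnyTerm Sg) = ⟨w.1, τ w.1 w.2⟩ → v = w) :
      RuleInst r A (.pred r.head x ts) (r.body.subst τ)

/-- `a ⇐_R l`. -/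
def Unfolds (R : Finset (Rule Sg)) (a : Atom Sg) (l : SHeap Sg) : Prop :=
  ∃ r ∈ R, RuleInst r a.vars a l

end

/-! ## Semantics -/

/-- Elements of the universe, of any sort. -/
abbrev AnyVal (Sg : Signature) := Σ s, Sg.Univ s

/-- Stores; constants are interpreted by `Sg.cval`. -/
abbrev Store (Sg : Signature) := (s : Sg.Srt) → Sg.Var s → Sg.Univ s

/-- Heaps: finite partial functions from locations to tuples of elements of the universe. -/
abbrev Heap (Sg : Signature) := Finmap fun _ : Sg.Univ Sg.loc => List (AnyVal Sg)

section
variable {Sg : Signature}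

def Store.eval (st : Store Sg) {s : Sg.Srt} : Term Sg s → Sg.Univ s
  | .var x => st s x
  | .cst c => Sg.cval s c

def Store.evalAny (st : Store Sg) (t : AnyTerm Sg) : AnyVal Sg := ⟨t.1, st.eval t.2⟩

/-- The store satisfies an equation or disequation. -/
def PAtom.Holds (st : Store Sg) : PAtom Sg → Prop
  | .eq _ e => (e.map st.eval).IsDiag
  | .ne _ e => ¬ (e.map st.eval).IsDiag

def PureHolds (st : Store Sg) (ξ : Pure Sg) : Prop := ∀ e ∈ ξ, e.Holds st

open Classical in
/-- Satisfaction of spatial formulas modulo a set of inductive rules (least relation). -/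
inductive SpModels (R : Finset (Rule Sg)) : Store Sg → Heap Sg → Spatial Sg → Prop where
  | emp (st : Store Sg) : SpModels R st ∅ 0
  | pto (st : Store Sg) (x : LVar Sg) (ts : List (AnyTerm Sg)) :
      SpModels R st (Finmap.singleton (st Sg.loc x) (ts.map st.evalAny)) {.pto x ts}
  | sep (st : Store Sg) (h₁ h₂ : Heap Sg) (φ₁ φ₂ : Spatial Sg) (hdisj : h₁.Disjoint h₂)
      (m₁ : SpModels R st h₁ φ₁) (m₂ : SpModels R st h₂ φ₂) :
      SpModels R st (h₁ ∪ h₂) (φ₁ + φ₂)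
  | pred (st st' : Store Sg) (h : Heap Sg) (p : Sg.Pred) (x : LVar Sg)
      (ts : (i : Fin (Sg.arity p)) → Term Sg (Sg.argSort p i)) (l : SHeap Sg)
      (hunf : Unfolds R (.pred p x ts) l)
      (hst : ∀ s (y : Sg.Var s),
        (⟨s, y⟩ : AnyVar Sg) ∉ l.vars \ (Atom.pred p x ts).vars → st' s y = st s y)
      (hpure : PureHolds st' l.pu) (m : SpModels R st' h l.sp) :
      SpModels R st h {.pred p x ts}

/-- Satisfaction of symbolic heaps. -/
def Models (R : Finset (Rule Sg)) (st : Store Sg) (h : Heap Sg) (l : SHeap Sg) : Prop :=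
  SpModels R st h l.sp ∧ PureHolds st l.pu

/-- Counter-models: the last condition says that the store is injective on the multiset `V`. -/
def Sequent.CounterModel (R : Finset (Rule Sg)) (S : Sequent Sg) (st : Store Sg) (h : Heap Sg) :
    Prop :=
  Models R st h S.lhs ∧ ¬ Models R st h S.rhs ∧ (∀ x ∈ S.V, st Sg.loc x ∉ h) ∧
    (S.V.map (st Sg.loc)).Nodup

def Sequent.Valid (R : Finset (Rule Sg)) (S : Sequent Sg) : Prop :=
  ∀ st h, ¬ S.CounterModel R st h

/-! ## Classes of inductive rules -/

/-- `P`-rules `p(x₁,…,xₙ) ⇐ x₁ ↦ (y₁,…,yₖ) * q₁(z₁,u₁) * … * qₘ(zₘ,uₘ) ⋏ ξ`. -/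
def Rule.IsPRule (r : Rule Sg) : Prop :=
  ∃ (ys : List (AnyTerm Sg)) (qs : Spatial Sg),
    r.body.sp = .pto r.root ys ::ₘ qs ∧ (∀ a ∈ qs, a.IsPred) ∧
    -- disequations `u ≉ v` of distinct terms, `u` a parameter or a `yᵢ`, `v` a non-parameter `yᵢ`
    (∀ e ∈ r.body.pu, ∃ (s : Sg.Srt) (u v : Term Sg s), e = .ne s s(u, v) ∧ u ≠ v ∧
      ((⟨s, u⟩ : AnyTerm Sg) ∈ r.formals.map AnyVar.toTerm ∨ (⟨s, u⟩ : AnyTerm Sg) ∈ ys) ∧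
      (⟨s, v⟩ : AnyTerm Sg) ∈ ys ∧ (⟨s, v⟩ : AnyTerm Sg) ∉ r.formals.map AnyVar.toTerm) ∧
    -- the roots `zᵢ` are pairwise distinct and are the existential location variables among the `yᵢ`
    (alloc qs).Nodup ∧
    (∀ z : LVar Sg, z ∈ alloc qs ↔ lterm z ∈ ys ∧ (⟨Sg.loc, z⟩ : AnyVar Sg) ∉ r.formals) ∧
    -- all arguments are parameters, `yᵢ`'s or constants
    (∀ a ∈ qs, ∀ t ∈ a.terms.tail,
      t ∈ r.formals.map AnyVar.toTerm ∨ t ∈ ys ∨ ∃ s c, t = ⟨s, .cst c⟩)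

/-- No two distinct rules of the same predicate overlap: the conjunction of the equations between
the parameters and between the tuples of the two rules and of their pure parts is unsatisfiable.
Using one store for each rule amounts to renaming the rules apart. -/
def Deterministic (R : Finset (Rule Sg)) : Prop :=
  ∀ r₁ ∈ R, ∀ r₂ ∈ R, r₁ ≠ r₂ → r₁.head = r₂.head →
    ∀ ys₁ ys₂, .pto r₁.root ys₁ ∈ r₁.body.sp → .pto r₂.root ys₂ ∈ r₂.body.sp →
      ¬ ∃ st₁ st₂ : Store Sg,
        (r₁.formals.map AnyVar.toTerm).map st₁.evalAny =
          (r₂.formals.map AnyVar.toTerm).map st₂.evalAny ∧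
        ys₁.map st₁.evalAny = ys₂.map st₂.evalAny ∧
        PureHolds st₁ r₁.body.pu ∧ PureHolds st₂ r₂.body.pu

/-- A `loc`-deterministic set of `P`-rules. -/
def LocDeterministic (R : Finset (Rule Sg)) : Prop :=
  (∀ r ∈ R, r.IsPRule) ∧ Deterministic R ∧
    ∀ r ∈ R, ∀ e ∈ r.body.pu, ∃ x y : LVar Sg, e = .ne Sg.loc s(.var x, .var y)

/-- Productive predicate symbols. -/
inductive Productive (R : Finset (Rule Sg)) : Sg.Pred → Prop where
  | mk (r : Rule Sg) (hr : r ∈ R)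
      (hq : ∀ q x ts, .pred q x ts ∈ r.body.sp → Productive R q) : Productive R r.head

/-- `Out R p i`: the parameter number `i` of `p` is an outgoing parameter.  Parameters are numbered
from `0`, the number of the root. -/
inductive Out (R : Finset (Rule Sg)) : Sg.Pred → ℕ → Prop where
  | pto (r : Rule Sg) (hr : r ∈ R) (i : ℕ) (x : LVar Sg) (hi : r.formals[i]? = some ⟨Sg.loc, x⟩)
      (ts : List (AnyTerm Sg)) (hmem : .pto r.root ts ∈ r.body.sp) (hx : lterm x ∈ ts) :
      Out R r.head i
  | pred (r : Rule Sg) (hr : r ∈ R) (i : ℕ) (x : LVar Sg) (hi : r.formals[i]? = some ⟨Sg.loc, x⟩)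
      (q : Sg.Pred) (y : LVar Sg) (ts : (i : Fin (Sg.arity q)) → Term Sg (Sg.argSort q i))
      (hmem : .pred q y ts ∈ r.body.sp) (j : ℕ) (hj : Out R q j)
      (hx : (Atom.pred q y ts).terms[j]? = some (lterm x)) :
      Out R r.head i

/-- Every non-root parameter of sort `loc` is outgoing. -/
def NoUselessParam (R : Finset (Rule Sg)) : Prop :=
  ∀ (p : Sg.Pred) (i : Fin (Sg.arity p)), Sg.argSort p i = Sg.loc → Out R p (i + 1)

/-- Number of parameters of a predicate atom, number of record fields of a points-to atom. -/
def Atom.width : Atom Sg → ℕ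
  | .pto _ ts => ts.length
  | .pred p _ _ => Sg.arity p + 1

/-- The maximal arity of the predicate symbols and of the records occurring in `R`. -/
def width (R : Finset (Rule Sg)) : ℕ :=
  R.sup fun r => max (Sg.arity r.head + 1) (r.body.sp.map Atom.width).sup

/-! ## The proof procedure -/

/-- `l ▷_V ξ`. -/
def Entails (l : SHeap Sg) (V : Multiset (LVar Sg)) (ξ : Pure Sg) : Prop :=
  ∀ e ∈ ξ, e ∈ l.pu ∨ (∃ s t, e = .eq s s(t, t)) ∨
    (∃ s c d, c ≠ d ∧ e = .ne s s(.cst c, .cst d)) ∨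
    ∃ x y : LVar Sg, e = .ne Sg.loc s(.var x, .var y) ∧ {x, y} ≤ alloc l.sp + V

/-- `x →_φ y`. -/
def Edge (R : Finset (Rule Sg)) (φ : Spatial Sg) (x y : LVar Sg) : Prop :=
  (∃ ts, .pto x ts ∈ φ ∧ lterm y ∈ ts) ∨
    ∃ p ts i, .pred p x ts ∈ φ ∧ Out R p i ∧ (Atom.pred p x ts).terms[i]? = some (lterm y)

def Sequent.IsAxiom (S : Sequent Sg) : Prop :=
  (S.lhs.sp = S.rhs.sp ∧ S.rhs.pu ⊆ S.lhs.pu) ∨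
  (∃ s t, PAtom.ne s s(t, t) ∈ S.lhs.pu) ∨
  ¬ (alloc S.lhs.sp).Nodup ∨
  (∃ x ∈ alloc S.lhs.sp, x ∈ S.V) ∨ ¬ S.V.Nodup

def Sequent.IsAntiAxiom (R : Finset (Rule Sg)) (S : Sequent Sg) : Prop :=
  ¬ S.IsAxiom ∧ EqFree S.lhs.pu ∧ S.rhs.pu = ∅ ∧
  ((∃ x ∈ alloc S.rhs.sp, x ∉ alloc S.lhs.sp) ∨
    (S.rhs.sp = 0 ∧ S.lhs.sp ≠ 0) ∨
    (∃ x ∈ alloc S.lhs.sp, x ∉ alloc S.rhs.sp ∧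
      ∀ y ∈ alloc S.rhs.sp, ¬ Relation.ReflTransGen (Edge R S.lhs.sp) y x) ∨
    (∃ x ∈ S.V, (⟨Sg.loc, x⟩ : AnyVar Sg) ∈ spVars S.lhs.sp ∧
      (⟨Sg.loc, x⟩ : AnyVar Sg) ∉ spVars S.rhs.sp) ∨
    (∃ x : LVar Sg, (⟨Sg.loc, x⟩ : AnyVar Sg) ∈ spVars S.lhs.sp ∧
      (⟨Sg.loc, x⟩ : AnyVar Sg) ∉ spVars S.rhs.sp ∧ x ∉ alloc S.lhs.sp))

/-- The location variables of the right-hand side that are neither in `V` nor allocated by the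
right-hand side. -/
def Sequent.narrowVars (S : Sequent Sg) : Set (LVar Sg) :=
  {x | (⟨Sg.loc, x⟩ : AnyVar Sg) ∈ S.rhs.vars ∧ x ∉ S.V ∧ x ∉ alloc S.rhs.sp}

def Sequent.Narrow (R : Finset (Rule Sg)) (S : Sequent Sg) : Prop :=
  S.EqualityFree ∧ S.narrowVars.encard ≤ (width R : ℕ∞)

end

/-- Rule applications: a rule name with an assignment of its schematic variables.  In `U`, the list
`E` contains one pair (inductive rule, instance of its body) for each inductive rule defining `p`. -/
inductive App (Sg : Signature) where
  | ruleR (φ : Spatial Sg) (ξ : Pure Sg) (V : Multiset (LVar Sg)) (γ : SHeap Sg)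
      (s : Sg.Srt) (x : Sg.Var s) (t : Term Sg s) : App Sg
  | ruleE (l : SHeap Sg) (V : Multiset (LVar Sg)) (ψ : Spatial Sg) (ζ ζ' : Pure Sg) : App Sg
  | ruleS (φ₁ φ₂ : Spatial Sg) (ξ₁ ξ₂ : Pure Sg) (V : Multiset (LVar Sg))
      (ψ₁ ψ₂ : Spatial Sg) (ζ₁ ζ₂ : Pure Sg) : App Sg
  | ruleU (p : Sg.Pred) (x : LVar Sg) (ts : (i : Fin (Sg.arity p)) → Term Sg (Sg.argSort p i))
      (φ : Spatial Sg) (ξ : Pure Sg) (V : Multiset (LVar Sg)) (γ : SHeap Sg)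
      (E : List (Rule Sg × SHeap Sg)) : App Sg
  | ruleI (x : LVar Sg) (ys : List (AnyTerm Sg)) (φ : Spatial Sg) (ξ : Pure Sg)
      (V : Multiset (LVar Sg)) (p : Sg.Pred)
      (zs : (i : Fin (Sg.arity p)) → Term Sg (Sg.argSort p i)) (ψ : Spatial Sg) (ζ : Pure Sg)
      (us : List (AnyTerm Sg)) (ψ' : Spatial Sg) (ζ' : Pure Sg) (σ : Subst Sg) : App Sg
  | ruleW (φ : Spatial Sg) (ξ ξ' : Pure Sg) (V : Multiset (LVar Sg)) (γ : SHeap Sg) : App Sg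
  | ruleC (φ : Spatial Sg) (ξ : Pure Sg) (V : Multiset (LVar Sg)) (γ : SHeap Sg)
      (x y : LVar Sg) : App Sg
  | ruleV (l : SHeap Sg) (V : Multiset (LVar Sg)) (γ : SHeap Sg) (x : LVar Sg) : App Sg

section
variable {Sg : Signature}

open Classical in
/-- The conclusion of a rule application. -/
noncomputable def App.concl : App Sg → Sequent Sg
  | .ruleR φ ξ V γ s x t => ⟨⟨φ, insert (.eq s s(.var x, t)) ξ⟩, V, γ⟩
  | .ruleE l V ψ ζ ζ' => ⟨l, V, ⟨ψ, ζ ∪ ζ'⟩⟩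
  | .ruleS φ₁ φ₂ ξ₁ ξ₂ V ψ₁ ψ₂ ζ₁ ζ₂ => ⟨⟨φ₁ + φ₂, ξ₁ ∪ ξ₂⟩, V, ⟨ψ₁ + ψ₂, ζ₁ ∪ ζ₂⟩⟩
  | .ruleU p x ts φ ξ V γ _ => ⟨⟨.pred p x ts ::ₘ φ, ξ⟩, V, γ⟩
  | .ruleI x ys φ ξ V p zs ψ ζ _ _ _ _ => ⟨⟨.pto x ys ::ₘ φ, ξ⟩, V, ⟨.pred p x zs ::ₘ ψ, ζ⟩⟩
  | .ruleW φ ξ ξ' V γ => ⟨⟨φ, ξ ∪ ξ'⟩, V, γ⟩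
  | .ruleC φ ξ V γ _ _ => ⟨⟨φ, ξ⟩, V, γ⟩
  | .ruleV l V γ x => ⟨l, x ::ₘ V, γ⟩

open Classical in
/-- The premises of a rule application. -/
noncomputable def App.prems : App Sg → List (Sequent Sg)
  | .ruleR φ ξ V γ _ x t =>
      [⟨SHeap.subst (single x t) ⟨φ, ξ⟩, V.map (single x t).onLoc, γ.subst (single x t)⟩]
  | .ruleE l V ψ ζ _ => [⟨l, V, ⟨ψ, ζ⟩⟩]
  | .ruleS φ₁ φ₂ ξ₁ ξ₂ V ψ₁ ψ₂ ζ₁ ζ₂ =>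
      [⟨⟨φ₁, ξ₁⟩, V + alloc φ₂, ⟨ψ₁, ζ₁⟩⟩, ⟨⟨φ₂, ξ₂⟩, V + alloc φ₁, ⟨ψ₂, ζ₂⟩⟩]
  | .ruleU _ _ _ φ ξ V γ E => E.map fun q => ⟨⟨q.2.sp + φ, q.2.pu ∪ ξ⟩, V, γ⟩
  | .ruleI x ys φ ξ V _ _ ψ ζ _ ψ' _ σ =>
      [⟨⟨.pto x ys ::ₘ φ, ξ⟩, V, ⟨.pto x ys ::ₘ (spSubst σ ψ' + ψ), ζ⟩⟩]
  | .ruleW φ ξ _ V γ => [⟨⟨φ, ξ⟩, V, γ⟩]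
  | .ruleC φ ξ V γ x y =>
      [⟨SHeap.subst (single x (.var y)) ⟨φ, ξ⟩, V.map (single x (.var y)).onLoc,
          γ.subst (single x (.var y))⟩,
        ⟨⟨φ, insert (.ne Sg.loc s(.var x, .var y)) ξ⟩, V, γ⟩]
  | .ruleV l V γ _ => [⟨l, V, γ⟩]

/-- The application conditions of the inference rules.  Pure formulas are considered without
repetitions, hence in `R`, `E` and `W` the conjuncts acted upon are disjoint from the others; in `E`
and `W` they are not `⊤`. -/
def App.Side (R : Finset (Rule Sg)) : App Sg → Prop
  | .ruleR _ ξ _ _ s x t => PAtom.eq s s(.var x, t) ∉ ξ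
  | .ruleE l V _ ζ ζ' => ζ' ≠ ∅ ∧ Disjoint ζ ζ' ∧ Entails l V ζ'
  | .ruleS φ₁ φ₂ _ _ _ _ _ _ _ => φ₁ ≠ 0 ∧ φ₂ ≠ 0
  | .ruleU p x ts φ ξ V γ E =>
      (E.map Prod.fst).Nodup ∧ (∀ r, r ∈ E.map Prod.fst ↔ r ∈ R ∧ r.head = p) ∧
      ∀ q ∈ E, RuleInst q.1 (Sequent.vars ⟨⟨.pred p x ts ::ₘ φ, ξ⟩, V, γ⟩) (.pred p x ts) q.2
  | .ruleI x ys φ ξ V p zs _ _ us ψ' ζ' σ =>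
      Unfolds R (.pred p x zs) ⟨.pto x us ::ₘ ψ', ζ'⟩ ∧
      (∀ s (v : Sg.Var s), σ s v ≠ .var v →
        (⟨s, .var v⟩ : AnyTerm Sg) ∈ us ∧ (⟨s, v⟩ : AnyVar Sg) ∉ (Atom.pred p x zs).vars) ∧
      us.map (AnyTerm.subst σ) = ys ∧
      Entails ⟨.pto x ys ::ₘ φ, ξ⟩ V (puSubst σ ζ')
  | .ruleW φ ξ ξ' V γ => ξ' ≠ ∅ ∧ Disjoint ξ ξ' ∧
      ((∃ s t u, ξ' = {.ne s s(t, u)} ∧ Entails ⟨φ, ∅⟩ V ξ') ∨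
        ∃ (s : Sg.Srt) (x : Sg.Var s),
          (∀ e ∈ ξ', ∃ t, t ≠ .var x ∧ e = .ne s s(.var x, t)) ∧
          (⟨s, x⟩ : AnyVar Sg) ∉ spVars φ ∪ puVars ξ ∪ γ.vars)
  | .ruleC _ _ _ _ _ _ => True
  | .ruleV l _ γ x => (⟨Sg.loc, x⟩ : AnyVar Sg) ∉ l.vars ∪ γ.vars

/-- The priority of the rules: `W > V > R > E > S > U > C > I`. -/
def App.priority : App Sg → ℕ
  | .ruleW .. => 7
  | .ruleV .. => 6
  | .ruleR .. => 5
  | .ruleE .. => 4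
  | .ruleS .. => 3
  | .ruleU .. => 2
  | .ruleC .. => 1
  | .ruleI .. => 0

/-- The application is an application of the separation rule. -/
def App.IsS : App Sg → Prop
  | .ruleS .. => True
  | _ => False

end

/-- Selection functions, on sets of atoms and on sets of rule applications. -/
structure Selection (Sg : Signature) where
  atom : Finset (Atom Sg) → Atom Sg
  atom_mem : ∀ A : Finset (Atom Sg), A.Nonempty → atom A ∈ A
  app : Set (App Sg) → App Sg
  app_mem : ∀ A : Set (App Sg), A.Nonempty → app A ∈ A

section
variable {Sg : Signature}

open Classical in
/-- The conditions of the strategy that are specific to one rule. -/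
def App.Strategy (R : Finset (Rule Sg)) (sel : Selection Sg) : App Sg → Prop
  | .ruleI _ _ _ _ _ _ _ ψ ζ _ _ _ _ => ζ = ∅ ∧ ψ = 0
  | .ruleU _ x _ _ _ _ γ _ => γ.pu = ∅ ∧ ∃ b : Atom Sg, γ.sp = {b} ∧ b.root = x
  | .ruleC φ ξ V γ x y =>
      γ.pu = ∅ ∧ (∃ b : Atom Sg, γ.sp = {b} ∧ b.IsPred) ∧ x ∈ alloc φ ∧
      (⟨Sg.loc, y⟩ : AnyVar Sg) ∈ γ.vars ∧ y ∉ alloc φ ∧ y ∉ V ∧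
      PAtom.ne Sg.loc s(.var x, .var y) ∉ ξ
  | .ruleS φ₁ φ₂ ξ₁ ξ₂ V ψ₁ ψ₂ ζ₁ ζ₂ =>
      ξ₁ = ξ₂ ∧ ζ₁ = ∅ ∧ ζ₂ = ∅ ∧ ψ₁ = {sel.atom (ψ₁ + ψ₂).toFinset} ∧
      (¬ (App.ruleS φ₁ φ₂ ξ₁ ξ₂ V ψ₁ ψ₂ ζ₁ ζ₂).concl.Narrow R →
        Sequent.Valid R ⟨⟨φ₁, ξ₁⟩, V + alloc φ₂, ⟨ψ₁, ζ₁⟩⟩)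
  | _ => True

/-- The rule application satisfies the application conditions and all the conditions of the
strategy other than priority and selection. -/
def App.Possible (R : Finset (Rule Sg)) (sel : Selection Sg) (a : App Sg) : Prop :=
  a.Side R ∧ ¬ a.concl.IsAxiom ∧ ¬ a.concl.IsAntiAxiom R ∧ (∀ P ∈ a.prems, ¬ P.IsAntiAxiom R) ∧
    a.Strategy R sel

/-- Admissible rule applications: the application is possible, no rule of higher priority is
possible on the same sequent, and, except for the rule `S` on narrow sequents, the application is
the one selected among all possible applications of the same rule to the same sequent. -/
def App.Admissible (R : Finset (Rule Sg)) (sel : Selection Sg) (a : App Sg) : Prop :=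
  a.Possible R sel ∧
  (∀ b : App Sg, b.concl = a.concl → b.Possible R sel → b.priority ≤ a.priority) ∧
  ((a.IsS ∧ a.concl.Narrow R) ∨
    a = sel.app {b | b.concl = a.concl ∧ b.priority = a.priority ∧ b.Possible R sel})

/-- Possibly infinite proof trees.  The nodes are the positions `π` with `label π ≠ none`; the root
is `[]`, and the `i`-th child of `π` is `i :: π`.  `step π` is the rule application at node `π`
(`none` if no rule is applied). -/
structure ProofTree (R : Finset (Rule Sg)) where
  label : List ℕ → Option (Sequent Sg)
  step : List ℕ → Option (App Sg)
  root_ne : label [] ≠ none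
  step_ok : ∀ π a, step π = some a → label π = some a.concl ∧ a.Side R
  child : ∀ π i, label (i :: π) = (step π).bind fun a => a.prems[i]?

def ProofTree.Admissible {R : Finset (Rule Sg)} (T : ProofTree R) (sel : Selection Sg) : Prop :=
  ∀ π a, T.step π = some a → a.Admissible R sel

/-- All leaves are axioms. -/
def ProofTree.FullyExpanded {R : Finset (Rule Sg)} (T : ProofTree R) : Prop :=
  ∀ π S, T.label π = some S → (∀ i, T.label (i :: π) = none) → S.IsAxiom

/-- The equations of `ξ` do not identify two distinct constants, and `ξ` contains no trivial
equation `t ≈ t` where `t` is a constant or is identified with a constant by the equations of `ξ`. -/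
def ConstantsSeparated (ξ : Pure Sg) : Prop :=
  ∀ (s : Sg.Srt) (t : Term Sg s) (c : Sg.Cst s),
    Relation.EqvGen (fun a b => PAtom.eq s s(a, b) ∈ ξ) t (.cst c) →
      PAtom.eq s s(t, t) ∉ ξ ∧ ∀ d, t = .cst d → d = c

end

end SL

/-!
# Valid sequents have admissible fully expanded proof trees

The core of the argument is that every valid sequent that is not an axiom is the conclusion of an
admissible rule application with valid premises (`SL.exists_admissible`).  The tree is then grown by
choosing such an application at every node; a node to which no rule is applied is an axiom, because
every rule application has a premise (`SL.App.prems_ne_nil`), predicate symbols being productive.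

Satisfaction is first restated at the level of values (`SL.VM`, `SL.models_iff`), where predicate
atoms are unfolded by a store for the variables of the rule and no renaming is involved.  Three
properties of this relation carry the proof.

* By determinism, a spatial formula has at most one model inside a given heap (`SL.VM.unique`).
* Productivity yields a model as soon as the roots have distinct values; the model avoids any given
  finite set of locations and, since all location parameters are outgoing, can be made to contain
  any given argument of an atom in some record (`SL.Adm.exists_model`).
* As the disequations of the rules always involve an allocated location, models are preserved by the
  maps on values that identify no allocated location with another one (`SL.VM.image`).

Evaluation in a generic store, which is injective and avoids the constants, reads off the syntactic
properties of valid sequents: anti-axioms are not valid (`SL.Sequent.IsAntiAxiom.not_valid`), and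
disequations on the right-hand side are entailed (`SL.entails_of_valid`).  All rules other than `S`
preserve validity from the conclusion to the premises (`SL.App.prems_valid`).

The heart of the proof is the rule `S`: if `φ ⊢ ψ₁ * ψ₂` is valid, then `φ` can be written as `φ₁ *
φ₂` so that both premises are valid (`SL.exists_valid_split`).  A generic model provides the
splitting, since in such a model the part of the heap described by an atom of `φ` lies on one side
only.  It remains valid in an arbitrary store, to which the generic store is specialized one
variable at a time: the new value of the variable is allocated on one side at most, so that the
models of the other side are preserved (`SL.SumValid.good_insert`), and uniqueness of models inside
a heap propagates correctness from one model of one side to all the models of both sides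
(`SL.SumValid.good_of_right`).

Finally, on a valid sequent that is not an axiom some rule application is possible
(`SL.exists_possible`): `R` or `E` if an equation or a conjunct on the right-hand side can be
removed, `S` if the right-hand side has at least two atoms, and otherwise `U`, `C` or `I`.  An
application of the highest priority is chosen; if it is an application of `S` to a narrow sequent,
it is replaced by the one with valid premises.
-/

namespace SL
open scoped Classical
variable {Sg : Signature}

/-! ### Variables, evaluation and substitution -/

/-- The composition of a substitution and a store. -/
def Store.comp (st : Store Sg) (σ : Subst Sg) : Store Sg := fun s x => st.eval (σ s x)

theorem AnyVar.toTerm_injective : Function.Injective (AnyVar.toTerm (Sg := Sg)) := by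
  rintro ⟨s, x⟩ ⟨t, y⟩ h
  simp only [AnyVar.toTerm, Sigma.mk.injEq] at h
  obtain ⟨rfl, h⟩ := h
  simpa using h

theorem mem_map_toTerm {L : List (AnyVar Sg)} {s : Sg.Srt} {x : Sg.Var s} :
    (⟨s, .var x⟩ : AnyTerm Sg) ∈ L.map AnyVar.toTerm ↔ (⟨s, x⟩ : AnyVar Sg) ∈ L :=
  List.mem_map_of_injective AnyVar.toTerm_injective (a := (⟨s, x⟩ : AnyVar Sg))

theorem var_toLVar (t : Term Sg Sg.loc) : Term.var t.toLVar = t := by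
  cases t with
  | var x => rfl
  | cst c => exact (Sg.cst_loc_isEmpty.false c).elim

theorem eval_subst (st : Store Sg) (σ : Subst Sg) {s : Sg.Srt} (t : Term Sg s) :
    st.eval (t.subst σ) = (st.comp σ).eval t := by
  cases t <;> rfl

theorem evalAny_subst (st : Store Sg) (σ : Subst Sg) (t : AnyTerm Sg) :
    st.evalAny (t.subst σ) = (st.comp σ).evalAny t := by
  obtain ⟨s, t⟩ := t
  simp only [Store.evalAny, AnyTerm.subst, eval_subst]

theorem onLoc_eval (st : Store Sg) (σ : Subst Sg) (x : LVar Sg) :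
    st Sg.loc (σ.onLoc x) = st.comp σ Sg.loc x := by
  change st.eval (Term.var (σ Sg.loc x).toLVar) = st.eval (σ Sg.loc x)
  rw [var_toLVar]

theorem holds_subst (st : Store Sg) (σ : Subst Sg) (e : PAtom Sg) :
    (e.subst σ).Holds st ↔ e.Holds (st.comp σ) := by
  cases e <;>
  · simp only [PAtom.subst, PAtom.Holds, Sym2.map_map]
    rw [show st.eval ∘ Term.subst σ = (st.comp σ).eval from funext fun t => eval_subst st σ t]

theorem pureHolds_subst (st : Store Sg) (σ : Subst Sg) (ξ : Pure Sg) :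
    PureHolds st (puSubst σ ξ) ↔ PureHolds (st.comp σ) ξ := by
  simp only [PureHolds, puSubst, Finset.forall_mem_image, holds_subst]

/-- Two stores agree on a set of variables. -/
def Agree (X : Set (AnyVar Sg)) (st st' : Store Sg) : Prop :=
  ∀ s (x : Sg.Var s), (⟨s, x⟩ : AnyVar Sg) ∈ X → st s x = st' s x

theorem Agree.mono {X Y : Set (AnyVar Sg)} {st st' : Store Sg} (h : Agree Y st st') (hX : X ⊆ Y) :
    Agree X st st' := fun s x hx => h s x (hX hx)

theorem evalAny_congr {st st' : Store Sg} (t : AnyTerm Sg)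
    (h : ∀ s (x : Sg.Var s), t = ⟨s, .var x⟩ → st s x = st' s x) :
    st.evalAny t = st'.evalAny t := by
  obtain ⟨s, t | c⟩ := t
  · simp only [Store.evalAny, Store.eval, h s t rfl]
  · rfl

theorem holds_congr {st st' : Store Sg} {e : PAtom Sg} (h : Agree e.vars st st') :
    e.Holds st ↔ e.Holds st' := by
  have key : ∀ (s : Sg.Srt) (z : Sym2 (Term Sg s)),
      (∀ x : Sg.Var s, Term.var x ∈ z → st s x = st' s x) → z.map st.eval = z.map st'.eval := by
    intro s z hz
    apply Sym2.map_congr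
    intro t ht
    cases t with
    | var x => exact hz x ht
    | cst c => rfl
  cases e with
  | eq s z => simp only [PAtom.Holds]; rw [key s z fun x hx => h s x ⟨x, rfl, hx⟩]
  | ne s z => simp only [PAtom.Holds]; rw [key s z fun x hx => h s x ⟨x, rfl, hx⟩]

theorem pureHolds_congr {st st' : Store Sg} {ξ : Pure Sg} (h : Agree (puVars ξ) st st') :
    PureHolds st ξ ↔ PureHolds st' ξ :=
  forall₂_congr fun e he => holds_congr (h.mono fun _ hv => ⟨e, he, hv⟩)

theorem Atom.mem_vars_iff {a : Atom Sg} {s : Sg.Srt} {x : Sg.Var s} :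
    (⟨s, x⟩ : AnyVar Sg) ∈ a.vars ↔ (⟨s, .var x⟩ : AnyTerm Sg) ∈ a.terms := Iff.rfl

theorem Atom.root_mem_vars (a : Atom Sg) : (⟨Sg.loc, a.root⟩ : AnyVar Sg) ∈ a.vars := by
  cases a <;> exact List.mem_cons_self

theorem Atom.vars_finite (a : Atom Sg) : a.vars.Finite :=
  Set.Finite.preimage AnyVar.toTerm_injective.injOn (List.finite_toSet a.terms)

theorem spVars_finite (φ : Spatial Sg) : (spVars φ).Finite := by
  have : spVars φ = ⋃ a ∈ {a | a ∈ φ}, a.vars := by ext; simp [spVars]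
  rw [this]
  exact Set.Finite.biUnion (by simp) fun a _ => a.vars_finite

theorem PAtom.vars_finite (e : PAtom Sg) : e.vars.Finite := by
  have key : ∀ (s : Sg.Srt) (z : Sym2 (Term Sg s)),
      {v : AnyVar Sg | ∃ x : Sg.Var s, v = ⟨s, x⟩ ∧ Term.var x ∈ z}.Finite := by
    intro s z
    induction z using Sym2.ind with | _ a b =>
    have : ({(⟨s, a⟩ : AnyTerm Sg), ⟨s, b⟩} : Set (AnyTerm Sg)).Finite := by simp
    refine (Set.Finite.preimage AnyVar.toTerm_injective.injOn this).subset ?_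
    rintro _ ⟨x, rfl, hx⟩
    rcases Sym2.mem_iff.1 hx with rfl | rfl
    · exact Or.inl rfl
    · exact Or.inr rfl
  cases e <;> exact key _ _

theorem puVars_finite (ξ : Pure Sg) : (puVars ξ).Finite := by
  have : puVars ξ = ⋃ e ∈ {e | e ∈ ξ}, e.vars := by ext; simp [puVars]
  rw [this]
  exact Set.Finite.biUnion ξ.finite_toSet fun a _ => a.vars_finite

theorem SHeap.vars_finite (l : SHeap Sg) : l.vars.Finite :=
  (spVars_finite _).union (puVars_finite _)

theorem Sequent.vars_finite (S : Sequent Sg) : S.vars.Finite := by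
  refine ((SHeap.vars_finite _).union (SHeap.vars_finite _)).union ?_
  refine (S.V.toFinset.finite_toSet.image fun x => (⟨Sg.loc, x⟩ : AnyVar Sg)).subset ?_
  rintro _ ⟨x, hx, rfl⟩
  exact ⟨x, by simpa using hx, rfl⟩

theorem Atom.terms_subst (σ : Subst Sg) (a : Atom Sg) :
    (a.subst σ).terms = a.terms.map (AnyTerm.subst σ) := by
  have : ∀ x, lterm (σ.onLoc x) = AnyTerm.subst σ (lterm x) := fun x => by
    simp only [lterm, AnyTerm.subst, Term.subst, Subst.onLoc, var_toLVar]
  cases a with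
  | pto x ts => simp [Atom.subst, Atom.terms, this]
  | pred p x ts =>
    simp only [Atom.subst, Atom.terms, this, List.map_cons, List.map_ofFn]
    rfl

theorem mem_vars_subst {σ : Subst Sg} {l : SHeap Sg} {s : Sg.Srt} {x w : Sg.Var s}
    (hx : (⟨s, x⟩ : AnyVar Sg) ∈ l.vars) (hw : σ s x = .var w) :
    (⟨s, w⟩ : AnyVar Sg) ∈ (l.subst σ).vars := by
  rcases hx with ⟨a, ha, hx⟩ | ⟨e, he, hx⟩
  · refine Or.inl ⟨a.subst σ, Multiset.mem_map_of_mem _ ha, ?_⟩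
    rw [Atom.mem_vars_iff, Atom.terms_subst]
    exact List.mem_map.2 ⟨_, Atom.mem_vars_iff.1 hx, by simp [AnyTerm.subst, Term.subst, hw]⟩
  · refine Or.inr ⟨e.subst σ, Finset.mem_image_of_mem _ he, ?_⟩
    cases e with
    | eq s' z =>
      obtain ⟨y, hy, hz⟩ := hx
      cases hy
      exact ⟨w, rfl, Sym2.mem_map.2 ⟨_, hz, hw⟩⟩
    | ne s' z =>
      obtain ⟨y, hy, hz⟩ := hx
      cases hy
      exact ⟨w, rfl, Sym2.mem_map.2 ⟨_, hz, hw⟩⟩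

/-- A family of values can be prescribed on the range of an injective family of variables. -/
theorem exists_extend {ι : Type*} {F : Sg.Srt → Type*} (k : ι → AnyVar Sg)
    (hk : Function.Injective k) (b : ∀ i, F (k i).1) (d : ∀ s, Sg.Var s → F s) :
    ∃ g : ∀ s, Sg.Var s → F s, (∀ i, g (k i).1 (k i).2 = b i) ∧
      ∀ s x, (∀ i, k i ≠ ⟨s, x⟩) → g s x = d s x := by
  let G : ∀ w : AnyVar Sg, F w.1 := fun w =>
    if h : ∃ i, k i = w then cast (congrArg (fun w : AnyVar Sg => F w.1) h.choose_spec) (b h.choose)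
    else d w.1 w.2
  have hG : ∀ i w (_ : k i = w), HEq (G w) (b i) := by
    intro i w hi
    have h : ∃ i, k i = w := ⟨i, hi⟩
    have : h.choose = i := hk (h.choose_spec.trans hi.symm)
    simp only [G, dif_pos h]
    refine (cast_heq _ _).trans ?_
    rw [this]
  refine ⟨fun s x => G ⟨s, x⟩, fun i => eq_of_heq (hG i _ rfl), fun s x h => ?_⟩
  exact dif_neg fun ⟨i, hi⟩ => h i hi

/-- The values of the formal parameters of a rule can be prescribed, since they are pairwise
distinct. -/
theorem exists_on_formals {F : Sg.Srt → Type*} (r : Rule Sg) (a : F Sg.loc)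
    (b : ∀ i, F (Sg.argSort r.head i)) (d : ∀ s, Sg.Var s → F s) :
    ∃ g : ∀ s, Sg.Var s → F s, g _ r.root = a ∧ (∀ i, g _ (r.params i) = b i) ∧
      ∀ s x, (⟨s, x⟩ : AnyVar Sg) ∉ r.formals → g s x = d s x := by
  have hnd := r.nodup
  rw [List.nodup_cons, List.nodup_ofFn] at hnd
  let k : Option (Fin (Sg.arity r.head)) → AnyVar Sg := fun
    | none => ⟨Sg.loc, r.root⟩
    | some i => ⟨_, r.params i⟩
  have hk : Function.Injective k := by
    rintro (_ | i) (_ | j) h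
    · rfl
    · exact (hnd.1 (List.mem_ofFn.2 ⟨j, h.symm⟩)).elim
    · exact (hnd.1 (List.mem_ofFn.2 ⟨i, h⟩)).elim
    · exact congrArg some (hnd.2 h)
  obtain ⟨g, hg, hd⟩ := exists_extend (F := F) k hk (fun | none => a | some i => b i) d
  refine ⟨g, hg none, fun i => hg (some i), fun s x hx => hd s x ?_⟩
  rintro (_ | i) h
  · exact hx (by rw [← h]; exact List.mem_cons_self)
  · exact hx (by rw [← h]; exact List.mem_cons_of_mem _ (List.mem_ofFn.2 ⟨i, rfl⟩))

theorem mem_formals {r : Rule Sg} {v : AnyVar Sg} :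
    v ∈ r.formals ↔ v = ⟨Sg.loc, r.root⟩ ∨ ∃ i, v = ⟨_, r.params i⟩ := by
  simp only [Rule.formals, List.mem_cons, List.mem_ofFn]
  exact or_congr Iff.rfl (exists_congr fun i => eq_comm)

theorem exists_injection_compl {α β : Type*} [Countable α] [Infinite β] {A : Set β}
    (hA : A.Finite) : ∃ f : α → β, Function.Injective f ∧ ∀ x, f x ∉ A := by
  have : Infinite (Aᶜ : Set β) := hA.infinite_compl.to_subtype
  obtain ⟨e, he⟩ := Countable.exists_injective_nat α
  exact ⟨fun x => (Infinite.natEmbedding (Aᶜ : Set β) (e x)).1,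
    fun x y h => he ((Infinite.natEmbedding _).injective (Subtype.ext h)), fun x =>
      (Infinite.natEmbedding (Aᶜ : Set β) (e x)).2⟩

/-- Every finite set of variables is avoided by an injective renaming. -/
theorem exists_fresh_renaming {A : Set (AnyVar Sg)} (hA : A.Finite) :
    ∃ f : ∀ s, Sg.Var s → Sg.Var s, (∀ s, Function.Injective (f s)) ∧
      ∀ s x, (⟨s, f s x⟩ : AnyVar Sg) ∉ A := by
  have : ∀ s, ∃ f : Sg.Var s → Sg.Var s, Function.Injective f ∧
      ∀ x, (⟨s, f x⟩ : AnyVar Sg) ∉ A := fun s => by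
    have := Sg.var_countable s
    have := Sg.var_infinite s
    exact exists_injection_compl
      (hA.preimage (f := fun x : Sg.Var s => (⟨s, x⟩ : AnyVar Sg)) sigma_mk_injective.injOn)
  choose f hf hA using this
  exact ⟨f, hf, hA⟩

/-- Every predicate atom has an instance of each rule, with fresh existential variables. -/
theorem exists_ruleInst (r : Rule Sg) {A : Set (AnyVar Sg)} (hA : A.Finite) (x : LVar Sg)
    (ts : (i : Fin (Sg.arity r.head)) → Term Sg (Sg.argSort r.head i)) :
    ∃ (τ : Subst Sg) (f : ∀ s, Sg.Var s → Sg.Var s), (∀ s, Function.Injective (f s)) ∧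
      τ _ r.root = .var x ∧ (∀ i, τ _ (r.params i) = ts i) ∧
      (∀ s y, (⟨s, y⟩ : AnyVar Sg) ∉ r.formals → τ s y = .var (f s y)) ∧
      (∀ s y, (⟨s, f s y⟩ : AnyVar Sg) ∉ A) ∧
      RuleInst r A (.pred r.head x ts) (r.body.subst τ) := by
  obtain ⟨f, hf, hfA⟩ := exists_fresh_renaming hA
  obtain ⟨τ, h1, h2, h3⟩ := exists_on_formals (F := Term Sg) r (.var x) ts fun s y => .var (f s y)
  refine ⟨τ, f, hf, h1, h2, h3, hfA, .mk τ x ts h1 h2 ?_ ?_⟩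
  · rintro ⟨s, y⟩ hv
    exact ⟨f s y, h3 s y hv.2, hfA s y⟩
  · rintro ⟨s, y⟩ hv ⟨s', y'⟩ hw h
    simp only [h3 s y hv.2, h3 s' y' hw.2, Sigma.mk.injEq] at h
    obtain ⟨rfl, h⟩ := h
    simp only [heq_eq_eq, Term.var.injEq] at h
    rw [hf s h]

/-! ### Heaps -/

/-- Locations. -/
abbrev Loc (Sg : Signature) := Sg.Univ Sg.loc

/-- `h₁` is a part of `h₂`. -/
def HSub (h₁ h₂ : Heap Sg) : Prop := ∀ l vs, h₁.lookup l = some vs → h₂.lookup l = some vs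

theorem HSub.rfl {h : Heap Sg} : HSub h h := fun _ _ hl => hl

theorem HSub.trans {h₁ h₂ h₃ : Heap Sg} (h : HSub h₁ h₂) (h' : HSub h₂ h₃) : HSub h₁ h₃ :=
  fun l vs hl => h' l vs (h l vs hl)

theorem HSub.mem {h₁ h₂ : Heap Sg} (h : HSub h₁ h₂) {l : Loc Sg} (hl : l ∈ h₁) : l ∈ h₂ := by
  obtain ⟨vs, hvs⟩ := Finmap.mem_iff.1 hl
  exact Finmap.mem_of_lookup_eq_some (h l vs hvs)

theorem hsub_left (h₁ h₂ : Heap Sg) : HSub h₁ (h₁ ∪ h₂) := fun l _ hl => by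
  rw [Finmap.lookup_union_left (Finmap.mem_of_lookup_eq_some hl), hl]

theorem hsub_right {h₁ h₂ : Heap Sg} (h : h₁.Disjoint h₂) : HSub h₂ (h₁ ∪ h₂) := fun l _ hl => by
  rw [Finmap.lookup_union_right fun h' => h l h' (Finmap.mem_of_lookup_eq_some hl), hl]

theorem lookup_union_some {h₁ h₂ : Heap Sg} (h : h₁.Disjoint h₂) {l : Loc Sg}
    {vs : List (AnyVal Sg)} :
    (h₁ ∪ h₂).lookup l = some vs ↔ h₁.lookup l = some vs ∨ h₂.lookup l = some vs := by
  constructor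
  · intro hl
    by_cases hm : l ∈ h₁
    · rw [Finmap.lookup_union_left hm] at hl; exact Or.inl hl
    · rw [Finmap.lookup_union_right hm] at hl; exact Or.inr hl
  · rintro (hl | hl)
    · exact hsub_left _ _ _ _ hl
    · exact hsub_right h _ _ hl

theorem heap_ext {h₁ h₂ : Heap Sg} (h : HSub h₁ h₂) (h' : HSub h₂ h₁) : h₁ = h₂ :=
  Finmap.ext_lookup fun l => Option.ext fun vs => ⟨h l vs, h' l vs⟩

theorem union_left_comm_of_disjoint {a b c : Heap Sg} (h : a.Disjoint b) :
    a ∪ (b ∪ c) = b ∪ (a ∪ c) := by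
  rw [← Finmap.union_assoc, Finmap.union_comm_of_disjoint h, Finmap.union_assoc]

theorem lookup_singleton_some {l l' : Loc Sg} {vs vs' : List (AnyVal Sg)} :
    (Finmap.singleton l vs : Heap Sg).lookup l' = some vs' ↔ l' = l ∧ vs' = vs := by
  constructor
  · intro h
    have := Finmap.mem_of_lookup_eq_some h
    rw [Finmap.mem_singleton] at this
    subst this
    rw [Finmap.lookup_singleton_eq] at h
    exact ⟨rfl, (Option.some.inj h).symm⟩
  · rintro ⟨rfl, rfl⟩
    exact Finmap.lookup_singleton_eq

/-! ### Satisfaction at the level of values -/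

/-- Spatial atoms whose arguments are values. -/
inductive VAtom (Sg : Signature) where
  | pto (l : Loc Sg) (vs : List (AnyVal Sg)) : VAtom Sg
  | pred (p : Sg.Pred) (l : Loc Sg)
      (args : (i : Fin (Sg.arity p)) → Sg.Univ (Sg.argSort p i)) : VAtom Sg

/-- The location allocated by an atom. -/
def VAtom.root : VAtom Sg → Loc Sg
  | .pto l _ => l
  | .pred _ l _ => l

/-- The list of values occurring in an atom, starting with the root. -/
def VAtom.vals : VAtom Sg → List (AnyVal Sg)
  | .pto l vs => ⟨Sg.loc, l⟩ :: vs
  | .pred _ l args => ⟨Sg.loc, l⟩ :: List.ofFn fun i => ⟨_, args i⟩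

/-- The value of an atom in a store. -/
def Atom.eval (st : Store Sg) : Atom Sg → VAtom Sg
  | .pto x ts => .pto (st _ x) (ts.map st.evalAny)
  | .pred p x ts => .pred p (st _ x) fun i => st.eval (ts i)

/-- The value of a spatial formula in a store. -/
def spEval (st : Store Sg) (φ : Spatial Sg) : Multiset (VAtom Sg) := φ.map (Atom.eval st)

/-- The value of the head of a rule. -/
def Rule.headVal (r : Rule Sg) (v : Store Sg) : VAtom Sg :=
  .pred r.head (v _ r.root) fun i => v _ (r.params i)

/-- Satisfaction of multisets of atoms with values, one atom being consumed at each step.  Predicate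
atoms are unfolded by means of a store for the variables of the rule, so that no renaming of
existential variables is needed. -/
inductive VM (R : Finset (Rule Sg)) : Heap Sg → Multiset (VAtom Sg) → Prop where
  | emp : VM R ∅ 0
  | pto (l : Loc Sg) (vs : List (AnyVal Sg)) (h : Heap Sg) (M : Multiset (VAtom Sg))
      (hl : l ∉ h) (m : VM R h M) : VM R (Finmap.singleton l vs ∪ h) (.pto l vs ::ₘ M)
  | pred (r : Rule Sg) (hr : r ∈ R) (v : Store Sg) (h₁ h₂ : Heap Sg) (M : Multiset (VAtom Sg))
      (hdisj : h₁.Disjoint h₂) (hpure : PureHolds v r.body.pu)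
      (m₁ : VM R h₁ (spEval v r.body.sp)) (m₂ : VM R h₂ M) :
      VM R (h₁ ∪ h₂) (r.headVal v ::ₘ M)

theorem singleton_disjoint {l : Loc Sg} {vs : List (AnyVal Sg)} {h : Heap Sg} :
    (Finmap.singleton l vs : Heap Sg).Disjoint h ↔ l ∉ h := by
  constructor
  · intro hd hl
    exact hd l (by simp) hl
  · intro hl l' hl' hm
    rw [Finmap.mem_singleton] at hl'
    exact hl (hl' ▸ hm)

theorem Atom.eval_root (st : Store Sg) (a : Atom Sg) : (a.eval st).root = st _ a.root := by
  cases a <;> rfl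

theorem Atom.eval_vals (st : Store Sg) (a : Atom Sg) :
    (a.eval st).vals = a.terms.map st.evalAny := by
  cases a with
  | pto x ts => rfl
  | pred p x ts => simp only [Atom.eval, VAtom.vals, Atom.terms, List.map_cons, List.map_ofFn]; rfl

theorem Atom.eval_congr {st st' : Store Sg} {a : Atom Sg} (h : Agree a.vars st st') :
    a.eval st = a.eval st' := by
  have hr : st _ a.root = st' _ a.root := h _ _ a.root_mem_vars
  have ht : ∀ t ∈ a.terms, st.evalAny t = st'.evalAny t := fun t ht =>
    evalAny_congr t fun s x hx => h s x (by rw [Atom.mem_vars_iff, ← hx]; exact ht)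
  cases a with
  | pto x ts =>
    simp only [Atom.eval, VAtom.pto.injEq]
    exact ⟨hr, List.map_congr_left fun t h' => ht t (List.mem_cons_of_mem _ h')⟩
  | pred p x ts =>
    simp only [Atom.eval, VAtom.pred.injEq, heq_eq_eq, true_and]
    refine ⟨hr, funext fun i => ?_⟩
    have := ht ⟨_, ts i⟩ (List.mem_cons_of_mem _ (List.mem_ofFn.2 ⟨i, rfl⟩))
    simpa [Store.evalAny] using this

theorem spEval_congr {st st' : Store Sg} {φ : Spatial Sg} (h : Agree (spVars φ) st st') :
    spEval st φ = spEval st' φ :=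
  Multiset.map_congr rfl fun a ha => Atom.eval_congr (h.mono fun _ hv => ⟨a, ha, hv⟩)

theorem Atom.eval_subst (st : Store Sg) (σ : Subst Sg) (a : Atom Sg) :
    (a.subst σ).eval st = a.eval (st.comp σ) := by
  cases a with
  | pto x ts =>
    simp only [Atom.subst, Atom.eval, onLoc_eval, List.map_map]
    congr 1
    exact List.map_congr_left fun t _ => evalAny_subst st σ t
  | pred p x ts => simp only [Atom.subst, Atom.eval, onLoc_eval, SL.eval_subst]

theorem spEval_subst (st : Store Sg) (σ : Subst Sg) (φ : Spatial Sg) :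
    spEval st (spSubst σ φ) = spEval (st.comp σ) φ := by
  simp only [spEval, spSubst, Multiset.map_map]
  exact Multiset.map_congr rfl fun a _ => a.eval_subst st σ

@[simp] theorem spEval_zero (st : Store Sg) : spEval st 0 = 0 := rfl

@[simp] theorem spEval_cons (st : Store Sg) (a : Atom Sg) (φ : Spatial Sg) :
    spEval st (a ::ₘ φ) = a.eval st ::ₘ spEval st φ := Multiset.map_cons _ _ _

@[simp] theorem spEval_add (st : Store Sg) (φ ψ : Spatial Sg) :
    spEval st (φ + ψ) = spEval st φ + spEval st ψ := Multiset.map_add _ _ _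

@[simp] theorem spEval_singleton (st : Store Sg) (a : Atom Sg) :
    spEval st {a} = {a.eval st} := Multiset.map_singleton _ _

theorem spEval_roots (st : Store Sg) (φ : Spatial Sg) :
    (spEval st φ).map VAtom.root = (alloc φ).map (st Sg.loc) := by
  simp only [spEval, alloc, Multiset.map_map]
  exact Multiset.map_congr rfl fun a _ => a.eval_root st

section
variable {R : Finset (Rule Sg)}

theorem VM.append {h₁ h₂ : Heap Sg} {M₁ M₂ : Multiset (VAtom Sg)} (m₁ : VM R h₁ M₁)
    (m₂ : VM R h₂ M₂) (hd : h₁.Disjoint h₂) : VM R (h₁ ∪ h₂) (M₁ + M₂) := by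
  induction m₁ with
  | emp => simpa using m₂
  | pto l vs h M hl m ih =>
    rw [Finmap.disjoint_union_left] at hd
    rw [Finmap.union_assoc, Multiset.cons_add]
    refine .pto l vs _ _ ?_ (ih hd.2)
    rw [Finmap.mem_union, not_or]
    exact ⟨hl, singleton_disjoint.1 hd.1⟩
  | pred r hr v k₁ k₂ M hdisj hpure n₁ n₂ _ ih =>
    rw [Finmap.disjoint_union_left] at hd
    rw [Finmap.union_assoc, Multiset.cons_add]
    exact .pred r hr v _ _ _ ((Finmap.disjoint_union_right _ _ _).2 ⟨hdisj, hd.1⟩) hpure n₁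
      (ih hd.2)

theorem VM.zero_inv {h : Heap Sg} (m : VM R h 0) : h = ∅ := by
  generalize hN : (0 : Multiset (VAtom Sg)) = N at m
  cases m with
  | emp => rfl
  | pto => exact (Multiset.zero_ne_cons hN).elim
  | pred => exact (Multiset.zero_ne_cons hN).elim

theorem VM.single_pto (l : Loc Sg) (vs : List (AnyVal Sg)) :
    VM R (Finmap.singleton l vs) {.pto l vs} := by
  simpa using VM.pto (R := R) l vs ∅ 0 Finmap.notMem_empty .emp

theorem VM.single_pred {r : Rule Sg} (hr : r ∈ R) {v : Store Sg} {h : Heap Sg}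
    (hpure : PureHolds v r.body.pu) (m : VM R h (spEval v r.body.sp)) :
    VM R h {r.headVal v} := by
  simpa using VM.pred r hr v h ∅ 0 (Finmap.Disjoint.symm _ _ (Finmap.disjoint_empty _)) hpure m .emp

/-- A derivation may be assumed to start with any atom of the multiset. -/
theorem VM.cons_inv {h : Heap Sg} {a : VAtom Sg} {M : Multiset (VAtom Sg)} (m : VM R h (a ::ₘ M)) :
    ∃ h₁ h₂, h₁.Disjoint h₂ ∧ h = h₁ ∪ h₂ ∧ VM R h₁ {a} ∧ VM R h₂ M := by
  generalize hN : a ::ₘ M = N at m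
  induction m generalizing a M with
  | emp => exact (Multiset.cons_ne_zero hN).elim
  | pto l vs h N hl m ih =>
    rcases Multiset.cons_eq_cons.1 hN with ⟨rfl, rfl⟩ | ⟨_, cs, hM, hN'⟩
    · exact ⟨_, _, singleton_disjoint.2 hl, rfl, .single_pto l vs, m⟩
    · obtain ⟨h₁, h₂, hd, rfl, m₁, m₂⟩ := ih hN'.symm
      rw [Finmap.mem_union, not_or] at hl
      have hd' := singleton_disjoint (vs := vs).2 hl.1
      refine ⟨h₁, Finmap.singleton l vs ∪ h₂, ?_, union_left_comm_of_disjoint hd', m₁, ?_⟩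
      · exact (Finmap.disjoint_union_right _ _ _).2 ⟨hd'.symm, hd⟩
      · rw [hM]; exact .pto l vs _ _ hl.2 m₂
  | pred r hr v k₁ k₂ N hdisj hpure n₁ n₂ _ ih =>
    rcases Multiset.cons_eq_cons.1 hN with ⟨rfl, rfl⟩ | ⟨_, cs, hM, hN'⟩
    · exact ⟨_, _, hdisj, rfl, .single_pred hr hpure n₁, n₂⟩
    · obtain ⟨h₁, h₂, hd, rfl, m₁, m₂⟩ := ih hN'.symm
      rw [Finmap.disjoint_union_right] at hdisj
      refine ⟨h₁, k₁ ∪ h₂, ?_, union_left_comm_of_disjoint hdisj.1, m₁, ?_⟩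
      · exact (Finmap.disjoint_union_right _ _ _).2 ⟨hdisj.1.symm, hd⟩
      · rw [hM]; exact .pred r hr v _ _ _ hdisj.2 hpure n₁ m₂

theorem VM.add_inv {h : Heap Sg} {M₁ M₂ : Multiset (VAtom Sg)} (m : VM R h (M₁ + M₂)) :
    ∃ h₁ h₂, h₁.Disjoint h₂ ∧ h = h₁ ∪ h₂ ∧ VM R h₁ M₁ ∧ VM R h₂ M₂ := by
  induction M₁ using Multiset.induction generalizing h with
  | empty => exact ⟨∅, h, Finmap.disjoint_empty _, by simp, .emp, by simpa using m⟩
  | cons a M ih =>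
    rw [Multiset.cons_add] at m
    obtain ⟨k₁, k, hd, rfl, m₁, m'⟩ := m.cons_inv
    obtain ⟨k₂, k₃, hd', rfl, m₂, m₃⟩ := ih m'
    rw [Finmap.disjoint_union_right] at hd
    refine ⟨k₁ ∪ k₂, k₃, (Finmap.disjoint_union_left _ _ _).2 ⟨hd.2, hd'⟩,
      Finmap.union_assoc.symm, ?_, m₃⟩
    exact m₁.append m₂ hd.1

theorem VM.pto_inv {h : Heap Sg} {l : Loc Sg} {vs : List (AnyVal Sg)} (m : VM R h {.pto l vs}) :
    h = Finmap.singleton l vs := by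
  generalize hN : ({.pto l vs} : Multiset (VAtom Sg)) = N at m
  cases m with
  | emp => exact (Multiset.cons_ne_zero hN).elim
  | pto l' vs' h M hl m =>
    rcases Multiset.cons_eq_cons.1 hN with ⟨h', rfl⟩ | ⟨_, cs, hM, _⟩
    · cases h'
      rw [m.zero_inv, Finmap.union_empty]
    · exact (Multiset.zero_ne_cons hM).elim
  | pred r =>
    rcases Multiset.cons_eq_cons.1 hN with ⟨h', _⟩ | ⟨_, cs, hM, _⟩
    · simp [Rule.headVal] at h'
    · exact (Multiset.zero_ne_cons hM).elim

theorem VM.pred_inv {h : Heap Sg} {p : Sg.Pred} {l : Loc Sg} {args} (m : VM R h {.pred p l args}) :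
    ∃ r ∈ R, ∃ v, VAtom.pred p l args = r.headVal v ∧ PureHolds v r.body.pu ∧
      VM R h (spEval v r.body.sp) := by
  generalize hN : ({.pred p l args} : Multiset (VAtom Sg)) = N at m
  cases m with
  | emp => exact (Multiset.cons_ne_zero hN).elim
  | pto =>
    rcases Multiset.cons_eq_cons.1 hN with ⟨h', _⟩ | ⟨_, cs, hM, _⟩
    · cases h'
    · exact (Multiset.zero_ne_cons hM).elim
  | pred r hr v k₁ k₂ N hdisj hpure n₁ n₂ =>
    rcases Multiset.cons_eq_cons.1 hN with ⟨h', rfl⟩ | ⟨_, cs, hM, _⟩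
    · rw [n₂.zero_inv, Finmap.union_empty]
      exact ⟨r, hr, v, h', hpure, n₁⟩
    · exact (Multiset.zero_ne_cons hM).elim

/-! ### Equivalence of the two semantics -/

/-- The store for the variables of the rule is the composition of the instantiating substitution
and the store that satisfies the instance. -/
theorem SpModels.toVM {st : Store Sg} {h : Heap Sg} {φ : Spatial Sg} (m : SpModels R st h φ) :
    VM R h (spEval st φ) := by
  induction m with
  | emp st => exact .emp
  | pto st x ts => exact .single_pto _ _
  | sep st h₁ h₂ φ₁ φ₂ hdisj m₁ m₂ ih₁ ih₂ => rw [spEval_add]; exact ih₁.append ih₂ hdisj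
  | pred st st' h p x ts l hunf hst hpure m ih =>
    obtain ⟨r, hr, hi⟩ := hunf
    have hag : Agree (Atom.pred p x ts).vars st' st := fun s y hy => hst s y fun h' => h'.2 hy
    rw [spEval_singleton, ← Atom.eval_congr hag]
    cases hi with
    | mk τ _ ts' hroot hparams hfresh hinj =>
      have : Atom.eval st' (.pred r.head x ts') = r.headVal (st'.comp τ) := by
        simp only [Atom.eval, Rule.headVal, Store.comp, hroot, hparams, Store.eval]
      rw [this]
      exact .single_pred hr ((pureHolds_subst _ _ _).1 hpure) (by rw [← spEval_subst]; exact ih)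

/-- The store for the variables of the rule is copied to an instance of the rule with fresh
existential variables. -/
theorem VM.toSpModels {st : Store Sg} {h : Heap Sg} {φ : Spatial Sg} (m : VM R h (spEval st φ)) :
    SpModels R st h φ := by
  generalize hN : spEval st φ = N at m
  induction m generalizing st φ with
  | emp =>
    rw [Multiset.map_eq_zero.1 hN]
    exact .emp st
  | pto l vs h M hl m ih =>
    obtain ⟨a, ha, hea, hM⟩ := (Multiset.map_eq_cons _ _ _ _).2 hN
    rw [← Multiset.cons_erase ha, ← Multiset.singleton_add]
    refine .sep st _ _ _ _ (singleton_disjoint.2 hl) ?_ (ih hM)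
    cases a with
    | pto x ts => cases hea; exact .pto st x ts
    | pred => cases hea
  | pred r hr v h₁ h₂ M hdisj hpure m₁ m₂ ih₁ ih₂ =>
    obtain ⟨a, ha, hea, hM⟩ := (Multiset.map_eq_cons _ _ _ _).2 hN
    rw [← Multiset.cons_erase ha, ← Multiset.singleton_add]
    refine .sep st _ _ _ _ hdisj ?_ (ih₂ hM)
    cases a with
    | pto x ts => cases hea
    | pred p x ts =>
      simp only [Atom.eval, Rule.headVal, VAtom.pred.injEq] at hea
      obtain ⟨rfl, hx, hts⟩ := hea
      rw [heq_eq_eq] at hts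
      obtain ⟨τ, f, hf, h1, h2, h3, hA, hinst⟩ :=
        exists_ruleInst r (Atom.vars_finite (.pred r.head x ts)) x ts
      -- the store `st` updated on the existential variables of the instance
      let st' : Store Sg := fun s w =>
        if (⟨s, w⟩ : AnyVar Sg) ∈ (r.body.subst τ).vars \ (Atom.pred r.head x ts).vars then
          if h : ∃ y, f s y = w then v s h.choose else st s w
        else st s w
      have hst : ∀ s (y : Sg.Var s), (⟨s, y⟩ : AnyVar Sg) ∉
          (r.body.subst τ).vars \ (Atom.pred r.head x ts).vars → st' s y = st s y :=
        fun s y hy => if_neg hy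
      have hag : Agree r.body.vars (st'.comp τ) v := by
        intro s y hy
        by_cases hyf : (⟨s, y⟩ : AnyVar Sg) ∈ r.formals
        · have hv : ∀ w, (⟨s, .var w⟩ : AnyTerm Sg) ∈ (Atom.pred r.head x ts).terms →
              st' s w = st s w := fun w hw => hst s w fun h' => h'.2 hw
          rcases mem_formals.1 hyf with h' | ⟨i, h'⟩
          · cases h'
            simp only [Store.comp, h1, Store.eval]
            rw [hv x List.mem_cons_self, hx]
          · cases h'
            rw [← congrFun hts i]
            simp only [Store.comp, h2]
            have hti : (⟨_, ts i⟩ : AnyTerm Sg) ∈ (Atom.pred r.head x ts).terms :=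
              List.mem_cons_of_mem _ (List.mem_ofFn.2 ⟨i, rfl⟩)
            generalize ts i = t at hti
            cases t with
            | var w => exact hv w hti
            | cst c => rfl
        · have hmem : (⟨s, f s y⟩ : AnyVar Sg) ∈
              (r.body.subst τ).vars \ (Atom.pred r.head x ts).vars :=
            ⟨mem_vars_subst hy (h3 s y hyf), hA s y⟩
          have hex : ∃ y', f s y' = f s y := ⟨y, rfl⟩
          simp only [Store.comp, h3 s y hyf, Store.eval, st', if_pos hmem, dif_pos hex]
          rw [hf s hex.choose_spec]
      refine .pred st st' h₁ r.head x ts (r.body.subst τ) ⟨r, hr, hinst⟩ hst ?_ ?_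
      · exact (pureHolds_subst _ _ _).2
          ((pureHolds_congr (hag.mono Set.subset_union_right)).2 hpure)
      · refine ih₁ ?_
        rw [SHeap.subst, spEval_subst]
        exact spEval_congr (hag.mono Set.subset_union_left)

theorem models_iff {st : Store Sg} {h : Heap Sg} {l : SHeap Sg} :
    Models R st h l ↔ VM R h (spEval st l.sp) ∧ PureHolds st l.pu :=
  and_congr_left fun _ => ⟨SpModels.toVM, VM.toSpModels⟩

end

/-! ### The shape of `P`-rules -/

/-- What is used of the definition of a `loc`-deterministic set of `P`-rules, for a rule with tuple
`ys` and predicate atoms `qs`. -/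
structure RuleShape (r : Rule Sg) (ys : List (AnyTerm Sg)) (qs : Spatial Sg) : Prop where
  sp_eq : r.body.sp = .pto r.root ys ::ₘ qs
  isPred : ∀ a ∈ qs, a.IsPred
  vars_mem : ∀ v ∈ r.body.vars, v ∈ r.formals ∨ v.toTerm ∈ ys
  nodup : (alloc qs).Nodup
  alloc_iff : ∀ z : LVar Sg, z ∈ alloc qs ↔ lterm z ∈ ys ∧ (⟨Sg.loc, z⟩ : AnyVar Sg) ∉ r.formals
  pure : ∀ e ∈ r.body.pu, ∃ x y : LVar Sg, e = .ne Sg.loc s(.var x, .var y) ∧ x ≠ y ∧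
    y ∈ alloc qs ∧ ((⟨Sg.loc, x⟩ : AnyVar Sg) ∈ r.formals ∨ x ∈ alloc qs)

theorem mem_formals_of_toTerm {r : Rule Sg} {v : AnyVar Sg}
    (h : v.toTerm ∈ r.formals.map AnyVar.toTerm) : v ∈ r.formals :=
  (List.mem_map_of_injective AnyVar.toTerm_injective).1 h

theorem mem_spVars_root {φ : Spatial Sg} {x : LVar Sg} (h : x ∈ alloc φ) :
    (⟨Sg.loc, x⟩ : AnyVar Sg) ∈ spVars φ := by
  obtain ⟨a, ha, rfl⟩ := Multiset.mem_map.1 h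
  exact ⟨a, ha, a.root_mem_vars⟩

theorem Atom.terms_eq (a : Atom Sg) : a.terms = lterm a.root :: a.terms.tail := by
  cases a <;> rfl

theorem root_mem_formals (r : Rule Sg) : (⟨Sg.loc, r.root⟩ : AnyVar Sg) ∈ r.formals :=
  List.mem_cons_self

theorem LocDeterministic.shape {R : Finset (Rule Sg)} (hdet : LocDeterministic R) {r : Rule Sg}
    (hr : r ∈ R) : ∃ ys qs, RuleShape r ys qs := by
  obtain ⟨ys, qs, hsp, hpred, hpu, hnd, halloc, hargs⟩ := hdet.1 r hr
  have hloc : ∀ z : LVar Sg, lterm z ∈ ys → (⟨Sg.loc, z⟩ : AnyVar Sg) ∈ r.formals ∨ z ∈ alloc qs :=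
    fun z hz => by
      by_cases h : (⟨Sg.loc, z⟩ : AnyVar Sg) ∈ r.formals
      · exact Or.inl h
      · exact Or.inr ((halloc z).2 ⟨hz, h⟩)
  refine ⟨ys, qs, hsp, hpred, ?_, hnd, halloc, ?_⟩
  · rintro v (⟨a, ha, hv⟩ | ⟨e, he, hv⟩)
    · rw [hsp, Multiset.mem_cons] at ha
      rcases ha with rfl | ha
      · rcases List.mem_cons.1 hv with h | h
        · exact Or.inl (AnyVar.toTerm_injective (a₁ := v) (a₂ := ⟨Sg.loc, r.root⟩) h ▸
            root_mem_formals r)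
        · exact Or.inr h
      · change v.toTerm ∈ a.terms at hv
        rw [a.terms_eq, List.mem_cons] at hv
        rcases hv with h | h
        · refine Or.inr ?_
          rw [h]
          exact ((halloc a.root).1 (Multiset.mem_map_of_mem _ ha)).1
        · rcases hargs a ha _ h with h | h | ⟨s, c, h⟩
          · exact Or.inl (mem_formals_of_toTerm h)
          · exact Or.inr h
          · obtain ⟨s', x⟩ := v
            simp only [AnyVar.toTerm, Sigma.mk.injEq] at h
            obtain ⟨rfl, h⟩ := h
            simp at h
    · obtain ⟨s, t, u, rfl, _, ht, hu, _⟩ := hpu e he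
      obtain ⟨x, rfl, hx⟩ := hv
      rcases Sym2.mem_iff.1 hx with rfl | rfl
      · rcases ht with h | h
        · exact Or.inl (mem_formals_of_toTerm (v := ⟨s, x⟩) h)
        · exact Or.inr h
      · exact Or.inr hu
  · intro e he
    obtain ⟨x, y, rfl⟩ := hdet.2.2 r hr e he
    obtain ⟨s, t, u, heq, hne, ht, hu, hu'⟩ := hpu _ he
    have key : ∀ x y : LVar Sg, Term.var x ≠ (Term.var y : Term Sg Sg.loc) →
        ((⟨Sg.loc, .var x⟩ : AnyTerm Sg) ∈ r.formals.map AnyVar.toTerm ∨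
          (⟨Sg.loc, .var x⟩ : AnyTerm Sg) ∈ ys) →
        (⟨Sg.loc, .var y⟩ : AnyTerm Sg) ∈ ys →
        (⟨Sg.loc, .var y⟩ : AnyTerm Sg) ∉ r.formals.map AnyVar.toTerm →
        x ≠ y ∧ y ∈ alloc qs ∧ ((⟨Sg.loc, x⟩ : AnyVar Sg) ∈ r.formals ∨ x ∈ alloc qs) := by
      intro x y hne hx hy hy'
      refine ⟨fun h => hne (congrArg _ h), (halloc y).2 ⟨hy, fun h => hy' ?_⟩, ?_⟩
      · exact mem_map_toTerm.2 h
      · rcases hx with h | h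
        · exact Or.inl (mem_map_toTerm.1 h)
        · exact hloc x h
    simp only [PAtom.ne.injEq] at heq
    obtain ⟨rfl, heq⟩ := heq
    rw [heq_eq_eq, Sym2.eq_iff] at heq
    rcases heq with ⟨rfl, rfl⟩ | ⟨rfl, rfl⟩
    · exact ⟨x, y, rfl, key x y hne ht hu hu'⟩
    · exact ⟨y, x, by rw [Sym2.eq_swap], key y x hne ht hu hu'⟩

theorem holds_ne {st : Store Sg} {s : Sg.Srt} {t u : Term Sg s} :
    (PAtom.ne s s(t, u)).Holds st ↔ st.eval t ≠ st.eval u := by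
  simp [PAtom.Holds]

theorem holds_eq {st : Store Sg} {s : Sg.Srt} {t u : Term Sg s} :
    (PAtom.eq s s(t, u)).Holds st ↔ st.eval t = st.eval u := by
  simp [PAtom.Holds]

theorem RuleShape.pureHolds {r : Rule Sg} {ys qs} (hs : RuleShape r ys qs) {v : Store Sg}
    (h : ∀ x y : LVar Sg, x ≠ y → y ∈ alloc qs →
      ((⟨Sg.loc, x⟩ : AnyVar Sg) ∈ r.formals ∨ x ∈ alloc qs) →
      PAtom.ne Sg.loc s(.var x, .var y) ∈ r.body.pu → v _ x ≠ v _ y) :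
    PureHolds v r.body.pu := by
  intro e he
  obtain ⟨x, y, rfl, hne, hy, hx⟩ := hs.pure e he
  exact holds_ne.2 (h x y hne hy hx he)

/-! ### Properties of the models of spatial formulas -/

section
variable {R : Finset (Rule Sg)}

theorem VM.pto_cons_inv {h : Heap Sg} {l : Loc Sg} {vs : List (AnyVal Sg)}
    {M : Multiset (VAtom Sg)} (m : VM R h (.pto l vs ::ₘ M)) :
    ∃ h', l ∉ h' ∧ h = Finmap.singleton l vs ∪ h' ∧ VM R h' M := by
  obtain ⟨h₁, h₂, hd, rfl, m₁, m₂⟩ := m.cons_inv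
  rw [m₁.pto_inv] at hd ⊢
  exact ⟨h₂, singleton_disjoint.1 hd, rfl, m₂⟩

theorem lookup_singleton_union (l : Loc Sg) (vs : List (AnyVal Sg)) (h : Heap Sg) :
    (Finmap.singleton l vs ∪ h : Heap Sg).lookup l = some vs :=
  hsub_left _ _ _ _ Finmap.lookup_singleton_eq

theorem spEval_body {r : Rule Sg} {ys qs} (hs : RuleShape r ys qs) (v : Store Sg) :
    spEval v r.body.sp = .pto (v _ r.root) (ys.map v.evalAny) ::ₘ spEval v qs := by
  rw [hs.sp_eq, spEval_cons]; rfl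

/-- The root of every atom is allocated, because every rule allocates its root. -/
theorem VM.root_mem (hdet : LocDeterministic R) {h : Heap Sg} {M : Multiset (VAtom Sg)}
    (m : VM R h M) : ∀ a ∈ M, a.root ∈ h := by
  induction m with
  | emp => simp
  | pto l vs h M hl m ih =>
    intro a ha
    rw [Finmap.mem_union]
    rcases Multiset.mem_cons.1 ha with rfl | ha
    · exact Or.inl (by simp [VAtom.root])
    · exact Or.inr (ih a ha)
  | pred r hr v h₁ h₂ M hdisj hpure m₁ m₂ ih₁ ih₂ =>
    intro a ha
    rw [Finmap.mem_union]
    rcases Multiset.mem_cons.1 ha with rfl | ha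
    · obtain ⟨ys, qs, hs⟩ := hdet.shape hr
      rw [spEval_body hs] at ih₁
      have := ih₁ _ (Multiset.mem_cons_self _ _)
      exact Or.inl this
    · exact Or.inr (ih₂ a ha)

theorem RuleShape.alloc_mem (hdet : LocDeterministic R) {r : Rule Sg} {ys qs}
    (hs : RuleShape r ys qs) {v : Store Sg} {h : Heap Sg} (m : VM R h (spEval v r.body.sp))
    {z : LVar Sg} (hz : z ∈ alloc qs) : v _ z ∈ h := by
  obtain ⟨c, hc, rfl⟩ := Multiset.mem_map.1 hz
  rw [← c.eval_root v]
  refine m.root_mem hdet _ ?_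
  rw [spEval_body hs]
  exact Multiset.mem_cons_of_mem (Multiset.mem_map_of_mem _ hc)

theorem VM.roots_nodup (hdet : LocDeterministic R) {h : Heap Sg} {M : Multiset (VAtom Sg)}
    (m : VM R h M) : (M.map VAtom.root).Nodup := by
  induction M using Multiset.induction generalizing h with
  | empty => simp
  | cons a M ih =>
    obtain ⟨h₁, h₂, hd, rfl, m₁, m₂⟩ := m.cons_inv
    rw [Multiset.map_cons, Multiset.nodup_cons]
    refine ⟨fun hmem => ?_, ih m₂⟩
    obtain ⟨b, hb, hba⟩ := Multiset.mem_map.1 hmem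
    have := m₂.root_mem hdet b hb
    exact hd _ (m₁.root_mem hdet a (Multiset.mem_singleton_self a)) (hba ▸ this)

/-- Two instances of rules whose heads and tuples have the same values coincide: this is
determinism, together with the fact that all the variables of a rule occur in its head or tuple. -/
theorem rule_eq_of_eval_eq (hdet : LocDeterministic R) {r r' : Rule Sg} (hr : r ∈ R) (hr' : r' ∈ R)
    {v v' : Store Sg} {ys qs ys' qs'} (hs : RuleShape r ys qs) (hs' : RuleShape r' ys' qs')
    (hhead : r.headVal v = r'.headVal v') (hys : ys.map v.evalAny = ys'.map v'.evalAny)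
    (hp : PureHolds v r.body.pu) (hp' : PureHolds v' r'.body.pu) :
    r = r' ∧ spEval v r.body.sp = spEval v' r'.body.sp := by
  have hform : (r.formals.map AnyVar.toTerm).map v.evalAny =
      (r'.formals.map AnyVar.toTerm).map v'.evalAny := by
    have : ∀ (r : Rule Sg) (v : Store Sg),
        (r.formals.map AnyVar.toTerm).map v.evalAny = (r.headVal v).vals := by
      intro r v
      simp only [Rule.formals, List.map_cons, List.map_ofFn, Rule.headVal, VAtom.vals]
      rfl
    rw [this, this, hhead]
  have hrr : r = r' := by
    by_contra hne
    have hh : r.head = r'.head := by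
      simp only [Rule.headVal, VAtom.pred.injEq] at hhead
      exact hhead.1
    exact hdet.2.1 r hr r' hr' hne hh ys ys' (by rw [hs.sp_eq]; exact Multiset.mem_cons_self _ _)
      (by rw [hs'.sp_eq]; exact Multiset.mem_cons_self _ _) ⟨v, v', hform, hys, hp, hp'⟩
  subst hrr
  have hyy : ys = ys' := by
    have h := hs.sp_eq.symm.trans hs'.sp_eq
    rcases Multiset.cons_eq_cons.1 h with ⟨h', _⟩ | ⟨_, cs, h', _⟩
    · cases h'; rfl
    · exact (hs.isPred (.pto r.root ys') (by rw [h']; exact Multiset.mem_cons_self _ _)).elim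
  subst hyy
  refine ⟨rfl, spEval_congr fun s x hx => ?_⟩
  rcases hs.vars_mem ⟨s, x⟩ (Or.inl hx) with h | h
  · have := List.map_inj_left.1 hform _ (List.mem_map_of_mem h)
    simpa [AnyVar.toTerm, Store.evalAny, Store.eval] using this
  · have := List.map_inj_left.1 hys _ h
    simpa [AnyVar.toTerm, Store.evalAny, Store.eval] using this

/-- A spatial formula has at most one model inside a given heap: the tuple allocated at the root of
a predicate atom determines the rule and the values of its existential variables. -/
theorem VM.unique (hdet : LocDeterministic R) {h₁ h₂ h : Heap Sg} {M : Multiset (VAtom Sg)}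
    (m₁ : VM R h₁ M) (m₂ : VM R h₂ M) (hs₁ : HSub h₁ h) (hs₂ : HSub h₂ h) : h₁ = h₂ := by
  induction m₁ generalizing h₂ with
  | emp => exact m₂.zero_inv.symm
  | pto l vs k M hl m ih =>
    obtain ⟨k', hl', rfl, m'⟩ := m₂.pto_cons_inv
    rw [ih m' ((hsub_right (singleton_disjoint.2 hl)).trans hs₁)
      ((hsub_right (singleton_disjoint.2 hl')).trans hs₂)]
  | pred r hr v k₁ k₂ M hdisj hpure n₁ n₂ ih₁ ih₂ =>
    obtain ⟨k₁', k₂', hd', rfl, n₁', n₂'⟩ := m₂.cons_inv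
    obtain ⟨r', hr', v', hhead, hpure', n₁'⟩ := VM.pred_inv n₁'
    have hs₁₁ := (hsub_left k₁ k₂).trans hs₁
    have hs₂₁ := (hsub_left k₁' k₂').trans hs₂
    obtain ⟨ys, qs, hs⟩ := hdet.shape hr
    obtain ⟨ys', qs', hs'⟩ := hdet.shape hr'
    have hys : ys.map v.evalAny = ys'.map v'.evalAny := by
      have e₁ := n₁
      have e₂ := n₁'
      rw [spEval_body hs] at e₁
      rw [spEval_body hs'] at e₂
      obtain ⟨_, _, rfl, _⟩ := e₁.pto_cons_inv
      obtain ⟨_, _, rfl, _⟩ := e₂.pto_cons_inv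
      have hroot : v _ r.root = v' _ r'.root := congrArg VAtom.root hhead
      have l₁ := hs₁₁ _ _ (lookup_singleton_union _ _ _)
      have l₂ := hs₂₁ _ _ (lookup_singleton_union _ _ _)
      rw [hroot, l₂] at l₁
      exact (Option.some.inj l₁).symm
    obtain ⟨_, heq⟩ := rule_eq_of_eval_eq hdet hr hr' hs hs' hhead hys hpure hpure'
    rw [ih₁ (heq ▸ n₁') hs₁₁ hs₂₁,
      ih₂ n₂' ((hsub_right hdisj).trans hs₁) ((hsub_right hd').trans hs₂)]

/-- Every location occurring in a record is allocated or is the value of a parameter. -/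
theorem VM.loc_mem_or (hdet : LocDeterministic R) {h : Heap Sg} {M : Multiset (VAtom Sg)}
    (m : VM R h M) {l₀ : Loc Sg} {vs : List (AnyVal Sg)} (hl₀ : h.lookup l₀ = some vs) {l : Loc Sg}
    (hl : (⟨Sg.loc, l⟩ : AnyVal Sg) ∈ vs) :
    l ∈ h ∨ ∃ a ∈ M, (⟨Sg.loc, l⟩ : AnyVal Sg) ∈ a.vals := by
  induction m with
  | emp => simp at hl₀
  | pto l' vs' h M hl' m ih =>
    rcases (lookup_union_some (singleton_disjoint.2 hl')).1 hl₀ with h' | h'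
    · obtain ⟨rfl, rfl⟩ := lookup_singleton_some.1 h'
      exact Or.inr ⟨_, Multiset.mem_cons_self _ _, List.mem_cons_of_mem _ hl⟩
    · rcases ih h' with h' | ⟨a, ha, h'⟩
      · exact Or.inl (Finmap.mem_union.2 (Or.inr h'))
      · exact Or.inr ⟨a, Multiset.mem_cons_of_mem ha, h'⟩
  | pred r hr v h₁ h₂ M hdisj hpure m₁ m₂ ih₁ ih₂ =>
    rcases (lookup_union_some hdisj).1 hl₀ with h' | h'
    · rcases ih₁ h' with h' | ⟨a, ha, h'⟩
      · exact Or.inl (Finmap.mem_union.2 (Or.inl h'))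
      · obtain ⟨ys, qs, hs⟩ := hdet.shape hr
        obtain ⟨b, hb, rfl⟩ := Multiset.mem_map.1 ha
        rw [Atom.eval_vals] at h'
        obtain ⟨⟨s, t⟩, ht, hte⟩ := List.mem_map.1 h'
        simp only [Store.evalAny, Sigma.mk.injEq] at hte
        obtain ⟨rfl, hte⟩ := hte
        rw [heq_eq_eq] at hte
        cases t with
        | cst c => exact (Sg.cst_loc_isEmpty.false c).elim
        | var z =>
          change v _ z = l at hte
          by_cases hz : (⟨Sg.loc, z⟩ : AnyVar Sg) ∈ r.formals
          · refine Or.inr ⟨_, Multiset.mem_cons_self _ _, ?_⟩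
            simp only [Rule.headVal, VAtom.vals, List.mem_cons, List.mem_ofFn]
            rcases mem_formals.1 hz with h | ⟨i, h⟩
            · cases h; exact Or.inl (by rw [hte])
            · refine Or.inr ⟨i, ?_⟩
              have := congrArg (fun w : AnyVar Sg => (⟨w.1, v w.1 w.2⟩ : AnyVal Sg)) h
              simp only [hte] at this
              exact this.symm
          · refine Or.inl (Finmap.mem_union.2 (Or.inl ?_))
            have hz' : z ∈ alloc qs := by
              rcases hs.vars_mem ⟨Sg.loc, z⟩ (Or.inl ⟨b, hb, ht⟩) with h | h
              · exact (hz h).elim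
              · exact (hs.alloc_iff z).2 ⟨h, hz⟩
            exact hte ▸ hs.alloc_mem hdet m₁ hz'
    · rcases ih₂ h' with h' | ⟨a, ha, h'⟩
      · exact Or.inl (Finmap.mem_union.2 (Or.inr h'))
      · exact Or.inr ⟨a, Multiset.mem_cons_of_mem ha, h'⟩

/-- Every allocated location is reachable from the root of an atom: a set that contains the roots
and is closed under the edges of the heap contains the domain. -/
theorem VM.mem_of_closed (hdet : LocDeterministic R) {h : Heap Sg} {M : Multiset (VAtom Sg)}
    (m : VM R h M) (D : Set (Loc Sg)) (hroot : ∀ a ∈ M, a.root ∈ D)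
    (hD : ∀ l ∈ D, ∀ vs, h.lookup l = some vs → ∀ l' ∈ h, (⟨Sg.loc, l'⟩ : AnyVal Sg) ∈ vs →
      l' ∈ D) :
    ∀ l ∈ h, l ∈ D := by
  induction m with
  | emp => intro l hl; exact (Finmap.notMem_empty hl).elim
  | pto l vs k M hl m ih =>
    intro l' hl'
    rcases Finmap.mem_union.1 hl' with h | h
    · rw [Finmap.mem_singleton] at h
      subst h
      exact hroot _ (Multiset.mem_cons_self _ _)
    · have hsub := hsub_right (singleton_disjoint (vs := vs).2 hl)
      exact ih (fun a ha => hroot a (Multiset.mem_cons_of_mem ha))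
        (fun l hl vs' h' l' hl' => hD l hl vs' (hsub _ _ h') l' (hsub.mem hl')) l' h
  | pred r hr v h₁ h₂ M hdisj hpure m₁ m₂ ih₁ ih₂ =>
    intro l hl
    have hsub₁ := hsub_left h₁ h₂
    have hsub₂ := hsub_right hdisj
    rcases Finmap.mem_union.1 hl with h | h
    · refine ih₁ ?_ (fun l hl vs' h' l' hl' => hD l hl vs' (hsub₁ _ _ h') l' (hsub₁.mem hl')) l h
      obtain ⟨ys, qs, hs⟩ := hdet.shape hr
      have hr' : v _ r.root ∈ D := hroot _ (Multiset.mem_cons_self _ _)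
      have hmem := m₁.root_mem hdet
      rw [spEval_body hs] at m₁ hmem ⊢
      intro a ha
      rcases Multiset.mem_cons.1 ha with rfl | ha'
      · exact hr'
      · obtain ⟨_, _, rfl, _⟩ := m₁.pto_cons_inv
        refine hD _ hr' _ (hsub₁ _ _ (lookup_singleton_union _ _ _)) _ (hsub₁.mem (hmem a ha)) ?_
        obtain ⟨b, hb, rfl⟩ := Multiset.mem_map.1 ha'
        rw [b.eval_root]
        exact List.mem_map.2
          ⟨_, ((hs.alloc_iff b.root).1 (Multiset.mem_map_of_mem _ hb)).1, rfl⟩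
    · exact ih₂ (fun a ha => hroot a (Multiset.mem_cons_of_mem ha))
        (fun l hl vs' h' l' hl' => hD l hl vs' (hsub₂ _ _ h') l' (hsub₂.mem hl')) l h

end

variable {R : Finset (Rule Sg)}

/-! ### Images of heaps -/

/-- Sort-preserving maps on values. -/
abbrev VMap (Sg : Signature) := (s : Sg.Srt) → Sg.Univ s → Sg.Univ s

/-- The action of `θ` on the values of any sort. -/
def VMap.onVal (θ : VMap Sg) (a : AnyVal Sg) : AnyVal Sg := ⟨a.1, θ a.1 a.2⟩

/-- The image of an atom by `θ`. -/
def VAtom.map (θ : VMap Sg) : VAtom Sg → VAtom Sg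
  | .pto l vs => .pto (θ _ l) (vs.map θ.onVal)
  | .pred p l args => .pred p (θ _ l) fun i => θ _ (args i)

/-- The map `θ` fixes the values of the constants. -/
def VMap.FixesCst (θ : VMap Sg) : Prop := ∀ s c, θ s (Sg.cval s c) = Sg.cval s c

/-- The composition of a store and a map on values. -/
def VMap.app (θ : VMap Sg) (st : Store Sg) : Store Sg := fun s x => θ s (st s x)

theorem VMap.FixesCst.eval {θ : VMap Sg} (hθ : θ.FixesCst) (st : Store Sg) {s : Sg.Srt}
    (t : Term Sg s) : (θ.app st).eval t = θ s (st.eval t) := by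
  cases t with
  | var x => rfl
  | cst c => exact (hθ s c).symm

theorem VMap.FixesCst.evalAny {θ : VMap Sg} (hθ : θ.FixesCst) (st : Store Sg) (t : AnyTerm Sg) :
    (θ.app st).evalAny t = θ.onVal (st.evalAny t) := by
  simp only [Store.evalAny, VMap.onVal, hθ.eval]

theorem Atom.eval_map {θ : VMap Sg} (hθ : θ.FixesCst) (st : Store Sg) (a : Atom Sg) :
    (a.eval st).map θ = a.eval (θ.app st) := by
  cases a with
  | pto x ts =>
    simp only [Atom.eval, VAtom.map, List.map_map, VMap.app]
    congr 1
    exact List.map_congr_left fun t _ => (hθ.evalAny st t).symm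
  | pred p x ts => simp only [Atom.eval, VAtom.map, hθ.eval]; rfl

theorem spEval_map {θ : VMap Sg} (hθ : θ.FixesCst) (st : Store Sg) (φ : Spatial Sg) :
    (spEval st φ).map (VAtom.map θ) = spEval (θ.app st) φ := by
  simp only [spEval, Multiset.map_map]
  exact Multiset.map_congr rfl fun a _ => a.eval_map hθ st

/-- `h'` is the image of the heap `h` by `θ`. -/
def IsImage (θ : VMap Sg) (h h' : Heap Sg) : Prop :=
  ∀ l vs, h'.lookup l = some vs ↔
    ∃ l₀ vs₀, h.lookup l₀ = some vs₀ ∧ θ _ l₀ = l ∧ vs₀.map θ.onVal = vs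

theorem IsImage.mem {θ : VMap Sg} {h h' : Heap Sg} (hi : IsImage θ h h') {l : Loc Sg}
    (hl : l ∈ h') : ∃ l₀ ∈ h, θ _ l₀ = l := by
  obtain ⟨vs, hvs⟩ := Finmap.mem_iff.1 hl
  obtain ⟨l₀, vs₀, h₀, rfl, _⟩ := (hi l vs).1 hvs
  exact ⟨l₀, Finmap.mem_of_lookup_eq_some h₀, rfl⟩

theorem IsImage.unique {θ : VMap Sg} {h h₁ h₂ : Heap Sg} (hi₁ : IsImage θ h h₁)
    (hi₂ : IsImage θ h h₂) : h₁ = h₂ :=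
  heap_ext (fun l vs hl => (hi₂ l vs).2 ((hi₁ l vs).1 hl))
    fun l vs hl => (hi₁ l vs).2 ((hi₂ l vs).1 hl)

theorem IsImage.union {θ : VMap Sg} {h₁ h₂ k₁ k₂ : Heap Sg} (hi₁ : IsImage θ h₁ k₁)
    (hi₂ : IsImage θ h₂ k₂) (hd : h₁.Disjoint h₂) (hd' : k₁.Disjoint k₂) :
    IsImage θ (h₁ ∪ h₂) (k₁ ∪ k₂) := by
  intro l vs
  rw [lookup_union_some hd', hi₁, hi₂]
  constructor
  · rintro (⟨l₀, vs₀, h, h'⟩ | ⟨l₀, vs₀, h, h'⟩)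
    · exact ⟨l₀, vs₀, (lookup_union_some hd).2 (Or.inl h), h'⟩
    · exact ⟨l₀, vs₀, (lookup_union_some hd).2 (Or.inr h), h'⟩
  · rintro ⟨l₀, vs₀, h, h'⟩
    rcases (lookup_union_some hd).1 h with h | h
    · exact Or.inl ⟨l₀, vs₀, h, h'⟩
    · exact Or.inr ⟨l₀, vs₀, h, h'⟩

theorem isImage_singleton (θ : VMap Sg) (l : Loc Sg) (vs : List (AnyVal Sg)) :
    IsImage θ (Finmap.singleton l vs) (Finmap.singleton (θ _ l) (vs.map θ.onVal)) := by
  intro l' vs'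
  simp only [lookup_singleton_some]
  constructor
  · rintro ⟨rfl, rfl⟩; exact ⟨l, vs, ⟨rfl, rfl⟩, rfl, rfl⟩
  · rintro ⟨_, _, ⟨rfl, rfl⟩, rfl, rfl⟩; exact ⟨rfl, rfl⟩

/-- Satisfaction is preserved by the maps on values that identify no allocated location with
another location: the disequations of the rules all involve an existential variable of sort `loc`,
the value of which is allocated. -/
theorem VM.image (hdet : LocDeterministic R) {h : Heap Sg} {M : Multiset (VAtom Sg)}
    (m : VM R h M) {θ : VMap Sg} (hθ : θ.FixesCst)
    (hinj : ∀ l ∈ h, ∀ b, θ Sg.loc b = θ Sg.loc l → b = l) :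
    ∃ h', IsImage θ h h' ∧ VM R h' (M.map (VAtom.map θ)) := by
  induction m with
  | emp => exact ⟨∅, fun l vs => by simp, .emp⟩
  | pto l vs k M hl m ih =>
    obtain ⟨k', hi, m'⟩ := ih fun l hl => hinj l (Finmap.mem_union.2 (Or.inr hl))
    have hl' : θ _ l ∉ k' := fun hmem => by
      obtain ⟨l₀, hl₀, h⟩ := hi.mem hmem
      rw [hinj l (Finmap.mem_union.2 (Or.inl (by simp))) l₀ h] at hl₀
      exact hl hl₀
    refine ⟨_, (isImage_singleton θ l vs).union hi (singleton_disjoint.2 hl)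
      (singleton_disjoint.2 hl'), ?_⟩
    rw [Multiset.map_cons]
    exact .pto _ _ _ _ hl' m'
  | pred r hr v h₁ h₂ M hdisj hpure m₁ m₂ ih₁ ih₂ =>
    have hinj₁ : ∀ l ∈ h₁, ∀ b, θ Sg.loc b = θ Sg.loc l → b = l :=
      fun l hl => hinj l (Finmap.mem_union.2 (Or.inl hl))
    obtain ⟨k₁, hi₁, n₁⟩ := ih₁ hinj₁
    obtain ⟨k₂, hi₂, n₂⟩ := ih₂ fun l hl => hinj l (Finmap.mem_union.2 (Or.inr hl))
    have hd : k₁.Disjoint k₂ := fun l hl hl' => by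
      obtain ⟨l₁, hl₁, rfl⟩ := hi₁.mem hl
      obtain ⟨l₂, hl₂, h⟩ := hi₂.mem hl'
      rw [hinj₁ l₁ hl₁ l₂ h] at hl₂
      exact hdisj l₁ hl₁ hl₂
    refine ⟨k₁ ∪ k₂, hi₁.union hi₂ hdisj hd, ?_⟩
    rw [Multiset.map_cons]
    obtain ⟨ys, qs, hs⟩ := hdet.shape hr
    refine .pred r hr (θ.app v) k₁ k₂ _ hd ?_ (by rw [← spEval_map hθ]; exact n₁) n₂
    refine hs.pureHolds fun x y _ hy _ he heq => ?_
    exact holds_ne.1 (hpure _ he) (hinj₁ _ (hs.alloc_mem hdet m₁ hy) _ heq)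

/-! ### Existence of models -/

/-- The location `w` occurs in a record of the heap. -/
def Contains (h : Heap Sg) (w : Loc Sg) : Prop :=
  ∃ l vs, h.lookup l = some vs ∧ (⟨Sg.loc, w⟩ : AnyVal Sg) ∈ vs

theorem Contains.mono {h h' : Heap Sg} {w : Loc Sg} (hc : Contains h w) (hs : HSub h h') :
    Contains h' w := by
  obtain ⟨l, vs, hl, hw⟩ := hc
  exact ⟨l, vs, hs _ _ hl, hw⟩

/-- The atom `a` has models satisfying `Q` the domains of which avoid any given finite set that
does not contain the root of `a`. -/
def HasModel (R : Finset (Rule Sg)) (Q : Heap Sg → Prop) (a : VAtom Sg) : Prop :=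
  ∀ F : Set (Loc Sg), F.Finite → a.root ∉ F → ∃ h, VM R h {a} ∧ (∀ l ∈ h, l ∉ F) ∧ Q h

theorem heap_dom_finite (h : Heap Sg) : {l | l ∈ h}.Finite :=
  h.keys.finite_toSet.subset fun _ hl => Finmap.mem_keys.2 hl

/-- Models of atoms with distinct roots are chosen one after the other, each of them disjoint from
the previous ones and from the remaining roots. -/
theorem exists_model_of_hasModel (Q : VAtom Sg → Heap Sg → Prop)
    {M : Multiset (VAtom Sg)} (hM : ∀ a ∈ M, HasModel R (Q a) a) (hnd : (M.map VAtom.root).Nodup)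
    {F : Set (Loc Sg)} (hF : F.Finite) (hroot : ∀ a ∈ M, a.root ∉ F) :
    ∃ h, VM R h M ∧ (∀ l ∈ h, l ∉ F) ∧ ∀ a ∈ M, ∃ k, HSub k h ∧ Q a k := by
  induction M using Multiset.induction generalizing F with
  | empty => exact ⟨∅, .emp, fun l hl => (Finmap.notMem_empty hl).elim, by simp⟩
  | cons a M ih =>
    rw [Multiset.map_cons, Multiset.nodup_cons] at hnd
    obtain ⟨h, m, hav, hQ⟩ := ih (fun b hb => hM b (Multiset.mem_cons_of_mem hb)) hnd.2
      (F := insert a.root F) (hF.insert _) (by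
        rintro b hb (h | h)
        · exact hnd.1 (Multiset.mem_map.2 ⟨b, hb, h⟩)
        · exact hroot b (Multiset.mem_cons_of_mem hb) h)
    have ha : a.root ∉ h := fun h' => hav _ h' (Set.mem_insert _ _)
    obtain ⟨k, m', hav', hQ'⟩ := hM a (Multiset.mem_cons_self _ _) (F ∪ {l | l ∈ h})
      (hF.union (heap_dom_finite h)) (by
        rintro (h' | h')
        · exact hroot a (Multiset.mem_cons_self _ _) h'
        · exact ha h')
    have hd : k.Disjoint h := fun l hl hl' => hav' l hl (Or.inr hl')
    refine ⟨k ∪ h, ?_, ?_, ?_⟩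
    · rw [← Multiset.singleton_add]; exact m'.append m hd
    · intro l hl
      rcases Finmap.mem_union.1 hl with h' | h'
      · exact fun hF => hav' l h' (Or.inl hF)
      · exact fun hF => hav l h' (Or.inr hF)
    · intro b hb
      rcases Multiset.mem_cons.1 hb with rfl | hb
      · exact ⟨k, hsub_left _ _, hQ'⟩
      · obtain ⟨k', hk', hQ''⟩ := hQ b hb
        exact ⟨k', hk'.trans (hsub_right hd), hQ''⟩

/-- Every atom with the right predicate symbol has an instance of the rule satisfying the pure part
of the rule, in which the existential locations are distinct and avoid a given finite set. -/
theorem exists_rule_store {r : Rule Sg} {ys qs} (hs : RuleShape r ys qs) (l : Loc Sg)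
    (args : (i : Fin (Sg.arity r.head)) → Sg.Univ (Sg.argSort r.head i)) {F : Set (Loc Sg)}
    (hF : F.Finite) :
    ∃ v : Store Sg, r.headVal v = .pred r.head l args ∧ PureHolds v r.body.pu ∧
      ((alloc qs).map (v Sg.loc)).Nodup ∧ ∀ z ∈ alloc qs, v _ z ∉ F ∧ v _ z ≠ l := by
  let G : Set (AnyVal Sg) := {a | a ∈ (VAtom.pred r.head l args).vals} ∪ Sigma.mk Sg.loc '' F
  have hG : G.Finite := (List.finite_toSet _).union (hF.image _)
  have : ∀ s, ∃ d : Sg.Var s → Sg.Univ s, Function.Injective d ∧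
      ∀ x, (⟨s, d x⟩ : AnyVal Sg) ∉ G := fun s => by
    have := Sg.var_countable s
    have := Sg.univ_infinite s
    exact exists_injection_compl
      (hG.preimage (f := fun x : Sg.Univ s => (⟨s, x⟩ : AnyVal Sg)) sigma_mk_injective.injOn)
  choose d hd hdG using this
  obtain ⟨v, h1, h2, h3⟩ := exists_on_formals r l args d
  have hhead : r.headVal v = .pred r.head l args := by
    simp only [Rule.headVal, h1, h2]
  have hz : ∀ z ∈ alloc qs, v _ z = d _ z := fun z hz => h3 _ z ((hs.alloc_iff z).1 hz).2
  have hzF : ∀ z ∈ alloc qs, (⟨Sg.loc, v _ z⟩ : AnyVal Sg) ∉ G := fun z h => by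
    rw [hz z h]; exact hdG _ z
  have hform : ∀ x : LVar Sg, (⟨Sg.loc, x⟩ : AnyVar Sg) ∈ r.formals →
      (⟨Sg.loc, v _ x⟩ : AnyVal Sg) ∈ G := by
    intro x hx
    refine Or.inl ?_
    rw [Set.mem_ofPred_eq, ← hhead]
    simp only [Rule.headVal, VAtom.vals, List.mem_cons, List.mem_ofFn]
    rcases mem_formals.1 hx with h | ⟨i, h⟩
    · cases h; exact Or.inl rfl
    · exact Or.inr ⟨i,
        (congrArg (fun w : AnyVar Sg => (⟨w.1, v w.1 w.2⟩ : AnyVal Sg)) h).symm⟩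
  refine ⟨v, hhead, hs.pureHolds fun x y hne hy hx _ heq => ?_, ?_, fun z h => ⟨fun h' => ?_, ?_⟩⟩
  · rcases hx with hx | hx
    · exact hzF y hy (heq ▸ hform x hx)
    · rw [hz x hx, hz y hy] at heq
      exact hne (hd _ heq)
  · refine Multiset.Nodup.map_on (fun x hx y hy h => ?_) hs.nodup
    rw [hz x hx, hz y hy] at h
    exact hd _ h
  · exact hzF z h (Or.inr ⟨_, h', rfl⟩)
  · intro h'
    exact hzF z h (h' ▸ Or.inl List.mem_cons_self)

/-- A model of a predicate atom is made of the record prescribed by a rule and of models of the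
atoms in the body of the rule. -/
theorem hasModel_of_rule {r : Rule Sg} (hr : r ∈ R) {ys qs}
    (hs : RuleShape r ys qs) (Q : VAtom Sg → Heap Sg → Prop)
    (hQ : ∀ b ∈ qs, ∀ v, HasModel R (Q (b.eval v)) (b.eval v)) (l : Loc Sg)
    (args : (i : Fin (Sg.arity r.head)) → Sg.Univ (Sg.argSort r.head i)) :
    HasModel R (fun h => ∃ v, r.headVal v = .pred r.head l args ∧
      h.lookup l = some (ys.map v.evalAny) ∧ ∀ b ∈ qs, ∃ k, HSub k h ∧ Q (b.eval v) k)
      (.pred r.head l args) := by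
  intro F hF hl
  obtain ⟨v, hhead, hpure, hnd, hz⟩ := exists_rule_store hs l args hF
  obtain ⟨h, m, hav, hQh⟩ := exists_model_of_hasModel Q (M := spEval v qs)
    (F := insert l F) (fun a ha => by
      obtain ⟨b, hb, rfl⟩ := Multiset.mem_map.1 ha
      exact hQ b hb v) (by rw [spEval_roots]; exact hnd) (hF.insert _) (by
      intro a ha
      obtain ⟨b, hb, rfl⟩ := Multiset.mem_map.1 ha
      rw [b.eval_root]
      have := hz _ (Multiset.mem_map_of_mem _ hb)
      rintro (h | h)
      · exact this.2 h
      · exact this.1 h)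
  have hroot : v _ r.root = l := congrArg VAtom.root hhead
  have hlh : l ∉ h := fun h' => hav l h' (Set.mem_insert _ _)
  have hd := singleton_disjoint (vs := ys.map v.evalAny).2 hlh
  refine ⟨Finmap.singleton l (ys.map v.evalAny) ∪ h, ?_, ?_, v, hhead,
    lookup_singleton_union _ _ _, ?_⟩
  · rw [← hhead]
    refine .single_pred hr hpure ?_
    rw [spEval_body hs, hroot]
    exact .pto _ _ _ _ hlh m
  · intro l' hl' hF'
    rcases Finmap.mem_union.1 hl' with h' | h'
    · rw [Finmap.mem_singleton] at h'
      exact hl (h' ▸ hF')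
    · exact hav l' h' (Or.inr hF')
  · intro b hb
    obtain ⟨k, hk, hQk⟩ := hQh _ (Multiset.mem_map_of_mem _ hb)
    exact ⟨k, hk.trans (hsub_right hd), hQk⟩

theorem HasModel.weaken {Q Q' : Heap Sg → Prop} {a : VAtom Sg} (h : HasModel R Q a)
    (hQ : ∀ h, Q h → Q' h) : HasModel R Q' a := fun F hF ha => by
  obtain ⟨h, m, hav, hq⟩ := h F hF ha
  exact ⟨h, m, hav, hQ h hq⟩

theorem RuleShape.pred_mem {r : Rule Sg} {ys qs} (hs : RuleShape r ys qs) {q x ts}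
    (h : Atom.pred q x ts ∈ qs) : Atom.pred q x ts ∈ r.body.sp := by
  rw [hs.sp_eq]; exact Multiset.mem_cons_of_mem h

/-- Every atom with a productive predicate symbol has models. -/
theorem Productive.hasModel (hdet : LocDeterministic R) {p : Sg.Pred} (hp : Productive R p) :
    ∀ l args, HasModel R (fun _ => True) (.pred p l args) := by
  induction hp with
  | mk r hr hq ih =>
    intro l args
    obtain ⟨ys, qs, hs⟩ := hdet.shape hr
    refine (hasModel_of_rule hr hs (fun _ _ => True) ?_ l args).weaken fun _ _ => trivial
    intro b hb v
    cases b with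
    | pto => exact (hs.isPred _ hb).elim
    | pred q x ts => exact ih q x ts (hs.pred_mem hb) _ _

theorem headVal_getElem? {r : Rule Sg} {v : Store Sg} {i : ℕ} {x : LVar Sg}
    (hi : r.formals[i]? = some ⟨Sg.loc, x⟩) : (r.headVal v).vals[i]? = some ⟨Sg.loc, v _ x⟩ := by
  have : (r.headVal v).vals = r.formals.map fun w => ⟨w.1, v w.1 w.2⟩ := by
    simp only [Rule.formals, List.map_cons, List.map_ofFn, Rule.headVal, VAtom.vals]
    rfl
  rw [this, List.getElem?_map, hi]
  rfl

/-- The value of an outgoing parameter occurs in a record of some model. -/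
theorem Out.hasModel (hdet : LocDeterministic R) (hprod : ∀ p, Productive R p) {p : Sg.Pred} {i : ℕ}
    (ho : Out R p i) : ∀ l args w, (VAtom.pred p l args).vals[i]? = some ⟨Sg.loc, w⟩ →
      HasModel R (fun h => Contains h w) (.pred p l args) := by
  have htriv : ∀ {r : Rule Sg} {ys qs}, RuleShape r ys qs → ∀ b ∈ qs, ∀ v : Store Sg,
      HasModel R (fun _ => True) (b.eval v) := by
    intro r ys qs hs b hb v
    cases b with
    | pto => exact (hs.isPred _ hb).elim
    | pred q x ts => exact (hprod q).hasModel hdet _ _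
  induction ho with
  | pto r hr i x hi ts hmem hx =>
    intro l args w hw
    obtain ⟨ys, qs, hs⟩ := hdet.shape hr
    have hts : ts = ys := by
      rw [hs.sp_eq, Multiset.mem_cons] at hmem
      rcases hmem with h | h
      · cases h; rfl
      · exact (hs.isPred _ h).elim
    subst hts
    refine (hasModel_of_rule hr hs (fun _ _ => True) (htriv hs) l args).weaken ?_
    rintro h ⟨v, hhead, hlook, _⟩
    refine ⟨l, _, hlook, List.mem_map.2 ⟨_, hx, ?_⟩⟩
    rw [← hhead, headVal_getElem? hi] at hw
    exact Option.some.inj hw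
  | pred r hr i x hi q y ts hmem j hj hx ih =>
    intro l args w hw
    obtain ⟨ys, qs, hs⟩ := hdet.shape hr
    refine (hasModel_of_rule hr hs
      (fun a k => (∃ l' args', a = .pred q l' args' ∧ a.vals[j]? = some ⟨Sg.loc, w⟩) →
        Contains k w) ?_ l args).weaken ?_
    · intro b hb v
      by_cases hc : ∃ l' args', b.eval v = .pred q l' args' ∧
          (b.eval v).vals[j]? = some ⟨Sg.loc, w⟩
      · obtain ⟨l', args', hbe, hj'⟩ := hc
        rw [hbe] at hj' ⊢
        exact (ih l' args' w hj').weaken fun _ h _ => h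
      · exact (htriv hs b hb v).weaken fun _ _ h => (hc h).elim
    · rintro h ⟨v, hhead, _, hq⟩
      have hqs : Atom.pred q y ts ∈ qs := by
        rw [hs.sp_eq, Multiset.mem_cons] at hmem
        rcases hmem with h | h
        · cases h
        · exact h
      obtain ⟨k, hk, hkw⟩ := hq _ hqs
      refine (hkw ⟨_, _, rfl, ?_⟩).mono hk
      rw [← hhead, headVal_getElem? hi] at hw
      rw [Atom.eval_vals, List.getElem?_map, hx, ← hw]
      rfl

/-- Every multiset of atoms with distinct roots has a model the domain of which avoids a given
finite set containing no root, and in the records of which a given argument of an atom occurs. -/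
theorem exists_model (hdet : LocDeterministic R) (hprod : ∀ p, Productive R p)
    (huse : NoUselessParam R) {M : Multiset (VAtom Sg)} (hnd : (M.map VAtom.root).Nodup)
    {F : Set (Loc Sg)} (hF : F.Finite) (hroot : ∀ a ∈ M, a.root ∉ F) (w : Loc Sg) :
    ∃ h, VM R h M ∧ (∀ l ∈ h, l ∉ F) ∧
      ((∃ a ∈ M, (⟨Sg.loc, w⟩ : AnyVal Sg) ∈ a.vals.tail) → Contains h w) := by
  have hM : ∀ a ∈ M, HasModel R
      (fun k => (⟨Sg.loc, w⟩ : AnyVal Sg) ∈ a.vals.tail → Contains k w) a := by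
    intro a ha
    cases a with
    | pto l vs =>
      intro F hF hl
      refine ⟨_, .single_pto l vs, fun l' hl' => ?_, fun hw => ?_⟩
      · rw [Finmap.mem_singleton] at hl'
        exact hl' ▸ hl
      · exact ⟨l, vs, Finmap.lookup_singleton_eq, hw⟩
    | pred p l args =>
      by_cases hw : (⟨Sg.loc, w⟩ : AnyVal Sg) ∈ (VAtom.pred p l args).vals.tail
      · obtain ⟨i, hi⟩ := List.mem_ofFn.1 hw
        refine HasModel.weaken (Out.hasModel hdet hprod (huse p i (congrArg Sigma.fst hi))
          l args w ?_) fun _ h _ => h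
        rw [VAtom.vals, List.getElem?_cons_succ, List.getElem?_ofFn, dif_pos i.2, ← hi]
      · exact ((hprod p).hasModel hdet l args).weaken fun _ _ h => (hw h).elim
  obtain ⟨h, m, hav, hQ⟩ := exists_model_of_hasModel
    (fun a k => (⟨Sg.loc, w⟩ : AnyVal Sg) ∈ a.vals.tail → Contains k w) hM hnd hF hroot
  refine ⟨h, m, hav, ?_⟩
  rintro ⟨a, ha, hw⟩
  obtain ⟨k, hk, hkw⟩ := hQ a ha
  exact (hkw hw).mono hk

/-! ### Generic stores and anti-axioms -/

/-- The assumptions on the set of inductive rules: it is `loc`-deterministic, all the predicate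
symbols are productive and all their non-root parameters of sort `loc` are outgoing. -/
structure Standing (R : Finset (Rule Sg)) : Prop where
  det : LocDeterministic R
  prod : ∀ p, Productive R p
  use : NoUselessParam R

theorem valid_iff {S : Sequent Sg} : S.Valid R ↔ ∀ st h, VM R h (spEval st S.lhs.sp) →
    PureHolds st S.lhs.pu → (∀ x ∈ S.V, st Sg.loc x ∉ h) → (S.V.map (st Sg.loc)).Nodup →
    VM R h (spEval st S.rhs.sp) ∧ PureHolds st S.rhs.pu := by
  simp only [Sequent.Valid, Sequent.CounterModel, models_iff]
  refine forall₂_congr fun st h => ?_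
  tauto

/-- A store that is injective and maps no variable to the value of a constant. -/
structure IsGeneric (st : Store Sg) : Prop where
  inj : ∀ s, Function.Injective (st s)
  ne_cst : ∀ s x c, st s x ≠ Sg.cval s c

theorem univ_nonempty (s : Sg.Srt) : Nonempty (Sg.Univ s) := by
  have := Sg.univ_infinite s
  infer_instance

theorem exists_generic_avoiding (hcst : ∀ s, Finite (Sg.Cst s)) (A : ∀ s, Set (Sg.Univ s))
    (hA : ∀ s, (A s).Finite) : ∃ st : Store Sg, IsGeneric st ∧ ∀ s x, st s x ∉ A s := by
  have : ∀ s, ∃ d : Sg.Var s → Sg.Univ s, Function.Injective d ∧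
      ∀ x, d x ∉ A s ∪ Set.range (Sg.cval s) := fun s => by
    have := Sg.var_countable s
    have := Sg.univ_infinite s
    have := hcst s
    exact exists_injection_compl ((hA s).union (Set.finite_range _))
  choose d hd hdA using this
  exact ⟨d, ⟨hd, fun s x c h => hdA s x (Or.inr ⟨c, h.symm⟩)⟩, fun s x h => hdA s x (Or.inl h)⟩

theorem exists_generic (hcst : ∀ s, Finite (Sg.Cst s)) : ∃ st : Store Sg, IsGeneric st := by
  obtain ⟨st, h, _⟩ := exists_generic_avoiding hcst (fun _ => ∅) fun _ => Set.finite_empty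
  exact ⟨st, h⟩

theorem IsGeneric.eval_injective {st : Store Sg} (hg : IsGeneric st) (s : Sg.Srt) :
    Function.Injective (st.eval (s := s)) := by
  rintro (x | c) (y | d) h
  · exact congrArg _ (hg.inj s h)
  · exact (hg.ne_cst s x d h).elim
  · exact (hg.ne_cst s y c h.symm).elim
  · exact congrArg _ (Sg.cval_injective s h)

theorem IsGeneric.evalAny_injective {st : Store Sg} (hg : IsGeneric st) :
    Function.Injective st.evalAny := by
  rintro ⟨s, t⟩ ⟨s', t'⟩ h
  simp only [Store.evalAny, Sigma.mk.injEq] at h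
  obtain ⟨rfl, h⟩ := h
  rw [hg.eval_injective s (eq_of_heq h)]

/-- The conditions on the store under which the left-hand side of a sequent has a model the domain
of which avoids the values of the variables of `V`: it satisfies the pure formula, and it is
injective on the multiset of the allocated variables and of the variables of `V`. -/
def Adm (φ : Spatial Sg) (ξ : Pure Sg) (V : Multiset (LVar Sg)) (st : Store Sg) : Prop :=
  PureHolds st ξ ∧ ((alloc φ + V).map (st Sg.loc)).Nodup

theorem Adm.nodup_V {φ : Spatial Sg} {ξ V} {st : Store Sg} (ha : Adm φ ξ V st) :
    (V.map (st Sg.loc)).Nodup := by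
  have := ha.2
  rw [Multiset.map_add, Multiset.nodup_add] at this
  exact this.2.1

theorem multiset_map_finite {α β : Type*} (M : Multiset α) (f : α → β) :
    {b | ∃ a ∈ M, f a = b}.Finite := by
  refine (M.toFinset.finite_toSet.image f).subset ?_
  rintro _ ⟨a, ha, rfl⟩
  exact ⟨a, by simpa using ha, rfl⟩

/-- The model can be chosen to avoid any finite set of locations that contains no root, and to
contain in a record a given location that is a non-root argument of an atom. -/
theorem Adm.exists_model (hR : Standing R) {φ : Spatial Sg} {ξ V} {st : Store Sg}
    (ha : Adm φ ξ V st) {F : Set (Loc Sg)} (hF : F.Finite)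
    (hroot : ∀ x ∈ alloc φ, st Sg.loc x ∉ F) (w : Loc Sg) :
    ∃ h, VM R h (spEval st φ) ∧ (∀ l ∈ h, l ∉ F) ∧ (∀ x ∈ V, st Sg.loc x ∉ h) ∧
      ((∃ a ∈ φ, (⟨Sg.loc, w⟩ : AnyVal Sg) ∈ (a.eval st).vals.tail) → Contains h w) := by
  have hnd := ha.2
  rw [Multiset.map_add, Multiset.nodup_add] at hnd
  obtain ⟨h, m, hav, hw⟩ := SL.exists_model hR.det hR.prod hR.use (M := spEval st φ)
    (by rw [spEval_roots]; exact hnd.1) (hF.union (multiset_map_finite V (st Sg.loc))) (by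
      intro a ha
      obtain ⟨b, hb, rfl⟩ := Multiset.mem_map.1 ha
      rw [b.eval_root]
      have hb' : b.root ∈ alloc φ := Multiset.mem_map_of_mem _ hb
      rintro (h | ⟨x, hx, h⟩)
      · exact hroot _ hb' h
      · exact Multiset.disjoint_left.1 hnd.2.2 (Multiset.mem_map_of_mem _ hb')
          (h ▸ Multiset.mem_map_of_mem _ hx)) w
  refine ⟨h, m, fun l hl hF => hav l hl (Or.inl hF), fun x hx hl => hav _ hl (Or.inr ⟨x, hx, rfl⟩),
    ?_⟩
  rintro ⟨a, ha, hw'⟩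
  exact hw ⟨_, Multiset.mem_map_of_mem _ ha, hw'⟩

theorem not_isAxiom {S : Sequent Sg} (h : ¬ S.IsAxiom) :
    (alloc S.lhs.sp + S.V).Nodup ∧ (∀ s t, PAtom.ne s s(t, t) ∉ S.lhs.pu) ∧
      ¬ (S.lhs.sp = S.rhs.sp ∧ S.rhs.pu ⊆ S.lhs.pu) := by
  simp only [Sequent.IsAxiom, not_or] at h
  obtain ⟨h1, h2, h3, h4, h5⟩ := h
  refine ⟨?_, fun s t ht => h2 ⟨s, t, ht⟩, h1⟩
  rw [Multiset.nodup_add, Multiset.disjoint_left]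
  exact ⟨not_not.1 h3, not_not.1 h5, fun hx hV => h4 ⟨_, hx, hV⟩⟩

theorem IsGeneric.pureHolds {st : Store Sg} (hg : IsGeneric st) {ξ : Pure Sg} (heq : EqFree ξ)
    (hne : ∀ s t, PAtom.ne s s(t, t) ∉ ξ) : PureHolds st ξ := by
  intro e he
  cases e with
  | eq s z => exact (heq s z he).elim
  | ne s z =>
    induction z using Sym2.ind with | _ a b =>
    refine holds_ne.2 fun h => ?_
    rw [hg.eval_injective s h] at he
    exact hne s b he

theorem IsGeneric.adm {st : Store Sg} (hg : IsGeneric st) {S : Sequent Sg} (hax : ¬ S.IsAxiom)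
    (heq : EqFree S.lhs.pu) : Adm S.lhs.sp S.lhs.pu S.V st :=
  ⟨hg.pureHolds heq (not_isAxiom hax).2.1, (not_isAxiom hax).1.map (hg.inj _)⟩

theorem Sequent.sortVars_finite (S : Sequent Sg) (s : Sg.Srt) :
    {x : Sg.Var s | (⟨s, x⟩ : AnyVar Sg) ∈ S.vars}.Finite :=
  S.vars_finite.preimage (f := fun x : Sg.Var s => (⟨s, x⟩ : AnyVar Sg))
    fun x _ y _ h => by simpa using h

/-- In a generic store, the left-hand side of a sequent has a model that allocates no variable of
the sequent other than the roots. -/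
theorem IsGeneric.exists_model (hR : Standing R) {st : Store Sg} (hg : IsGeneric st)
    {S : Sequent Sg} (hax : ¬ S.IsAxiom) (heq : EqFree S.lhs.pu) (w : Loc Sg) :
    ∃ h, VM R h (spEval st S.lhs.sp) ∧
      (∀ x : LVar Sg, (⟨Sg.loc, x⟩ : AnyVar Sg) ∈ S.vars → st _ x ∈ h → x ∈ alloc S.lhs.sp) ∧
      (∀ x ∈ S.V, st Sg.loc x ∉ h) ∧
      ((∃ a ∈ S.lhs.sp, (⟨Sg.loc, w⟩ : AnyVal Sg) ∈ (a.eval st).vals.tail) → Contains h w) := by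
  let F : Set (Loc Sg) := st Sg.loc '' ({x | (⟨Sg.loc, x⟩ : AnyVar Sg) ∈ S.vars} \
    {x | x ∈ alloc S.lhs.sp})
  have hF : F.Finite := by
    refine Set.Finite.image _ (Set.Finite.subset ?_ Set.sdiff_subset)
    exact S.sortVars_finite Sg.loc
  obtain ⟨h, m, hav, hV, hw⟩ := (hg.adm hax heq).exists_model hR hF (by
    rintro x hx ⟨y, hy, hxy⟩
    exact hy.2 (hg.inj _ hxy ▸ hx)) w
  refine ⟨h, m, fun x hx hxh => ?_, hV, hw⟩
  by_contra hxa
  exact hav _ hxh ⟨x, ⟨hx, hxa⟩, rfl⟩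

theorem VM.exists_part {h : Heap Sg} {M : Multiset (VAtom Sg)} (m : VM R h M) {a : VAtom Sg}
    (ha : a ∈ M) : ∃ k, HSub k h ∧ VM R k {a} := by
  rw [← Multiset.cons_erase ha] at m
  obtain ⟨k, k', hd, rfl, mk, _⟩ := m.cons_inv
  exact ⟨k, hsub_left _ _, mk⟩

theorem VM.parts_disjoint (hdet : LocDeterministic R) {h k k' : Heap Sg} {M : Multiset (VAtom Sg)}
    (m : VM R h M) {a b : VAtom Sg} (ha : a ∈ M) (hb : b ∈ M) (hne : a ≠ b) (hk : HSub k h)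
    (mk : VM R k {a}) (hk' : HSub k' h) (mk' : VM R k' {b}) : k.Disjoint k' := by
  rw [← Multiset.cons_erase ha] at m
  obtain ⟨k₁, h₁, hd, rfl, mk₁, m₁⟩ := m.cons_inv
  obtain ⟨k₂, hk₂, mk₂⟩ := m₁.exists_part ((Multiset.mem_erase_of_ne hne.symm).2 hb)
  rw [mk.unique hdet mk₁ hk (hsub_left _ _), mk'.unique hdet mk₂ hk' (hk₂.trans (hsub_right hd))]
  exact fun l hl hl' => hd l hl (hk₂.mem hl')

theorem loc_mem_vals {st : Store Sg} {a : Atom Sg} {l : Loc Sg}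
    (h : (⟨Sg.loc, l⟩ : AnyVal Sg) ∈ (a.eval st).vals) :
    ∃ y : LVar Sg, lterm y ∈ a.terms ∧ l = st _ y := by
  rw [Atom.eval_vals] at h
  obtain ⟨⟨s, t⟩, ht, hte⟩ := List.mem_map.1 h
  simp only [Store.evalAny, Sigma.mk.injEq] at hte
  obtain ⟨rfl, hte⟩ := hte
  cases t with
  | cst c => exact (Sg.cst_loc_isEmpty.false c).elim
  | var z => exact ⟨z, ht, (eq_of_heq hte).symm⟩

/-- A location that occurs in a record is allocated or is the value of a variable. -/
theorem VM.contains_mem_or (hdet : LocDeterministic R) {st : Store Sg} {h : Heap Sg}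
    {ψ : Spatial Sg} (m : VM R h (spEval st ψ)) {l : Loc Sg} (hc : Contains h l) :
    l ∈ h ∨ ∃ a ∈ ψ, ∃ y : LVar Sg, lterm y ∈ a.terms ∧ l = st _ y := by
  obtain ⟨l₀, vs, hl₀, hl⟩ := hc
  rcases m.loc_mem_or hdet hl₀ hl with h | ⟨a, ha, h⟩
  · exact Or.inl h
  · obtain ⟨b, hb, rfl⟩ := Multiset.mem_map.1 ha
    exact Or.inr ⟨b, hb, loc_mem_vals h⟩

theorem spVars_lhs_subset {S : Sequent Sg} {v : AnyVar Sg} (h : v ∈ spVars S.lhs.sp) : v ∈ S.vars :=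
  Or.inl (Or.inl (Or.inl h))

theorem spVars_rhs_subset {S : Sequent Sg} {v : AnyVar Sg} (h : v ∈ spVars S.rhs.sp) : v ∈ S.vars :=
  Or.inl (Or.inr (Or.inl h))

theorem VM.alloc_mem (hdet : LocDeterministic R) {st : Store Sg} {h : Heap Sg} {φ : Spatial Sg}
    (m : VM R h (spEval st φ)) {x : LVar Sg} (hx : x ∈ alloc φ) : st _ x ∈ h := by
  obtain ⟨a, ha, rfl⟩ := Multiset.mem_map.1 hx
  rw [← a.eval_root st]
  exact m.root_mem hdet _ (Multiset.mem_map_of_mem _ ha)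

/-- All the location arguments of an atom are successors of its root: this is where the assumption
that all the parameters are outgoing is used. -/
theorem edge_of_mem_terms (huse : NoUselessParam R) {φ : Spatial Sg} {a : Atom Sg} (ha : a ∈ φ)
    {y : LVar Sg} (hy : lterm y ∈ a.terms) : y = a.root ∨ Edge R φ a.root y := by
  cases a with
  | pto x ts =>
    rcases List.mem_cons.1 hy with h | h
    · simp only [lterm, Sigma.mk.injEq, heq_eq_eq, true_and, Term.var.injEq] at h
      exact Or.inl h
    · exact Or.inr (Or.inl ⟨ts, ha, h⟩)
  | pred p x ts =>
    rcases List.mem_cons.1 hy with h | h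
    · simp only [lterm, Sigma.mk.injEq, heq_eq_eq, true_and, Term.var.injEq] at h
      exact Or.inl h
    · obtain ⟨i, hi⟩ := List.mem_ofFn.1 h
      refine Or.inr (Or.inr ⟨p, ts, i + 1, ha, huse p i (congrArg Sigma.fst hi), ?_⟩)
      rw [Atom.terms, List.getElem?_cons_succ, List.getElem?_ofFn, dif_pos i.2, ← hi]

/-- The locations of the heap are reachable from the roots of the right-hand side.  Since only the
roots of the left-hand side are both allocated and values of variables, a path in the heap follows
the edges between the atoms of the left-hand side. -/
theorem reachable_of_valid (hR : Standing R) {st : Store Sg} (hg : IsGeneric st) {S : Sequent Sg}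
    {h : Heap Sg} (m : VM R h (spEval st S.lhs.sp)) (m' : VM R h (spEval st S.rhs.sp))
    (hgen : ∀ x : LVar Sg, (⟨Sg.loc, x⟩ : AnyVar Sg) ∈ S.vars → st _ x ∈ h → x ∈ alloc S.lhs.sp)
    {x : LVar Sg} (hx : x ∈ alloc S.lhs.sp) :
    ∃ y ∈ alloc S.rhs.sp, Relation.ReflTransGen (Edge R S.lhs.sp) y x := by
  let D : Set (Loc Sg) := {l | ∃ a ∈ S.lhs.sp, ∃ k, HSub k h ∧ VM R k {a.eval st} ∧ l ∈ k ∧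
    ∃ y ∈ alloc S.rhs.sp, Relation.ReflTransGen (Edge R S.lhs.sp) y a.root}
  have hroot : ∀ b ∈ S.lhs.sp, (∃ y ∈ alloc S.rhs.sp,
      Relation.ReflTransGen (Edge R S.lhs.sp) y b.root) → st _ b.root ∈ D := by
    intro b hb hr
    obtain ⟨k, hk, mk⟩ := m.exists_part (Multiset.mem_map_of_mem _ hb)
    refine ⟨b, hb, k, hk, mk, ?_, hr⟩
    rw [← b.eval_root st]
    exact mk.root_mem hR.det _ (Multiset.mem_singleton_self _)
  have hD : ∀ l ∈ h, l ∈ D := by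
    refine m'.mem_of_closed hR.det D ?_ ?_
    · intro a ha
      obtain ⟨c, hc, rfl⟩ := Multiset.mem_map.1 ha
      have hc' : c.root ∈ alloc S.rhs.sp := Multiset.mem_map_of_mem _ hc
      obtain ⟨b, hb, hbc⟩ := Multiset.mem_map.1
        (hgen c.root (spVars_rhs_subset (mem_spVars_root hc')) (m'.alloc_mem hR.det hc'))
      rw [c.eval_root, ← hbc]
      exact hroot b hb ⟨c.root, hc', hbc ▸ .refl⟩
    · rintro l ⟨a, ha, k, hk, mk, hlk, hreach⟩ vs hl l' hl' hvs
      have hkl : k.lookup l = some vs := by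
        obtain ⟨vs', hvs'⟩ := Finmap.mem_iff.1 hlk
        have := hk _ _ hvs'
        rw [hl] at this
        rw [hvs', this]
      have mk' : VM R k (spEval st {a}) := by rwa [spEval_singleton]
      rcases mk'.contains_mem_or hR.det ⟨l, vs, hkl, hvs⟩ with h' | ⟨b, hb, y, hy, rfl⟩
      · exact ⟨a, ha, k, hk, mk, h', hreach⟩
      · rw [Multiset.mem_singleton] at hb
        subst hb
        obtain ⟨b', hb', rfl⟩ := Multiset.mem_map.1
          (hgen y (spVars_lhs_subset ⟨b, ha, hy⟩) hl')
        refine hroot b' hb' ?_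
        obtain ⟨z, hz, hreach⟩ := hreach
        rcases edge_of_mem_terms hR.use ha hy with h' | h'
        · exact ⟨z, hz, h' ▸ hreach⟩
        · exact ⟨z, hz, hreach.tail h'⟩
  obtain ⟨c, hc, rfl⟩ := Multiset.mem_map.1 hx
  obtain ⟨a, ha, k, hk, mk, hck, hreach⟩ := hD _ (m.alloc_mem hR.det hx)
  by_cases hac : a.eval st = c.eval st
  · have := congrArg VAtom.root hac
    rw [Atom.eval_root, Atom.eval_root] at this
    rwa [← hg.inj _ this]
  · obtain ⟨k', hk', mk'⟩ := m.exists_part (Multiset.mem_map_of_mem (Atom.eval st) hc)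
    refine (m.parts_disjoint hR.det (Multiset.mem_map_of_mem _ ha) (Multiset.mem_map_of_mem _ hc)
      hac hk mk hk' mk' _ hck ?_).elim
    rw [← c.eval_root st]
    exact mk'.root_mem hR.det _ (Multiset.mem_singleton_self _)

theorem mem_tail_vals {st : Store Sg} {a : Atom Sg} {x : LVar Sg} (hx : lterm x ∈ a.terms)
    (hne : x ≠ a.root) : (⟨Sg.loc, st _ x⟩ : AnyVal Sg) ∈ (a.eval st).vals.tail := by
  rw [Atom.eval_vals, ← List.map_tail]
  refine List.mem_map.2 ⟨lterm x, ?_, rfl⟩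
  rw [a.terms_eq] at hx
  rcases List.mem_cons.1 hx with h | h
  · simp only [lterm, Sigma.mk.injEq, heq_eq_eq, true_and, Term.var.injEq] at h
    exact (hne h).elim
  · exact h

/-- Anti-axioms are not valid: a generic model of the left-hand side allocates no variable other
than the roots, and any given non-allocated variable of the left-hand side occurs in a record of
such a model. -/
theorem Sequent.IsAntiAxiom.not_valid (hcst : ∀ s, Finite (Sg.Cst s)) (hR : Standing R)
    {S : Sequent Sg} (ha : S.IsAntiAxiom R) : ¬ S.Valid R := by
  obtain ⟨hax, heq, _, hcase⟩ := ha
  intro hvalid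
  rw [valid_iff] at hvalid
  obtain ⟨st, hg⟩ := exists_generic hcst
  have hadm := hg.adm hax heq
  have key : ∀ w, ∃ h, VM R h (spEval st S.lhs.sp) ∧ VM R h (spEval st S.rhs.sp) ∧
      (∀ x : LVar Sg, (⟨Sg.loc, x⟩ : AnyVar Sg) ∈ S.vars → st _ x ∈ h → x ∈ alloc S.lhs.sp) ∧
      ((∃ a ∈ S.lhs.sp, (⟨Sg.loc, w⟩ : AnyVal Sg) ∈ (a.eval st).vals.tail) → Contains h w) := by
    intro w
    obtain ⟨h, m, hgen, hV, hw⟩ := hg.exists_model hR hax heq w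
    exact ⟨h, m, (hvalid st h m hadm.1 hV hadm.nodup_V).1, hgen, hw⟩
  -- a non-allocated variable of the left-hand side that does not occur on the right-hand side
  -- occurs in a record of some model
  have key' : ∀ x : LVar Sg, (⟨Sg.loc, x⟩ : AnyVar Sg) ∈ spVars S.lhs.sp →
      (⟨Sg.loc, x⟩ : AnyVar Sg) ∉ spVars S.rhs.sp → x ∉ alloc S.lhs.sp → False := by
    rintro x ⟨a, ha, hx⟩ hx' hxa
    obtain ⟨h, m, m', hgen, hw⟩ := key (st _ x)
    have hc := hw ⟨a, ha, mem_tail_vals hx fun h' => hxa (h' ▸ Multiset.mem_map_of_mem _ ha)⟩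
    rcases m'.contains_mem_or hR.det hc with h' | ⟨b, hb, y, hy, hxy⟩
    · exact hxa (hgen x (spVars_lhs_subset ⟨a, ha, hx⟩) h')
    · exact hx' (hg.inj _ hxy ▸ ⟨b, hb, hy⟩)
  obtain ⟨w⟩ := univ_nonempty (Sg := Sg) Sg.loc
  obtain ⟨h, m, m', hgen, _⟩ := key w
  rcases hcase with ⟨x, hx, hx'⟩ | ⟨h0, hne⟩ | ⟨x, hx, _, hno⟩ | ⟨x, hxV, hx, hx'⟩ |
    ⟨x, hx, hx', hxa⟩
  · exact hx' (hgen x (spVars_rhs_subset (mem_spVars_root hx)) (m'.alloc_mem hR.det hx))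
  · rw [h0, spEval_zero] at m'
    rw [m'.zero_inv] at m
    obtain ⟨a, ha⟩ := Multiset.exists_mem_of_ne_zero hne
    exact Finmap.notMem_empty (m.alloc_mem hR.det (Multiset.mem_map_of_mem _ ha))
  · obtain ⟨y, hy, hr⟩ := reachable_of_valid hR hg m m' hgen hx
    exact hno y hy hr
  · refine key' x hx hx' fun hxa => ?_
    exact Multiset.disjoint_left.1 (Multiset.nodup_add.1 (not_isAxiom hax).1).2.2 hxa hxV
  · exact key' x hx hx' hxa

/-! ### Invertibility of the inference rules -/

theorem adm_of_model (hdet : LocDeterministic R) {st : Store Sg} {h : Heap Sg} {φ : Spatial Sg}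
    {ξ : Pure Sg} {V : Multiset (LVar Sg)} (m : VM R h (spEval st φ)) (hp : PureHolds st ξ)
    (hV : ∀ x ∈ V, st Sg.loc x ∉ h) (hnd : (V.map (st Sg.loc)).Nodup) : Adm φ ξ V st := by
  refine ⟨hp, ?_⟩
  rw [Multiset.map_add, Multiset.nodup_add, ← spEval_roots]
  refine ⟨m.roots_nodup hdet, hnd, Multiset.disjoint_left.2 fun hl hl' => ?_⟩
  obtain ⟨a, ha, rfl⟩ := Multiset.mem_map.1 hl
  obtain ⟨x, hx, hxa⟩ := Multiset.mem_map.1 hl'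
  exact hV x hx (hxa ▸ m.root_mem hdet a ha)

/-- `l ▷_V ξ` is sound. -/
theorem Entails.holds {l : SHeap Sg} {V : Multiset (LVar Sg)} {ξ : Pure Sg} (he : Entails l V ξ)
    {st : Store Sg} (ha : Adm l.sp l.pu V st) : PureHolds st ξ := by
  intro e hmem
  rcases he e hmem with h | ⟨s, t, rfl⟩ | ⟨s, c, d, hcd, rfl⟩ | ⟨x, y, rfl, hxy⟩
  · exact ha.1 e h
  · exact holds_eq.2 rfl
  · exact holds_ne.2 fun h => hcd (Sg.cval_injective s h)
  · refine holds_ne.2 fun h => ?_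
    have := Multiset.nodup_of_le (Multiset.map_le_map hxy) ha.2
    simp only [Multiset.insert_eq_cons, Multiset.map_cons, Multiset.map_singleton,
      Multiset.nodup_cons, Multiset.mem_singleton] at this
    exact this.1 h

/-- The store obtained by changing the value of one variable. -/
noncomputable def Store.upd (st : Store Sg) {s : Sg.Srt} (x : Sg.Var s) (u : Sg.Univ s) :
    Store Sg := Function.update st s (Function.update (st s) x u)

theorem Store.upd_self (st : Store Sg) {s : Sg.Srt} (x : Sg.Var s) (u : Sg.Univ s) :
    st.upd x u s x = u := by
  simp [Store.upd]

theorem Store.upd_of_ne (st : Store Sg) {s : Sg.Srt} (x : Sg.Var s) (u : Sg.Univ s) {s' : Sg.Srt}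
    {y : Sg.Var s'} (h : (⟨s', y⟩ : AnyVar Sg) ≠ ⟨s, x⟩) : st.upd x u s' y = st s' y := by
  by_cases hs : s' = s
  · subst hs
    have : y ≠ x := fun h' => h (by rw [h'])
    simp [Store.upd, this]
  · simp [Store.upd, hs]

theorem Store.upd_agree (st : Store Sg) {s : Sg.Srt} (x : Sg.Var s) (u : Sg.Univ s)
    {X : Set (AnyVar Sg)} (hx : (⟨s, x⟩ : AnyVar Sg) ∉ X) : Agree X (st.upd x u) st :=
  fun _ _ hy => st.upd_of_ne x u fun h => hx (h ▸ hy)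

/-- The variable `x` can be given a value that avoids a finite set, the locations of the heap and
the values of the variables of `V`. -/
theorem exists_fresh_upd (st : Store Sg) (h : Heap Sg) {V : Multiset (LVar Sg)} (hnd : V.Nodup)
    {s : Sg.Srt} (x : Sg.Var s)
    (hV : ∀ y ∈ V, (⟨Sg.loc, y⟩ : AnyVar Sg) ≠ ⟨s, x⟩ → st Sg.loc y ∉ h)
    (hinj : ∀ y ∈ V, ∀ z ∈ V, (⟨Sg.loc, y⟩ : AnyVar Sg) ≠ ⟨s, x⟩ →
      (⟨Sg.loc, z⟩ : AnyVar Sg) ≠ ⟨s, x⟩ → st Sg.loc y = st Sg.loc z → y = z)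
    {B : Set (Sg.Univ s)} (hB : B.Finite) :
    ∃ u, u ∉ B ∧ (∀ y ∈ V, st.upd x u Sg.loc y ∉ h) ∧ (V.map (st.upd x u Sg.loc)).Nodup := by
  let F : Set (Loc Sg) := {l | l ∈ h} ∪ {l | ∃ y ∈ V, st Sg.loc y = l}
  have hF : F.Finite := (heap_dom_finite h).union (multiset_map_finite _ _)
  have hF' : {u : Sg.Univ s | (⟨s, u⟩ : AnyVal Sg) ∈ Sigma.mk Sg.loc '' F}.Finite :=
    (hF.image _).preimage (f := fun u : Sg.Univ s => (⟨s, u⟩ : AnyVal Sg))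
      fun x _ y _ h => by simpa using h
  have := Sg.univ_infinite s
  obtain ⟨u, hu⟩ := (hB.union hF').exists_notMem
  have huF : ∀ y, (⟨Sg.loc, y⟩ : AnyVar Sg) = ⟨s, x⟩ → st.upd x u Sg.loc y ∉ F := by
    intro y hy
    cases hy
    rw [Store.upd_self]
    exact fun h' => hu (Or.inr ⟨u, h', rfl⟩)
  refine ⟨u, fun h' => hu (Or.inl h'), fun y hy => ?_, Multiset.Nodup.map_on ?_ hnd⟩
  · by_cases hyx : (⟨Sg.loc, y⟩ : AnyVar Sg) = ⟨s, x⟩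
    · exact fun h' => huF y hyx (Or.inl h')
    · rw [Store.upd_of_ne _ _ _ hyx]; exact hV y hy hyx
  · intro y hy z hz heq
    by_cases hyx : (⟨Sg.loc, y⟩ : AnyVar Sg) = ⟨s, x⟩ <;>
      by_cases hzx : (⟨Sg.loc, z⟩ : AnyVar Sg) = ⟨s, x⟩
    · simpa using hyx.trans hzx.symm
    · have := huF y hyx
      rw [heq, Store.upd_of_ne _ _ _ hzx] at this
      exact (this (Or.inr ⟨z, hz, rfl⟩)).elim
    · have := huF z hzx
      rw [← heq, Store.upd_of_ne _ _ _ hyx] at this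
      exact (this (Or.inr ⟨y, hy, rfl⟩)).elim
    · rw [Store.upd_of_ne _ _ _ hyx, Store.upd_of_ne _ _ _ hzx] at heq
      exact hinj y hy z hz hyx hzx heq

theorem term_subst_single {s : Sg.Srt} (x : Sg.Var s) (t u : Term Sg s) :
    u.subst (single x t) = if u = .var x then t else u := by
  cases u with
  | cst c => simp [Term.subst]
  | var y =>
    by_cases h : y = x
    · subst h; simp [Term.subst, single]
    · simp [Term.subst, single, h]

theorem term_subst_single_of_ne {s s' : Sg.Srt} (hs : s' ≠ s) (x : Sg.Var s) (t : Term Sg s)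
    (u : Term Sg s') : u.subst (single x t) = u := by
  cases u with
  | cst c => rfl
  | var y => simp [Term.subst, single, hs]

/-- Validity is preserved by substitutions, the composition of the substitution and a store being a
store.  The pure formula may be weakened by conjuncts that the substitution makes trivial. -/
theorem valid_subst (σ : Subst Sg) {φ : Spatial Sg} {ξ ξ₀ : Pure Sg} {V : Multiset (LVar Sg)}
    {γ : SHeap Sg} (hv : Sequent.Valid R ⟨⟨φ, ξ₀⟩, V, γ⟩)
    (hξ : ∀ st : Store Sg, PureHolds (st.comp σ) ξ → PureHolds (st.comp σ) ξ₀) :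
    Sequent.Valid R ⟨SHeap.subst σ ⟨φ, ξ⟩, V.map σ.onLoc, γ.subst σ⟩ := by
  rw [valid_iff] at hv ⊢
  intro st h m hp hV hnd
  simp only [SHeap.subst, spEval_subst, pureHolds_subst] at m hp ⊢
  have hmap : (V.map σ.onLoc).map (st Sg.loc) = V.map (st.comp σ Sg.loc) := by
    rw [Multiset.map_map]
    exact Multiset.map_congr rfl fun x _ => onLoc_eval st σ x
  refine hv (st.comp σ) h m (hξ st hp) (fun x hx => ?_) (by rw [← hmap]; exact hnd)
  rw [← onLoc_eval]
  exact hV _ (Multiset.mem_map_of_mem _ hx)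

theorem pureHolds_insert {st : Store Sg} {ξ : Pure Sg} {e : PAtom Sg} :
    PureHolds st (insert e ξ) ↔ e.Holds st ∧ PureHolds st ξ := Finset.forall_mem_insert _ _ _

theorem pureHolds_union {st : Store Sg} {ξ ξ' : Pure Sg} :
    PureHolds st (ξ ∪ ξ') ↔ PureHolds st ξ ∧ PureHolds st ξ' := Finset.forall_mem_union

theorem pureHolds_empty (st : Store Sg) : PureHolds st ∅ := by simp [PureHolds]

theorem valid_ruleR {φ : Spatial Sg} {ξ : Pure Sg} {V : Multiset (LVar Sg)} {γ : SHeap Sg}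
    {s : Sg.Srt} {x : Sg.Var s} {t : Term Sg s}
    (hv : (App.ruleR φ ξ V γ s x t).concl.Valid R) :
    ∀ P ∈ (App.ruleR φ ξ V γ s x t).prems, P.Valid R := by
  simp only [App.prems, List.mem_singleton, forall_eq]
  refine valid_subst _ hv fun st hp => pureHolds_insert.2 ⟨holds_eq.2 ?_, hp⟩
  rw [← eval_subst, ← eval_subst, term_subst_single, term_subst_single, if_pos rfl]
  split_ifs <;> rfl

theorem valid_ruleC {φ : Spatial Sg} {ξ : Pure Sg} {V : Multiset (LVar Sg)} {γ : SHeap Sg}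
    {x y : LVar Sg} (hv : (App.ruleC φ ξ V γ x y).concl.Valid R) :
    ∀ P ∈ (App.ruleC φ ξ V γ x y).prems, P.Valid R := by
  simp only [App.prems, List.mem_cons, List.not_mem_nil, or_false, forall_eq_or_imp, forall_eq]
  refine ⟨valid_subst _ hv fun _ => id, ?_⟩
  rw [App.concl, valid_iff] at hv
  rw [valid_iff]
  exact fun st h m hp => hv st h m (pureHolds_insert.1 hp).2

theorem valid_ruleE {l : SHeap Sg} {V : Multiset (LVar Sg)} {ψ : Spatial Sg} {ζ ζ' : Pure Sg}
    (hv : (App.ruleE l V ψ ζ ζ').concl.Valid R) :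
    ∀ P ∈ (App.ruleE l V ψ ζ ζ').prems, P.Valid R := by
  simp only [App.prems, List.mem_singleton, forall_eq]
  rw [App.concl, valid_iff] at hv
  rw [valid_iff]
  intro st h m hp hV hnd
  obtain ⟨m', hp'⟩ := hv st h m hp hV hnd
  exact ⟨m', (pureHolds_union.1 hp').1⟩

/-- The weakened disequations either hold in all models of the spatial formula, or they all involve
a variable that occurs nowhere else, apart from `V`, and that can be given a fresh value. -/
theorem valid_ruleW (hdet : LocDeterministic R) {φ : Spatial Sg} {ξ ξ' : Pure Sg}
    {V : Multiset (LVar Sg)} {γ : SHeap Sg} (hs : (App.ruleW φ ξ ξ' V γ).Side R)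
    (hax : ¬ (App.ruleW φ ξ ξ' V γ).concl.IsAxiom)
    (hv : (App.ruleW φ ξ ξ' V γ).concl.Valid R) :
    ∀ P ∈ (App.ruleW φ ξ ξ' V γ).prems, P.Valid R := by
  simp only [App.prems, List.mem_singleton, forall_eq]
  have hndV := (Multiset.nodup_add.1 (not_isAxiom hax).1).2.1
  rw [App.concl, valid_iff] at hv
  rw [valid_iff]
  intro st h m hp hV hnd
  rcases hs.2.2 with ⟨s, t, u, rfl, he⟩ | ⟨s, x, hξ', hx⟩
  · exact hv st h m (pureHolds_union.2 ⟨hp, he.holds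
      (adm_of_model hdet m (pureHolds_empty st) hV hnd)⟩) hV hnd
  · have hB : {u : Sg.Univ s | ∃ e ∈ ξ', ∃ t, t ≠ .var x ∧ e = .ne s s(.var x, t) ∧
        u = st.eval t}.Finite := by
      have : ∀ e ∈ ξ', ∃ u : Sg.Univ s, ∀ t, t ≠ .var x → e = .ne s s(.var x, t) →
          st.eval t = u := by
        intro e he
        obtain ⟨t, ht, rfl⟩ := hξ' e he
        refine ⟨st.eval t, fun t' ht' h' => ?_⟩
        simp only [PAtom.ne.injEq, heq_eq_eq, true_and, Sym2.eq_iff] at h'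
        rcases h' with ⟨_, rfl⟩ | ⟨rfl, _⟩
        · rfl
        · exact (ht' rfl).elim
      have hne := univ_nonempty (Sg := Sg) s
      choose! f hf using this
      refine (ξ'.finite_toSet.image f).subset ?_
      rintro u ⟨e, he, t, ht, het, rfl⟩
      exact ⟨e, he, (hf e he t ht het).symm⟩
    obtain ⟨u, hu, hV', hnd'⟩ := exists_fresh_upd st h hndV x (fun y hy _ => hV y hy)
      (fun y hy z hz _ _ heq => Multiset.inj_on_of_nodup_map hnd y hy z hz heq) hB
    have hag := st.upd_agree x u hx
    have hag₁ : Agree (spVars φ) (st.upd x u) st := hag.mono fun v hv => Or.inl (Or.inl hv)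
    have hag₂ : Agree (puVars ξ) (st.upd x u) st := hag.mono fun v hv => Or.inl (Or.inr hv)
    have hag₃ : Agree (spVars γ.sp) (st.upd x u) st := hag.mono fun v hv => Or.inr (Or.inl hv)
    have hag₄ : Agree (puVars γ.pu) (st.upd x u) st := hag.mono fun v hv => Or.inr (Or.inr hv)
    have := hv (st.upd x u) h (by rw [spEval_congr hag₁]; exact m)
      (pureHolds_union.2 ⟨(pureHolds_congr hag₂).2 hp, fun e he => ?_⟩) hV' hnd'
    · rwa [spEval_congr hag₃, pureHolds_congr hag₄] at this
    · obtain ⟨t, ht, rfl⟩ := hξ' e he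
      refine holds_ne.2 fun h' => hu ⟨_, he, t, ht, rfl, ?_⟩
      change st.upd x u s x = _ at h'
      rw [Store.upd_self] at h'
      rw [h']
      cases t with
      | cst c => rfl
      | var y =>
        refine st.upd_of_ne x u fun h => ht ?_
        simp only [Sigma.mk.injEq, heq_eq_eq, true_and] at h
        rw [h]

/-- The variable `x` occurs nowhere else, hence it can be given a fresh value. -/
theorem valid_ruleV {l : SHeap Sg} {V : Multiset (LVar Sg)} {γ : SHeap Sg} {x : LVar Sg}
    (hs : (App.ruleV l V γ x).Side R) (hax : ¬ (App.ruleV l V γ x).concl.IsAxiom)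
    (hv : (App.ruleV l V γ x).concl.Valid R) :
    ∀ P ∈ (App.ruleV l V γ x).prems, P.Valid R := by
  simp only [App.prems, List.mem_singleton, forall_eq]
  have hndV : (x ::ₘ V).Nodup := (Multiset.nodup_add.1 (not_isAxiom hax).1).2.1
  rw [App.concl, valid_iff] at hv
  rw [valid_iff]
  intro st h m hp hV hnd
  have hmem : ∀ y ∈ x ::ₘ V, (⟨Sg.loc, y⟩ : AnyVar Sg) ≠ ⟨Sg.loc, x⟩ → y ∈ V := fun y hy hne =>
    (Multiset.mem_cons.1 hy).resolve_left fun h' => hne (by rw [h'])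
  obtain ⟨u, _, hV', hnd'⟩ := exists_fresh_upd st h hndV x (fun y hy hne => hV y (hmem y hy hne))
    (fun y hy z hz hy' hz' heq =>
      Multiset.inj_on_of_nodup_map hnd y (hmem y hy hy') z (hmem z hz hz') heq) Set.finite_empty
  have hag := st.upd_agree x u hs
  have hag₁ : Agree (spVars l.sp) (st.upd x u) st := hag.mono fun v hv => Or.inl (Or.inl hv)
  have hag₂ : Agree (puVars l.pu) (st.upd x u) st := hag.mono fun v hv => Or.inl (Or.inr hv)
  have hag₃ : Agree (spVars γ.sp) (st.upd x u) st := hag.mono fun v hv => Or.inr (Or.inl hv)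
  have hag₄ : Agree (puVars γ.pu) (st.upd x u) st := hag.mono fun v hv => Or.inr (Or.inr hv)
  have := hv (st.upd x u) h (by rw [spEval_congr hag₁]; exact m) ((pureHolds_congr hag₂).2 hp)
    hV' hnd'
  rwa [spEval_congr hag₃, pureHolds_congr hag₄] at this

/-- An instance of a rule is determined by a substitution that maps the head of the rule to the
predicate atom. -/
theorem RuleInst.inv {r : Rule Sg} {A : Set (AnyVar Sg)} {a : Atom Sg} {l : SHeap Sg}
    (hi : RuleInst r A a l) : ∃ τ : Subst Sg, l = r.body.subst τ ∧
      ∀ st, a.eval st = r.headVal (st.comp τ) := by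
  cases hi with
  | mk τ x ts hroot hparams _ _ =>
    refine ⟨τ, rfl, fun st => ?_⟩
    simp only [Atom.eval, Rule.headVal, Store.comp, hroot, hparams]
    rfl

theorem valid_ruleU {p : Sg.Pred} {x : LVar Sg} {ts} {φ : Spatial Sg} {ξ : Pure Sg}
    {V : Multiset (LVar Sg)} {γ : SHeap Sg} {E : List (Rule Sg × SHeap Sg)}
    (hs : (App.ruleU p x ts φ ξ V γ E).Side R)
    (hv : (App.ruleU p x ts φ ξ V γ E).concl.Valid R) :
    ∀ P ∈ (App.ruleU p x ts φ ξ V γ E).prems, P.Valid R := by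
  simp only [App.prems, List.mem_map]
  rintro _ ⟨⟨r, l⟩, hq, rfl⟩
  have hr : r ∈ R := ((hs.2.1 r).1 (List.mem_map_of_mem hq)).1
  obtain ⟨τ, hl, heval⟩ := (hs.2.2 _ hq).inv
  dsimp only at hl
  subst hl
  rw [App.concl, valid_iff] at hv
  rw [valid_iff]
  intro st h m hp hV hnd
  refine hv st h ?_ (pureHolds_union.1 hp).2 hV hnd
  simp only [spEval_add] at m
  obtain ⟨h₁, h₂, hd, rfl, m₁, m₂⟩ := m.add_inv
  rw [spEval_cons, heval st]
  simp only [SHeap.subst, spEval_subst] at m₁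
  exact .pred r hr _ h₁ h₂ _ hd ((pureHolds_subst _ _ _).1 (pureHolds_union.1 hp).1) m₁ m₂

theorem RuleShape.subst_sp {r : Rule Sg} {ys qs} (hs : RuleShape r ys qs) {τ : Subst Sg}
    {x : LVar Sg} {us : List (AnyTerm Sg)} {ψ : Spatial Sg} {ζ : Pure Sg}
    (h : (⟨.pto x us ::ₘ ψ, ζ⟩ : SHeap Sg) = r.body.subst τ) :
    us = ys.map (AnyTerm.subst τ) ∧ ψ = spSubst τ qs ∧ ζ = puSubst τ r.body.pu := by
  simp only [SHeap.subst, SHeap.mk.injEq] at h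
  obtain ⟨h, rfl⟩ := h
  rw [hs.sp_eq, spSubst, Multiset.map_cons] at h
  rcases Multiset.cons_eq_cons.1 h with ⟨h', rfl⟩ | ⟨_, cs, _, h'⟩
  · cases h'
    exact ⟨rfl, rfl, rfl⟩
  · have : Atom.pto x us ∈ qs.map (Atom.subst τ) := by
      rw [h']; exact Multiset.mem_cons_self _ _
    obtain ⟨b, hb, hbe⟩ := Multiset.mem_map.1 this
    cases b with
    | pto => exact (hs.isPred _ hb).elim
    | pred => cases hbe

/-- By determinism, the rule unfolding the right-hand side is the one prescribed by the tuple that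
is allocated at its root. -/
theorem valid_ruleI (hdet : LocDeterministic R) {x : LVar Sg} {ys : List (AnyTerm Sg)}
    {φ : Spatial Sg} {ξ : Pure Sg} {V : Multiset (LVar Sg)} {p : Sg.Pred} {zs}
    {us : List (AnyTerm Sg)} {ψ' : Spatial Sg} {ζ' : Pure Sg} {σ : Subst Sg}
    (hs : (App.ruleI x ys φ ξ V p zs 0 ∅ us ψ' ζ' σ).Side R)
    (hv : (App.ruleI x ys φ ξ V p zs 0 ∅ us ψ' ζ' σ).concl.Valid R) :
    ∀ P ∈ (App.ruleI x ys φ ξ V p zs 0 ∅ us ψ' ζ' σ).prems, P.Valid R := by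
  simp only [App.prems, List.mem_singleton, forall_eq]
  obtain ⟨⟨r, hr, hi⟩, hσ, hus, hent⟩ := hs
  obtain ⟨τ, hl, heval⟩ := hi.inv
  obtain ⟨ysr, qs, hsh⟩ := hdet.shape hr
  obtain ⟨hus', hψ', hζ'⟩ := hsh.subst_sp hl
  rw [App.concl, valid_iff] at hv
  rw [valid_iff]
  intro st h m hp hV hnd
  refine ⟨?_, pureHolds_empty st⟩
  have m' := (hv st h m hp hV hnd).1
  simp only [Multiset.cons_zero, spEval_singleton] at m'
  obtain ⟨r₂, hr₂, v₂, hhead₂, hpure₂, n₂⟩ := VM.pred_inv m'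
  obtain ⟨ys₂, qs₂, hsh₂⟩ := hdet.shape hr₂
  have hag : Agree (Atom.pred p x zs).vars (st.comp σ) st := by
    intro s y hy
    by_contra hne
    refine (hσ s y fun h' => hne ?_).2 hy
    simp only [Store.comp, h', Store.eval]
  have hhead : r.headVal ((st.comp σ).comp τ) = r₂.headVal v₂ := by
    rw [← heval, Atom.eval_congr hag]; exact hhead₂
  have hys : ysr.map ((st.comp σ).comp τ).evalAny = ys.map st.evalAny := by
    rw [← hus, hus', List.map_map, List.map_map]
    exact List.map_congr_left fun t _ => by
      simp only [Function.comp, evalAny_subst]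
  have hys₂ : ys.map st.evalAny = ys₂.map v₂.evalAny := by
    rw [spEval_body hsh₂] at n₂
    simp only [spEval_cons, Atom.eval] at m
    obtain ⟨h₁, _, hh₁, _⟩ := m.pto_cons_inv
    obtain ⟨h₂, _, hh₂, _⟩ := n₂.pto_cons_inv
    have hroot : st _ x = v₂ _ r₂.root := congrArg VAtom.root hhead₂
    have e₁ := lookup_singleton_union (st _ x) (ys.map st.evalAny) h₁
    have e₂ := lookup_singleton_union (v₂ _ r₂.root) (ys₂.map v₂.evalAny) h₂
    rw [← hh₁, hroot] at e₁
    rw [← hh₂, e₁] at e₂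
    exact Option.some.inj e₂
  have hpure : PureHolds ((st.comp σ).comp τ) r.body.pu := by
    rw [← pureHolds_subst, ← hζ', ← pureHolds_subst]
    exact hent.holds (adm_of_model hdet m hp hV hnd)
  obtain ⟨_, heq⟩ := rule_eq_of_eval_eq hdet hr hr₂ hsh hsh₂ hhead (hys.trans hys₂) hpure hpure₂
  rw [← heq, spEval_body hsh, hys] at n₂
  have hroot : ((st.comp σ).comp τ) _ r.root = st _ x :=
    (congrArg VAtom.root hhead).trans (congrArg VAtom.root hhead₂).symm
  rw [hroot, ← spEval_subst, ← hψ', ← spEval_subst] at n₂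
  simp only [add_zero, spEval_cons]
  exact n₂

theorem union_left_cancel {a b c : Heap Sg} (hb : a.Disjoint b) (hc : a.Disjoint c)
    (h : a ∪ b = a ∪ c) : b = c := by
  rw [Finmap.union_comm_of_disjoint hb, Finmap.union_comm_of_disjoint hc] at h
  exact (Finmap.union_cancel hb.symm hc.symm).1 h

/-- By uniqueness of models inside a heap, a heap satisfying `M₁ + M₂` is split as the part
satisfying `M₁` prescribes. -/
theorem VM.second_of_first (hdet : LocDeterministic R) {h₁ h₂ : Heap Sg}
    {M₁ M₂ : Multiset (VAtom Sg)} (m : VM R (h₁ ∪ h₂) (M₁ + M₂)) (hd : h₁.Disjoint h₂)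
    (m₁ : VM R h₁ M₁) : VM R h₂ M₂ := by
  obtain ⟨k₁, k₂, hd', heq, n₁, n₂⟩ := m.add_inv
  have : h₁ = k₁ := m₁.unique hdet n₁ (hsub_left h₁ h₂) (heq ▸ hsub_left k₁ k₂)
  subst this
  rw [union_left_cancel hd hd' heq]
  exact n₂

/-- If the conclusion and the first premise of an application of `S` are valid, then so is the
second premise: every model of the latter is extended by a model of `φ₁`, and the model of `ψ₁`
inside the union is unique. -/
theorem valid_ruleS (hR : Standing R) {φ₁ φ₂ ψ₁ ψ₂ : Spatial Sg} {ξ : Pure Sg}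
    {V : Multiset (LVar Sg)} (hv : Sequent.Valid R ⟨⟨φ₁ + φ₂, ξ⟩, V, ⟨ψ₁ + ψ₂, ∅⟩⟩)
    (hv₁ : Sequent.Valid R ⟨⟨φ₁, ξ⟩, V + alloc φ₂, ⟨ψ₁, ∅⟩⟩) :
    Sequent.Valid R ⟨⟨φ₂, ξ⟩, V + alloc φ₁, ⟨ψ₂, ∅⟩⟩ := by
  rw [valid_iff] at hv hv₁ ⊢
  intro st h₂ m₂ hp hV hnd
  refine ⟨?_, pureHolds_empty st⟩
  have ha : ((alloc φ₂ + (V + alloc φ₁)).map (st Sg.loc)).Nodup :=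
    (adm_of_model hR.det m₂ hp hV hnd).2
  have ha₁ : Adm φ₁ ξ (V + alloc φ₂) st := by
    refine ⟨hp, ?_⟩
    rwa [show alloc φ₁ + (V + alloc φ₂) = alloc φ₂ + (V + alloc φ₁) by abel]
  obtain ⟨w⟩ := univ_nonempty (Sg := Sg) Sg.loc
  obtain ⟨h₁, m₁, hav, hV₁, _⟩ := ha₁.exists_model hR (heap_dom_finite h₂)
    (fun x hx => hV x (Multiset.mem_add.2 (Or.inr hx))) w
  have hd : h₁.Disjoint h₂ := hav
  have n₁ := (hv₁ st h₁ m₁ hp hV₁ ha₁.nodup_V).1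
  have hVV : (V.map (st Sg.loc)).Nodup := by
    rw [Multiset.map_add] at hnd
    exact (Multiset.nodup_add.1 hnd).1
  have n := (hv st (h₁ ∪ h₂) (by rw [spEval_add]; exact m₁.append m₂ hd) hp (fun x hx => by
    rw [Finmap.mem_union, not_or]
    exact ⟨hV₁ x (Multiset.mem_add.2 (Or.inl hx)), hV x (Multiset.mem_add.2 (Or.inl hx))⟩) hVV).1
  rw [spEval_add] at n
  exact n.second_of_first hR.det hd n₁

/-! ### Equations between constants -/

theorem ConstantsSeparated.mono {ξ ξ' : Pure Sg} (h : ConstantsSeparated ξ)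
    (hsub : ∀ s e, PAtom.eq s e ∈ ξ' → PAtom.eq s e ∈ ξ) : ConstantsSeparated ξ' := by
  intro s t c hg
  obtain ⟨h1, h2⟩ := h s t c (Relation.EqvGen.mono (fun _ _ hab => hsub s _ hab) _ _ hg)
  exact ⟨fun h' => h1 (hsub s _ h'), h2⟩

theorem ConstantsSeparated.of_subset {ξ ξ' : Pure Sg} (h : ConstantsSeparated ξ)
    (hsub : ξ' ⊆ ξ) : ConstantsSeparated ξ' := h.mono fun _ _ h => hsub h

theorem eq_mem_puSubst {σ : Subst Sg} {ξ : Pure Sg} {s : Sg.Srt} {a b : Term Sg s}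
    (h : PAtom.eq s s(a, b) ∈ puSubst σ ξ) :
    ∃ u w, PAtom.eq s s(u, w) ∈ ξ ∧ u.subst σ = a ∧ w.subst σ = b := by
  obtain ⟨e, he, hes⟩ := Finset.mem_image.1 h
  cases e with
  | ne => cases hes
  | eq s' z =>
    simp only [PAtom.subst, PAtom.eq.injEq] at hes
    obtain ⟨rfl, hz⟩ := hes
    induction z using Sym2.ind with | _ u w =>
    rw [heq_eq_eq, Sym2.map_mk, Sym2.eq_iff] at hz
    rcases hz with ⟨h1, h2⟩ | ⟨h1, h2⟩
    · exact ⟨u, w, he, h1, h2⟩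
    · exact ⟨w, u, by rwa [Sym2.eq_swap], h2, h1⟩

/-- A substituted term is related to the original one by the equation `x ≈ t`.  An equation of `ξ`
between distinct terms becomes trivial only if it is `x ≈ t`, which does not occur in `ξ`. -/
theorem ConstantsSeparated.ruleR {ξ : Pure Sg} {s : Sg.Srt} {x : Sg.Var s} {t : Term Sg s}
    (h : ConstantsSeparated (insert (.eq s s(.var x, t)) ξ)) (hnot : PAtom.eq s s(.var x, t) ∉ ξ) :
    ConstantsSeparated (puSubst (single x t) ξ) := by
  have h1 : ∀ s' (u : Term Sg s'), Relation.EqvGen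
      (fun a b => PAtom.eq s' s(a, b) ∈ insert (PAtom.eq s s(.var x, t)) ξ) u
      (u.subst (single x t)) := by
    intro s' u
    by_cases hs : s' = s
    · subst hs
      rw [term_subst_single]
      split_ifs with hu
      · subst hu; exact .rel _ _ (Finset.mem_insert_self _ _)
      · exact .refl _
    · rw [term_subst_single_of_ne hs]; exact .refl _
  intro s' t' c hg
  have hg' : Relation.EqvGen
      (fun a b => PAtom.eq s' s(a, b) ∈ insert (PAtom.eq s s(.var x, t)) ξ) t' (.cst c) := by
    clear hnot
    generalize Term.cst c = d at hg
    induction hg with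
    | rel a b hab =>
      obtain ⟨u, w, huw, rfl, rfl⟩ := eq_mem_puSubst hab
      exact ((h1 _ u).symm _ _).trans _ _ _
        ((Relation.EqvGen.rel _ _ (Finset.mem_insert_of_mem huw)).trans _ _ _ (h1 _ w))
    | refl a => exact .refl a
    | symm a b _ ih => exact ih.symm
    | trans a b c _ _ ih₁ ih₂ => exact ih₁.trans _ _ _ ih₂
  refine ⟨fun hmem => ?_, (h s' t' c hg').2⟩
  obtain ⟨u, w, huw, hu, hw⟩ := eq_mem_puSubst hmem
  have huc : Relation.EqvGen
      (fun a b => PAtom.eq s' s(a, b) ∈ insert (PAtom.eq s s(.var x, t)) ξ) u (.cst c) :=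
    (h1 s' u).trans _ _ _ (hu ▸ hg')
  by_cases huw' : u = w
  · subst huw'
    exact (h s' u c huc).1 (Finset.mem_insert_of_mem huw)
  · by_cases hs : s' = s
    · subst hs
      rw [term_subst_single] at hu hw
      rw [← hw] at hu
      split_ifs at hu with h2 h3 h3
      · exact huw' (h2.trans h3.symm)
      · subst h2 hu; exact hnot huw
      · subst h3 hu; exact hnot (by rwa [Sym2.eq_swap])
      · exact huw' hu
    · rw [term_subst_single_of_ne hs] at hu hw
      exact huw' (hu.trans hw.symm)

/-- Equations of sorts other than `loc` are not affected by a substitution of location variables,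
and there is no constant of sort `loc`. -/
theorem ConstantsSeparated.ruleC {ξ : Pure Sg} {x y : LVar Sg} (h : ConstantsSeparated ξ) :
    ConstantsSeparated (puSubst (single x (.var y)) ξ) := by
  intro s t c
  by_cases hs : s = Sg.loc
  · subst hs; exact (Sg.cst_loc_isEmpty.false c).elim
  · have key : ∀ a b : Term Sg s, PAtom.eq s s(a, b) ∈ puSubst (single x (.var y)) ξ →
        PAtom.eq s s(a, b) ∈ ξ := by
      intro a b hab
      obtain ⟨u, w, huw, rfl, rfl⟩ := eq_mem_puSubst hab
      rwa [term_subst_single_of_ne hs, term_subst_single_of_ne hs]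
    intro hg
    obtain ⟨h1, h2⟩ := h s t c (Relation.EqvGen.mono key _ _ hg)
    exact ⟨fun h' => h1 (key _ _ h'), h2⟩

/-! ### Splitting a valid sequent -/

theorem alloc_add (φ₁ φ₂ : Spatial Sg) : alloc (φ₁ + φ₂) = alloc φ₁ + alloc φ₂ :=
  Multiset.map_add _ _ _

theorem Adm.left {φ₁ φ₂ : Spatial Sg} {ξ V} {st : Store Sg} (h : Adm (φ₁ + φ₂) ξ V st) :
    Adm φ₁ ξ V st := by
  refine ⟨h.1, Multiset.nodup_of_le (Multiset.map_le_map ?_) h.2⟩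
  rw [alloc_add]
  exact add_le_add_left (Multiset.le_add_right _ _) V

theorem Adm.right {φ₁ φ₂ : Spatial Sg} {ξ V} {st : Store Sg} (h : Adm (φ₁ + φ₂) ξ V st) :
    Adm φ₂ ξ V st := by
  rw [add_comm] at h
  exact h.left

/-- In the store `st`, the splittings of the two sides of a sequent fit together: for all disjoint
heaps satisfying `φ₁` and `φ₂` respectively and avoiding the values of the variables of `V`, the
first one satisfies `ψ₁` and the second one satisfies `ψ₂`. -/
def Good (R : Finset (Rule Sg)) (φ₁ φ₂ ψ₁ ψ₂ : Spatial Sg) (V : Multiset (LVar Sg))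
    (st : Store Sg) : Prop :=
  ∀ h₁ h₂, VM R h₁ (spEval st φ₁) → VM R h₂ (spEval st φ₂) → h₁.Disjoint h₂ →
    (∀ x ∈ V, st Sg.loc x ∉ h₁) → (∀ x ∈ V, st Sg.loc x ∉ h₂) →
    VM R h₁ (spEval st ψ₁) ∧ VM R h₂ (spEval st ψ₂)

theorem Good.symm {φ₁ φ₂ ψ₁ ψ₂ : Spatial Sg} {V : Multiset (LVar Sg)} {st : Store Sg}
    (h : Good R φ₁ φ₂ ψ₁ ψ₂ V st) : Good R φ₂ φ₁ ψ₂ ψ₁ V st :=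
  fun h₂ h₁ m₂ m₁ hd hV₂ hV₁ => (h h₁ h₂ m₁ m₂ hd.symm hV₁ hV₂).symm

/-- The validity of a sequent with a sum on both sides. -/
abbrev SumValid (R : Finset (Rule Sg)) (φ₁ φ₂ ψ₁ ψ₂ : Spatial Sg) (ξ : Pure Sg)
    (V : Multiset (LVar Sg)) : Prop :=
  Sequent.Valid R ⟨⟨φ₁ + φ₂, ξ⟩, V, ⟨ψ₁ + ψ₂, ∅⟩⟩

theorem SumValid.symm {φ₁ φ₂ ψ₁ ψ₂ : Spatial Sg} {ξ : Pure Sg} {V : Multiset (LVar Sg)}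
    (h : SumValid R φ₁ φ₂ ψ₁ ψ₂ ξ V) : SumValid R φ₂ φ₁ ψ₂ ψ₁ ξ V := by
  rw [SumValid, add_comm φ₂, add_comm ψ₂]; exact h

/-- Whether `φ₂` satisfies `ψ₂` in a heap does not depend on the disjoint heap in which `φ₁`
satisfies `ψ₁`. -/
theorem SumValid.exchange (hdet : LocDeterministic R) {φ₁ φ₂ ψ₁ ψ₂ : Spatial Sg} {ξ : Pure Sg}
    {V : Multiset (LVar Sg)} (hv : SumValid R φ₁ φ₂ ψ₁ ψ₂ ξ V) {st : Store Sg}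
    (ha : Adm (φ₁ + φ₂) ξ V st) {h₁ h₂ : Heap Sg} (m₁ : VM R h₁ (spEval st φ₁))
    (m₂ : VM R h₂ (spEval st φ₂)) (hd : h₁.Disjoint h₂) (hV₁ : ∀ x ∈ V, st Sg.loc x ∉ h₁)
    (hV₂ : ∀ x ∈ V, st Sg.loc x ∉ h₂) (n₁ : VM R h₁ (spEval st ψ₁)) : VM R h₂ (spEval st ψ₂) := by
  have n := (valid_iff.1 hv st (h₁ ∪ h₂) (by rw [spEval_add]; exact m₁.append m₂ hd) ha.1
    (fun x hx => by
      rw [Finmap.mem_union, not_or]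
      exact ⟨hV₁ x hx, hV₂ x hx⟩) ha.nodup_V).1
  rw [spEval_add] at n
  exact n.second_of_first hdet hd n₁

/-- A single model of `φ₂` satisfying `ψ₂` suffices: it is compared with all the other ones by
means of models that are disjoint from all those under consideration. -/
theorem SumValid.good_of_right (hR : Standing R) {φ₁ φ₂ ψ₁ ψ₂ : Spatial Sg} {ξ : Pure Sg}
    {V : Multiset (LVar Sg)} (hv : SumValid R φ₁ φ₂ ψ₁ ψ₂ ξ V) {st : Store Sg}
    (ha : Adm (φ₁ + φ₂) ξ V st) {k : Heap Sg} (mk : VM R k (spEval st φ₂))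
    (hVk : ∀ x ∈ V, st Sg.loc x ∉ k) (hroot : ∀ x ∈ alloc φ₁, st Sg.loc x ∉ k)
    (nk : VM R k (spEval st ψ₂)) : Good R φ₁ φ₂ ψ₁ ψ₂ V st := by
  intro h₁ h₂ m₁ m₂ hd hV₁ hV₂
  have ha' : Adm (φ₂ + φ₁) ξ V st := by rwa [add_comm]
  obtain ⟨w⟩ := univ_nonempty (Sg := Sg) Sg.loc
  obtain ⟨k₁, mk₁, hav₁, hVk₁, _⟩ := ha.left.exists_model hR
    ((heap_dom_finite k).union (heap_dom_finite h₂)) (by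
      rintro x hx (h | h)
      · exact hroot x hx h
      · exact hd _ (m₁.alloc_mem hR.det hx) h) w
  obtain ⟨k₂, mk₂, hav₂, hVk₂, _⟩ := ha.right.exists_model hR
    ((heap_dom_finite k₁).union (heap_dom_finite h₁)) (by
      rintro x hx (h | h)
      · exact hav₁ _ h (Or.inr (m₂.alloc_mem hR.det hx))
      · exact hd _ h (m₂.alloc_mem hR.det hx)) w
  have hd₁ : k₁.Disjoint k := fun l hl hl' => hav₁ l hl (Or.inl hl')
  have hd₂ : k₁.Disjoint h₂ := fun l hl hl' => hav₁ l hl (Or.inr hl')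
  have hd₃ : k₁.Disjoint k₂ := fun l hl hl' => hav₂ l hl' (Or.inl hl)
  have hd₄ : h₁.Disjoint k₂ := fun l hl hl' => hav₂ l hl' (Or.inr hl)
  have n₁ := hv.symm.exchange hR.det ha' mk mk₁ hd₁.symm hVk hVk₁ nk
  have n₂ := hv.exchange hR.det ha mk₁ mk₂ hd₃ hVk₁ hVk₂ n₁
  exact ⟨hv.symm.exchange hR.det ha' mk₂ m₁ hd₄.symm hVk₂ hV₁ n₂,
    hv.exchange hR.det ha mk₁ m₂ hd₂ hVk₁ hV₂ n₁⟩

/-- The splitting is preserved by the maps on values that are injective around the locations of some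
model of `φ₂`: the image of this model satisfies `ψ₂`, and a single model suffices. -/
theorem SumValid.transfer_right (hR : Standing R) {φ₁ φ₂ ψ₁ ψ₂ : Spatial Sg} {ξ : Pure Sg}
    {V : Multiset (LVar Sg)} (hv : SumValid R φ₁ φ₂ ψ₁ ψ₂ ξ V) {st : Store Sg}
    (hg : Good R φ₁ φ₂ ψ₁ ψ₂ V st) {θ : VMap Sg} (hθ : θ.FixesCst)
    (ha' : Adm (φ₁ + φ₂) ξ V (θ.app st)) {k₁ k₂ : Heap Sg} (mk₁ : VM R k₁ (spEval st φ₁))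
    (mk₂ : VM R k₂ (spEval st φ₂)) (hd : k₁.Disjoint k₂) (hV₁ : ∀ x ∈ V, st Sg.loc x ∉ k₁)
    (hV₂ : ∀ x ∈ V, st Sg.loc x ∉ k₂)
    (hinj : ∀ l ∈ k₂, ∀ b, θ Sg.loc b = θ Sg.loc l → b = l) :
    Good R φ₁ φ₂ ψ₁ ψ₂ V (θ.app st) := by
  obtain ⟨_, n₂⟩ := hg k₁ k₂ mk₁ mk₂ hd hV₁ hV₂
  obtain ⟨k', hi, mk'⟩ := mk₂.image hR.det hθ hinj
  obtain ⟨k'', hi', nk'⟩ := n₂.image hR.det hθ hinj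
  rw [← hi.unique hi'] at nk'
  rw [spEval_map hθ] at mk' nk'
  have hmem : ∀ x : LVar Sg, θ.app st Sg.loc x ∈ k' → st Sg.loc x ∈ k₂ := by
    intro x hx
    obtain ⟨l, hl, hlx⟩ := hi.mem hx
    rwa [hinj l hl _ hlx.symm]
  exact hv.good_of_right hR ha' mk' (fun x hx h => hV₂ x hx (hmem x h))
    (fun x hx h => hd _ (mk₁.alloc_mem hR.det hx) (hmem x h)) nk'

/-- The splitting is preserved by the maps on values that identify no location allocated on one of
the two sides with another location. -/
theorem SumValid.transfer (hR : Standing R) {φ₁ φ₂ ψ₁ ψ₂ : Spatial Sg} {ξ : Pure Sg}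
    {V : Multiset (LVar Sg)} (hv : SumValid R φ₁ φ₂ ψ₁ ψ₂ ξ V) {st : Store Sg}
    (hg : Good R φ₁ φ₂ ψ₁ ψ₂ V st) {θ : VMap Sg} (hθ : θ.FixesCst)
    (ha' : Adm (φ₁ + φ₂) ξ V (θ.app st)) {k₁ k₂ : Heap Sg} (mk₁ : VM R k₁ (spEval st φ₁))
    (mk₂ : VM R k₂ (spEval st φ₂)) (hd : k₁.Disjoint k₂) (hV₁ : ∀ x ∈ V, st Sg.loc x ∉ k₁)
    (hV₂ : ∀ x ∈ V, st Sg.loc x ∉ k₂)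
    (hinj : (∀ l ∈ k₁, ∀ b, θ Sg.loc b = θ Sg.loc l → b = l) ∨
      ∀ l ∈ k₂, ∀ b, θ Sg.loc b = θ Sg.loc l → b = l) :
    Good R φ₁ φ₂ ψ₁ ψ₂ V (θ.app st) := by
  rcases hinj with hinj | hinj
  · exact (hv.symm.transfer_right hR hg.symm hθ (by rwa [add_comm]) mk₂ mk₁ hd.symm hV₂ hV₁
      hinj).symm
  · exact hv.transfer_right hR hg hθ ha' mk₁ mk₂ hd hV₁ hV₂ hinj

/-- Disjoint models of the two parts of the left-hand side. -/
theorem Adm.exists_models (hR : Standing R) {φ₁ φ₂ : Spatial Sg} {ξ V} {st : Store Sg}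
    (ha : Adm (φ₁ + φ₂) ξ V st) {F : Set (Loc Sg)} (hF : F.Finite)
    (hroot : ∀ x ∈ alloc (φ₁ + φ₂), st Sg.loc x ∉ F) :
    ∃ k₁ k₂, VM R k₁ (spEval st φ₁) ∧ VM R k₂ (spEval st φ₂) ∧ k₁.Disjoint k₂ ∧
      (∀ x ∈ V, st Sg.loc x ∉ k₁) ∧ (∀ x ∈ V, st Sg.loc x ∉ k₂) ∧ (∀ l ∈ k₁, l ∉ F) ∧
      ∀ l ∈ k₂, l ∉ F := by
  obtain ⟨w⟩ := univ_nonempty (Sg := Sg) Sg.loc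
  obtain ⟨k, m, hav, hV, _⟩ := ha.exists_model hR hF hroot w
  rw [spEval_add] at m
  obtain ⟨k₁, k₂, hd, rfl, m₁, m₂⟩ := m.add_inv
  simp only [Finmap.mem_union, not_or] at hav hV
  exact ⟨k₁, k₂, m₁, m₂, hd, fun x hx => (hV x hx).1, fun x hx => (hV x hx).2,
    fun l hl => hav l (Or.inl hl), fun l hl => hav l (Or.inr hl)⟩

theorem Good.congr {φ₁ φ₂ ψ₁ ψ₂ : Spatial Sg} {V : Multiset (LVar Sg)} {st st' : Store Sg}
    {X : Set (AnyVar Sg)} (hag : Agree X st st') (h1 : spVars φ₁ ⊆ X) (h2 : spVars φ₂ ⊆ X)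
    (h3 : spVars ψ₁ ⊆ X) (h4 : spVars ψ₂ ⊆ X)
    (hV : ∀ x ∈ V, (⟨Sg.loc, x⟩ : AnyVar Sg) ∈ X) (hg : Good R φ₁ φ₂ ψ₁ ψ₂ V st) :
    Good R φ₁ φ₂ ψ₁ ψ₂ V st' := by
  intro k₁ k₂ m₁ m₂ hd hV₁ hV₂
  have hV' : ∀ x ∈ V, st Sg.loc x = st' Sg.loc x := fun x hx => hag _ _ (hV x hx)
  rw [← spEval_congr (hag.mono h1)] at m₁
  rw [← spEval_congr (hag.mono h2)] at m₂
  rw [← spEval_congr (hag.mono h3), ← spEval_congr (hag.mono h4)]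
  exact hg k₁ k₂ m₁ m₂ hd (fun x hx => by rw [hV' x hx]; exact hV₁ x hx)
    fun x hx => by rw [hV' x hx]; exact hV₂ x hx

/-- Disequalities between the terms over `X` are reflected: if `st'` satisfies the conditions for
having a model and identifies all terms that `st` identifies, then so does `st`. -/
theorem Adm.reflect {φ : Spatial Sg} {ξ : Pure Sg} {V : Multiset (LVar Sg)} {st st' : Store Sg}
    {X : Set (AnyVar Sg)} (hφ : spVars φ ⊆ X) (hξ : puVars ξ ⊆ X)
    (hV : ∀ x ∈ V, (⟨Sg.loc, x⟩ : AnyVar Sg) ∈ X) (heq : EqFree ξ) (ha : Adm φ ξ V st')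
    (h : ∀ s (a b : Term Sg s), (∀ x, a = .var x → (⟨s, x⟩ : AnyVar Sg) ∈ X) →
      (∀ x, b = .var x → (⟨s, x⟩ : AnyVar Sg) ∈ X) → st.eval a = st.eval b →
      st'.eval a = st'.eval b) : Adm φ ξ V st := by
  constructor
  · intro e he
    have hp := ha.1 e he
    cases e with
    | eq s z => exact (heq s z he).elim
    | ne s z =>
      induction z using Sym2.ind with | _ a b =>
      rw [holds_ne] at hp ⊢
      refine fun hab => hp (h s a b ?_ ?_ hab)
      · rintro x rfl
        exact hξ ⟨_, he, x, rfl, Sym2.mem_mk_left _ _⟩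
      · rintro x rfl
        exact hξ ⟨_, he, x, rfl, Sym2.mem_mk_right _ _⟩
  · have hX : ∀ x ∈ alloc φ + V, (⟨Sg.loc, x⟩ : AnyVar Sg) ∈ X := by
      intro x hx
      rcases Multiset.mem_add.1 hx with hx | hx
      · exact hφ (mem_spVars_root hx)
      · exact hV x hx
    refine Multiset.Nodup.map_on (fun x hx y hy hxy => ?_) (Multiset.Nodup.of_map _ ha.2)
    refine Multiset.inj_on_of_nodup_map ha.2 x hx y hy (h Sg.loc (.var x) (.var y) ?_ ?_ hxy)
    · rintro z hz; cases hz; exact hX x hx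
    · rintro z hz; cases hz; exact hX y hy

/-- Two injective finite families are related by a permutation, because permutation groups are
multiply transitive. -/
theorem exists_perm {ι α : Type*} [Finite ι] {f g : ι → α} (hf : Function.Injective f)
    (hg : Function.Injective g) : ∃ π : Equiv.Perm α, ∀ i, π (f i) = g i := by
  obtain ⟨n, ⟨e⟩⟩ := Finite.exists_equiv_fin ι
  have := Equiv.Perm.isMultiplyPretransitive α n
  obtain ⟨π, hπ⟩ := MulAction.exists_smul_eq (Equiv.Perm α)
    (⟨f ∘ e.symm, hf.comp e.symm.injective⟩ : Fin n ↪ α) ⟨g ∘ e.symm, hg.comp e.symm.injective⟩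
  refine ⟨π, fun i => ?_⟩
  have := DFunLike.congr_fun hπ (e i)
  simpa using this

/-- The store equal to `st` on `Z` and to `g` elsewhere. -/
noncomputable def hybrid (Z : Set (AnyVar Sg)) (st g : Store Sg) : Store Sg :=
  fun s x => if (⟨s, x⟩ : AnyVar Sg) ∈ Z then st s x else g s x

/-- If `g` is generic and avoids the values of `st` on `X`, then the terms over `X` identified by a
hybrid store are identified by `st`. -/
theorem hybrid_eval {Z X : Set (AnyVar Sg)} {st g : Store Sg} (hg : IsGeneric g)
    (hgX : ∀ s (x y : Sg.Var s), (⟨s, y⟩ : AnyVar Sg) ∈ X → g s x ≠ st s y) (s : Sg.Srt)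
    (a b : Term Sg s) (ha : ∀ x, a = .var x → (⟨s, x⟩ : AnyVar Sg) ∈ X)
    (hb : ∀ x, b = .var x → (⟨s, x⟩ : AnyVar Sg) ∈ X)
    (h : (hybrid Z st g).eval a = (hybrid Z st g).eval b) : st.eval a = st.eval b := by
  have hcst : ∀ (x : Sg.Var s) (c : Sg.Cst s), hybrid Z st g s x = Sg.cval s c →
      st s x = Sg.cval s c := by
    intro x c hx
    unfold hybrid at hx
    split_ifs at hx with hZ
    · exact hx
    · exact (hg.ne_cst s x c hx).elim
  cases a with
  | cst c =>
    cases b with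
    | cst d => exact h
    | var y => exact (hcst y c h.symm).symm
  | var x =>
    cases b with
    | cst d => exact hcst x d h
    | var y =>
      change hybrid Z st g s x = hybrid Z st g s y at h
      unfold hybrid at h
      split_ifs at h with h1 h2 h2
      · exact h
      · exact (hgX s y x (ha x rfl) h.symm).elim
      · exact (hgX s x y (hb y rfl) h).elim
      · exact congrArg (st s) (hg.inj s h)

/-- The map sending the value `u` to `c`, and fixing the other values. -/
noncomputable def collapse {s : Sg.Srt} (u c : Sg.Univ s) : VMap Sg :=
  Function.update (fun _ => id) s (Function.update id u c)

theorem collapse_self {s : Sg.Srt} (u c : Sg.Univ s) : collapse u c s u = c := by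
  simp [collapse]

theorem collapse_of_ne {s s' : Sg.Srt} (u c : Sg.Univ s) (b : Sg.Univ s')
    (h : (⟨s', b⟩ : AnyVal Sg) ≠ ⟨s, u⟩) : collapse u c s' b = b := by
  by_cases hs : s' = s
  · subst hs
    have : b ≠ u := fun h' => h (by rw [h'])
    simp [collapse, this]
  · simp [collapse, hs]

theorem collapse_inj {s : Sg.Srt} (u c : Sg.Univ s) {l b : Loc Sg}
    (hu : (⟨Sg.loc, l⟩ : AnyVal Sg) ≠ ⟨s, u⟩) (hc : (⟨Sg.loc, l⟩ : AnyVal Sg) ≠ ⟨s, c⟩)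
    (h : collapse u c Sg.loc b = collapse u c Sg.loc l) : b = l := by
  rw [collapse_of_ne u c l hu] at h
  by_cases hb : (⟨Sg.loc, b⟩ : AnyVal Sg) = ⟨s, u⟩
  · cases hb
    rw [collapse_self] at h
    exact (hc (by rw [h])).elim
  · rwa [collapse_of_ne u c b hb] at h

/-- One step of the specialization of a store: the value of one variable, which is isolated in the
store, becomes arbitrary.  The new value is allocated on one side at most, and the models of the
other side are preserved. -/
theorem SumValid.good_insert (hR : Standing R) {φ₁ φ₂ ψ₁ ψ₂ : Spatial Sg} {ξ : Pure Sg}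
    {V : Multiset (LVar Sg)} (hv : SumValid R φ₁ φ₂ ψ₁ ψ₂ ξ V) {X Z : Set (AnyVar Sg)}
    (h1 : spVars φ₁ ⊆ X) (h2 : spVars φ₂ ⊆ X) (h3 : spVars ψ₁ ⊆ X) (h4 : spVars ψ₂ ⊆ X)
    (hV : ∀ x ∈ V, (⟨Sg.loc, x⟩ : AnyVar Sg) ∈ X) {st g : Store Sg} (hg : IsGeneric g)
    (hgX : ∀ s (x y : Sg.Var s), (⟨s, y⟩ : AnyVar Sg) ∈ X → g s x ≠ st s y)
    (hadm : ∀ Z, Adm (φ₁ + φ₂) ξ V (hybrid Z st g))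
    (hadm' : ∀ st₁ st₂ : Store Sg, Agree X st₁ st₂ → Adm (φ₁ + φ₂) ξ V st₂ →
      Adm (φ₁ + φ₂) ξ V st₁)
    (hroot : ∀ x ∈ alloc (φ₁ + φ₂), (⟨Sg.loc, x⟩ : AnyVar Sg) ∈ Z) {s : Sg.Srt} {y : Sg.Var s}
    (hy : (⟨s, y⟩ : AnyVar Sg) ∉ Z) (hgood : Good R φ₁ φ₂ ψ₁ ψ₂ V (hybrid Z st g)) :
    Good R φ₁ φ₂ ψ₁ ψ₂ V (hybrid (insert ⟨s, y⟩ Z) st g) := by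
  have hrootX : ∀ x ∈ alloc (φ₁ + φ₂), (⟨Sg.loc, x⟩ : AnyVar Sg) ∈ X := by
    intro x hx
    rw [alloc_add, Multiset.mem_add] at hx
    rcases hx with hx | hx
    · exact h1 (mem_spVars_root hx)
    · exact h2 (mem_spVars_root hx)
  -- on `X`, the new store is the image of the old one by the map sending `g s y` to `st s y`
  have hag : Agree X ((collapse (g s y) (st s y)).app (hybrid Z st g))
      (hybrid (insert ⟨s, y⟩ Z) st g) := by
    intro s' x hx
    by_cases hxy : (⟨s', x⟩ : AnyVar Sg) = ⟨s, y⟩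
    · cases hxy
      simp only [VMap.app, hybrid, if_neg hy, collapse_self, if_pos (Set.mem_insert _ _)]
    · have hval : (⟨s', hybrid Z st g s' x⟩ : AnyVal Sg) ≠ ⟨s, g s y⟩ := by
        intro h
        simp only [Sigma.mk.injEq] at h
        obtain ⟨rfl, h⟩ := h
        rw [heq_eq_eq] at h
        unfold hybrid at h
        split_ifs at h with hZ
        · exact hgX s' y x hx h.symm
        · exact hxy (by rw [hg.inj s' h])
      rw [VMap.app, collapse_of_ne _ _ _ hval]
      simp only [hybrid, Set.mem_insert_iff, hxy, false_or]
  have hθ : (collapse (g s y) (st s y)).FixesCst := by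
    intro s' c
    refine collapse_of_ne _ _ _ fun h => ?_
    simp only [Sigma.mk.injEq] at h
    obtain ⟨rfl, h⟩ := h
    exact hg.ne_cst s' y c (eq_of_heq h).symm
  have hF : {l : Loc Sg | (⟨Sg.loc, l⟩ : AnyVal Sg) = ⟨s, g s y⟩}.Finite :=
    Set.Subsingleton.finite fun a ha b hb => by
      have : (⟨Sg.loc, a⟩ : AnyVal Sg) = ⟨Sg.loc, b⟩ := Eq.trans ha (Eq.symm hb)
      simpa using this
  obtain ⟨k₁, k₂, m₁, m₂, hd, hV₁, hV₂, hF₁, hF₂⟩ := (hadm Z).exists_models hR hF (by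
    intro x hx h
    simp only [hybrid, if_pos (hroot x hx)] at h
    have hxX := hrootX x hx
    simp only [Set.mem_ofPred_eq, Sigma.mk.injEq] at h
    obtain ⟨rfl, h⟩ := h
    exact hgX _ y x hxX (eq_of_heq h).symm)
  refine Good.congr hag h1 h2 h3 h4 hV
    (hv.transfer hR hgood hθ (hadm' _ _ hag (hadm _)) m₁ m₂ hd hV₁ hV₂ ?_)
  -- the new value of `y` cannot be allocated both in `k₁` and in `k₂`
  by_cases hc : ∃ l ∈ k₁, (⟨Sg.loc, l⟩ : AnyVal Sg) = ⟨s, st s y⟩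
  · obtain ⟨c, hc, hcy⟩ := hc
    refine Or.inr fun l hl b hb => collapse_inj _ _ (hF₂ l hl) (fun h => ?_) hb
    have : (⟨Sg.loc, l⟩ : AnyVal Sg) = ⟨Sg.loc, c⟩ := h.trans hcy.symm
    have : l = c := by simpa using this
    exact hd c hc (this ▸ hl)
  · exact Or.inl fun l hl b hb =>
      collapse_inj _ _ (hF₁ l hl) (fun h => hc ⟨l, hl, h⟩) hb

/-- A splitting that is correct in a generic store is correct in all stores.  The generic store is
first mapped by a permutation of the values to a store that agrees with `st` on the allocated
variables and is otherwise generic.  The values of the other variables are then replaced one at a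
time by their values in `st`. -/
theorem SumValid.good_of_generic (hcst : ∀ s, Finite (Sg.Cst s)) (hR : Standing R)
    {φ₁ φ₂ ψ₁ ψ₂ : Spatial Sg} {ξ : Pure Sg} {V : Multiset (LVar Sg)}
    (hv : SumValid R φ₁ φ₂ ψ₁ ψ₂ ξ V) (heq : EqFree ξ) {gen : Store Sg} (hgen : IsGeneric gen)
    (hgood : Good R φ₁ φ₂ ψ₁ ψ₂ V gen) {st : Store Sg} (ha : Adm (φ₁ + φ₂) ξ V st) :
    Good R φ₁ φ₂ ψ₁ ψ₂ V st := by
  let S : Sequent Sg := ⟨⟨φ₁ + φ₂, ξ⟩, V, ⟨ψ₁ + ψ₂, ∅⟩⟩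
  have hadd : ∀ φ φ' : Spatial Sg, spVars φ ⊆ spVars (φ + φ') ∧ spVars φ' ⊆ spVars (φ + φ') :=
    fun φ φ' => ⟨fun v ⟨a, ha, hv⟩ => ⟨a, Multiset.mem_add.2 (Or.inl ha), hv⟩,
      fun v ⟨a, ha, hv⟩ => ⟨a, Multiset.mem_add.2 (Or.inr ha), hv⟩⟩
  have h0 : spVars (φ₁ + φ₂) ⊆ S.vars := fun v hv => spVars_lhs_subset (S := S) hv
  have h0' : spVars (ψ₁ + ψ₂) ⊆ S.vars := fun v hv => spVars_rhs_subset (S := S) hv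
  have h1 := (hadd φ₁ φ₂).1.trans h0
  have h2 := (hadd φ₁ φ₂).2.trans h0
  have h3 := (hadd ψ₁ ψ₂).1.trans h0'
  have h4 := (hadd ψ₁ ψ₂).2.trans h0'
  have hξ : puVars ξ ⊆ S.vars := fun v hv => Or.inl (Or.inl (Or.inr hv))
  have hV : ∀ x ∈ V, (⟨Sg.loc, x⟩ : AnyVar Sg) ∈ S.vars := fun x hx => Or.inr ⟨x, hx, rfl⟩
  have hfin : S.vars.Finite := S.vars_finite
  have hfinS := S.sortVars_finite
  generalize S.vars = X at h0 h1 h2 h3 h4 hξ hV hfin hfinS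
  obtain ⟨g, hg, hgav⟩ := exists_generic_avoiding hcst
    (fun s => st s '' {y : Sg.Var s | (⟨s, y⟩ : AnyVar Sg) ∈ X}) fun s => (hfinS s).image _
  have hgX : ∀ s (x y : Sg.Var s), (⟨s, y⟩ : AnyVar Sg) ∈ X → g s x ≠ st s y :=
    fun s x y hy h => hgav s x ⟨y, hy, h.symm⟩
  have hadm : ∀ Z, Adm (φ₁ + φ₂) ξ V (hybrid Z st g) := fun Z =>
    ha.reflect h0 hξ hV heq (hybrid_eval hg hgX)
  have hadm' : ∀ st₁ st₂ : Store Sg, Agree X st₁ st₂ → Adm (φ₁ + φ₂) ξ V st₂ →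
      Adm (φ₁ + φ₂) ξ V st₁ := by
    intro st₁ st₂ hag ha
    have key : ∀ s (a : Term Sg s), (∀ x, a = .var x → (⟨s, x⟩ : AnyVar Sg) ∈ X) →
        st₁.eval a = st₂.eval a := by
      rintro s (x | c) h
      · exact hag s x (h x rfl)
      · rfl
    exact ha.reflect h0 hξ hV heq fun s a b hax hbx hab => by
      rw [← key s a hax, ← key s b hbx, hab]
  -- the variables on which the values of `st` are taken in the first store
  let Z₀ : Set (AnyVar Sg) := {v | ∃ x ∈ alloc (φ₁ + φ₂), v = ⟨Sg.loc, x⟩}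
  have hmain : ∀ Y : Finset (AnyVar Sg), Good R φ₁ φ₂ ψ₁ ψ₂ V (hybrid (Z₀ ∪ Y) st g) := by
    intro Y
    induction Y using Finset.induction with
    | empty =>
      rw [Finset.coe_empty, Set.union_empty]
      -- the hybrid store is injective on `X`, hence it is the image of `gen` by a permutation
      have hinj : ∀ s (x y : Sg.Var s), (⟨s, x⟩ : AnyVar Sg) ∈ X → (⟨s, y⟩ : AnyVar Sg) ∈ X →
          hybrid Z₀ st g s x = hybrid Z₀ st g s y → x = y := by
        intro s x y hx hy h
        unfold hybrid at h
        split_ifs at h with hx' hy' hy'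
        · obtain ⟨x', hx', hxx⟩ := hx'
          obtain ⟨y', hy', hyy⟩ := hy'
          cases hxx
          cases hyy
          have hnd := ha.2
          rw [Multiset.map_add, Multiset.nodup_add] at hnd
          exact Multiset.inj_on_of_nodup_map hnd.1 _ hx' _ hy' h
        · exact (hgX s y x hx h.symm).elim
        · exact (hgX s x y hy h).elim
        · exact hg.inj s h
      have hne : ∀ s (x : Sg.Var s) c, hybrid Z₀ st g s x ≠ Sg.cval s c := by
        intro s x c h
        unfold hybrid at h
        split_ifs at h with hx'
        · obtain ⟨x', hx', hxx⟩ := hx'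
          cases hxx
          exact Sg.cst_loc_isEmpty.false c
        · exact hg.ne_cst s x c h
      have : ∀ s, ∃ π : Equiv.Perm (Sg.Univ s),
          ∀ i : {x : Sg.Var s // (⟨s, x⟩ : AnyVar Sg) ∈ X} ⊕ Sg.Cst s,
          π (Sum.elim (fun x => gen s x.1) (Sg.cval s) i) =
            Sum.elim (fun x => hybrid Z₀ st g s x.1) (Sg.cval s) i := by
        intro s
        have := hcst s
        have : Finite {x : Sg.Var s // (⟨s, x⟩ : AnyVar Sg) ∈ X} := hfinS s
        refine exists_perm ?_ ?_
        · exact Function.Injective.sumElim (fun x y h => Subtype.ext (hgen.inj s h))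
            (Sg.cval_injective s) fun x c => hgen.ne_cst s x.1 c
        · exact Function.Injective.sumElim
            (fun x y h => Subtype.ext (hinj s x.1 y.1 x.2 y.2 h))
            (Sg.cval_injective s) fun x c => hne s x.1 c
      choose π hπ using this
      have hag : Agree X (VMap.app (fun s => π s) gen) (hybrid Z₀ st g) :=
        fun s x hx => hπ s (Sum.inl ⟨x, hx⟩)
      have hadmgen : Adm (φ₁ + φ₂) ξ V gen := by
        refine ha.reflect h0 hξ hV heq fun s a b _ _ hab => ?_
        rw [hgen.eval_injective s hab]
      obtain ⟨k₁, k₂, m₁, m₂, hd, hV₁, hV₂, _⟩ := hadmgen.exists_models hR Set.finite_empty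
        fun _ _ => Set.notMem_empty _
      exact Good.congr hag h1 h2 h3 h4 hV (hv.transfer hR hgood (fun s c => hπ s (Sum.inr c))
        (hadm' _ _ hag (hadm _)) m₁ m₂ hd hV₁ hV₂
        (Or.inl fun l _ b hb => (π Sg.loc).injective hb))
    | insert y Y _ ih =>
      rw [Finset.coe_insert, Set.union_insert]
      by_cases hy : y ∈ Z₀ ∪ (Y : Set (AnyVar Sg))
      · rwa [Set.insert_eq_of_mem hy]
      · exact hv.good_insert hR h1 h2 h3 h4 hV hg hgX hadm hadm'
          (fun x hx => Or.inl ⟨x, hx, rfl⟩) hy ih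
  refine Good.congr (X := X) (fun s x hx => ?_) h1 h2 h3 h4 hV (hmain hfin.toFinset)
  exact if_pos (Or.inr (by simpa using hx))

theorem HSub.of_mem {k h h' : Heap Sg} (hk : HSub k h) (hh : HSub h' h)
    (hmem : ∀ l ∈ k, l ∈ h') : HSub k h' := by
  intro l vs hl
  obtain ⟨vs', hvs'⟩ := Finmap.mem_iff.1 (hmem l (Finmap.mem_of_lookup_eq_some hl))
  have := hh _ _ hvs'
  rw [hk _ _ hl] at this
  rw [hvs', this]

/-- In a generic model, the part of the heap that satisfies an atom of the left-hand side lies on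
one side of any splitting of the heap: its locations are reachable from its root, and the only
ones that are values of variables are roots. -/
theorem part_subset (hdet : LocDeterministic R) {gen : Store Sg}
    {S : Sequent Sg} {h h' k : Heap Sg} {ψ : Spatial Sg} (hψ : ψ ≤ S.rhs.sp)
    (m : VM R h (spEval gen S.lhs.sp))
    (hgm : ∀ x : LVar Sg, (⟨Sg.loc, x⟩ : AnyVar Sg) ∈ S.vars → gen _ x ∈ h → x ∈ alloc S.lhs.sp)
    (hh' : HSub h' h) (n : VM R h' (spEval gen ψ)) {a : Atom Sg} (ha : a ∈ S.lhs.sp)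
    (hk : HSub k h) (mk : VM R k {a.eval gen}) (hroot : gen _ a.root ∈ h') : HSub k h' := by
  refine hk.of_mem hh' (mk.mem_of_closed hdet {l | l ∈ h'} ?_ ?_)
  · intro b hb
    rw [Multiset.mem_singleton.1 hb, a.eval_root]
    exact hroot
  · intro l hl vs hvs l' hl' hmem
    have hvs' : h'.lookup l = some vs := by
      obtain ⟨ws, hws⟩ := Finmap.mem_iff.1 (show l ∈ h' from hl)
      have := hh' _ _ hws
      rw [hk _ _ hvs] at this
      rw [hws, this]
    rcases n.contains_mem_or hdet ⟨l, vs, hvs', hmem⟩ with h'' | ⟨b, hb, y, hy, rfl⟩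
    · exact h''
    · obtain ⟨c, hc, rfl⟩ := Multiset.mem_map.1 (hgm y
        (spVars_rhs_subset ⟨b, Multiset.mem_of_le hψ hb, hy⟩) (hk.mem hl'))
      by_cases hac : a.eval gen = c.eval gen
      · have := congrArg VAtom.root hac
        rw [Atom.eval_root, Atom.eval_root] at this
        rwa [Set.mem_ofPred_eq, ← this]
      · obtain ⟨k', hk', mk'⟩ := m.exists_part (Multiset.mem_map_of_mem (Atom.eval gen) hc)
        refine (m.parts_disjoint hdet (Multiset.mem_map_of_mem _ ha)
          (Multiset.mem_map_of_mem _ hc) hac hk mk hk' mk' _ hl' ?_).elim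
        rw [← c.eval_root gen]
        exact mk'.root_mem hdet _ (Multiset.mem_singleton_self _)

/-- A model of a valid sequent in a generic store splits the left-hand side. -/
theorem exists_generic_split (hR : Standing R) {gen : Store Sg} (hgen : IsGeneric gen)
    {φ ψ₁ ψ₂ : Spatial Sg} {ξ : Pure Sg} {V : Multiset (LVar Sg)}
    (hv : Sequent.Valid R ⟨⟨φ, ξ⟩, V, ⟨ψ₁ + ψ₂, ∅⟩⟩)
    (hax : ¬ Sequent.IsAxiom (⟨⟨φ, ξ⟩, V, ⟨ψ₁ + ψ₂, ∅⟩⟩ : Sequent Sg)) (heq : EqFree ξ) :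
    ∃ φ₁ φ₂, φ = φ₁ + φ₂ ∧ Good R φ₁ φ₂ ψ₁ ψ₂ V gen ∧ (ψ₁ ≠ 0 → φ₁ ≠ 0) ∧
      (ψ₂ ≠ 0 → φ₂ ≠ 0) := by
  obtain ⟨w⟩ := univ_nonempty (Sg := Sg) Sg.loc
  obtain ⟨h, m, hgm, hV, _⟩ := hgen.exists_model hR hax heq w
  have hadm := hgen.adm hax heq
  have n := (valid_iff.1 hv gen h m hadm.1 hV hadm.nodup_V).1
  simp only [spEval_add] at n
  obtain ⟨h₁, h₂, hd, rfl, n₁, n₂⟩ := n.add_inv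
  have hs₁ := hsub_left h₁ h₂
  have hs₂ := hsub_right hd
  -- each atom of the left-hand side is put on the side where its root is allocated
  have key : ∀ φ' : Spatial Sg, (∀ a ∈ φ', a ∈ φ) → ∀ h', VM R h' (spEval gen φ') →
      HSub h' (h₁ ∪ h₂) → ∃ φ₁ φ₂ k₁ k₂, φ' = φ₁ + φ₂ ∧ VM R k₁ (spEval gen φ₁) ∧
        VM R k₂ (spEval gen φ₂) ∧ h' = k₁ ∪ k₂ ∧ HSub k₁ h₁ ∧ HSub k₂ h₂ := by
    intro φ'
    induction φ' using Multiset.induction with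
    | empty =>
      intro _ h' m' _
      refine ⟨0, 0, ∅, ∅, rfl, .emp, .emp, ?_, fun l vs h => by simp at h,
        fun l vs h => by simp at h⟩
      rw [m'.zero_inv, Finmap.union_empty]
    | cons a φ' ih =>
      intro hmem h' m' hsub
      rw [spEval_cons] at m'
      obtain ⟨k, h'', hd', rfl, mk, m''⟩ := m'.cons_inv
      obtain ⟨φ₁, φ₂, k₁, k₂, rfl, mk₁, mk₂, rfl, hk₁, hk₂⟩ := ih
        (fun b hb => hmem b (Multiset.mem_cons_of_mem hb)) h'' m'' ((hsub_right hd').trans hsub)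
      have hk := (hsub_left k (k₁ ∪ k₂)).trans hsub
      have ha := hmem a (Multiset.mem_cons_self _ _)
      rw [Finmap.disjoint_union_right] at hd'
      have hroot : gen _ a.root ∈ k := by
        rw [← a.eval_root gen]
        exact mk.root_mem hR.det _ (Multiset.mem_singleton_self _)
      have hdu : ∀ {k₁' k₂' : Heap Sg}, HSub k₁' h₁ → HSub k₂' h₂ → k₁'.Disjoint k₂' :=
        fun h₁' h₂' l hl hl' => hd l (h₁'.mem hl) (h₂'.mem hl')
      rcases Finmap.mem_union.1 (hk.mem hroot) with hr | hr
      · have hk' := part_subset (S := ⟨⟨φ, ξ⟩, V, ⟨ψ₁ + ψ₂, ∅⟩⟩) hR.det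
          (Multiset.le_add_right ψ₁ ψ₂) m hgm hs₁ n₁ ha hk mk hr
        refine ⟨a ::ₘ φ₁, φ₂, k ∪ k₁, k₂, (Multiset.cons_add _ _ _).symm, ?_, mk₂,
          Finmap.union_assoc.symm, ?_, hk₂⟩
        · rw [spEval_cons]; exact mk.append mk₁ hd'.1
        · intro l vs hl
          exact ((lookup_union_some hd'.1).1 hl).elim (hk' l vs) (hk₁ l vs)
      · have hk' := part_subset (S := ⟨⟨φ, ξ⟩, V, ⟨ψ₁ + ψ₂, ∅⟩⟩) hR.det
          (Multiset.le_add_left ψ₂ ψ₁) m hgm hs₂ n₂ ha hk mk hr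
        refine ⟨φ₁, a ::ₘ φ₂, k₁, k ∪ k₂, (Multiset.add_cons _ _ _).symm, mk₁, ?_,
          union_left_comm_of_disjoint hd'.1, hk₁, ?_⟩
        · rw [spEval_cons]; exact mk.append mk₂ hd'.2
        · intro l vs hl
          exact ((lookup_union_some hd'.2).1 hl).elim (hk' l vs) (hk₂ l vs)
  obtain ⟨φ₁, φ₂, k₁, k₂, rfl, mk₁, mk₂, heqh, hk₁, hk₂⟩ := key φ (fun _ h => h) _ m HSub.rfl
  have hd' : k₁.Disjoint k₂ := fun l hl hl' => hd l (hk₁.mem hl) (hk₂.mem hl')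
  have e₁ : k₁ = h₁ := heap_ext hk₁ fun l vs hl => by
    have h := hs₁ l vs hl
    rw [heqh] at h
    exact ((lookup_union_some hd').1 h).resolve_right fun h' =>
      hd l (Finmap.mem_of_lookup_eq_some hl) (hk₂.mem (Finmap.mem_of_lookup_eq_some h'))
  have e₂ : k₂ = h₂ := heap_ext hk₂ fun l vs hl => by
    have h := hs₂ l vs hl
    rw [heqh] at h
    exact ((lookup_union_some hd').1 h).resolve_left fun h' =>
      hd l (hk₁.mem (Finmap.mem_of_lookup_eq_some h')) (Finmap.mem_of_lookup_eq_some hl)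
  subst e₁ e₂
  have hne : ∀ {φ ψ : Spatial Sg} {k : Heap Sg}, VM R k (spEval gen φ) → VM R k (spEval gen ψ) →
      ψ ≠ 0 → φ ≠ 0 := by
    rintro φ ψ k mk nk hψ rfl
    obtain ⟨a, ha⟩ := Multiset.exists_mem_of_ne_zero hψ
    have := nk.alloc_mem hR.det (Multiset.mem_map_of_mem Atom.root ha)
    rw [mk.zero_inv] at this
    exact Finmap.notMem_empty this
  refine ⟨φ₁, φ₂, rfl, SumValid.good_of_right hR hv hadm mk₂ (fun x hx h => ?_) (fun x hx h => ?_)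
    n₂, hne mk₁ n₁, hne mk₂ n₂⟩
  · exact hV x hx (Finmap.mem_union.2 (Or.inr h))
  · exact hd _ (mk₁.alloc_mem hR.det hx) h

/-- If the splittings fit together in all stores, then the first premise of the rule `S` is valid:
its models are extended by models of `φ₂`. -/
theorem valid_of_good (hR : Standing R) {φ₁ φ₂ ψ₁ ψ₂ : Spatial Sg} {ξ : Pure Sg}
    {V : Multiset (LVar Sg)} (h : ∀ st, Adm (φ₁ + φ₂) ξ V st → Good R φ₁ φ₂ ψ₁ ψ₂ V st) :
    Sequent.Valid R ⟨⟨φ₁, ξ⟩, V + alloc φ₂, ⟨ψ₁, ∅⟩⟩ := by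
  rw [valid_iff]
  intro st h₁ m₁ hp hV hnd
  refine ⟨?_, pureHolds_empty st⟩
  have ha : ((alloc φ₁ + (V + alloc φ₂)).map (st Sg.loc)).Nodup :=
    (adm_of_model hR.det m₁ hp hV hnd).2
  have hadm : Adm (φ₁ + φ₂) ξ V st := by
    refine ⟨hp, ?_⟩
    rwa [alloc_add, show alloc φ₁ + alloc φ₂ + V = alloc φ₁ + (V + alloc φ₂) by abel]
  obtain ⟨w⟩ := univ_nonempty (Sg := Sg) Sg.loc
  obtain ⟨h₂, m₂, hav, hV₂, _⟩ := hadm.right.exists_model hR (heap_dom_finite h₁)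
    (fun x hx => hV x (Multiset.mem_add.2 (Or.inr hx))) w
  exact (h st hadm h₁ h₂ m₁ m₂ (fun l hl hl' => hav l hl' hl)
    (fun x hx => hV x (Multiset.mem_add.2 (Or.inl hx))) hV₂).1

/-- The left-hand side of a valid sequent is split along any splitting of the right-hand side. -/
theorem exists_valid_split (hcst : ∀ s, Finite (Sg.Cst s)) (hR : Standing R)
    {φ ψ₁ ψ₂ : Spatial Sg} {ξ : Pure Sg} {V : Multiset (LVar Sg)}
    (hv : Sequent.Valid R ⟨⟨φ, ξ⟩, V, ⟨ψ₁ + ψ₂, ∅⟩⟩)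
    (hax : ¬ Sequent.IsAxiom (⟨⟨φ, ξ⟩, V, ⟨ψ₁ + ψ₂, ∅⟩⟩ : Sequent Sg)) (heq : EqFree ξ)
    (hψ₁ : ψ₁ ≠ 0) (hψ₂ : ψ₂ ≠ 0) :
    ∃ φ₁ φ₂, φ = φ₁ + φ₂ ∧ φ₁ ≠ 0 ∧ φ₂ ≠ 0 ∧
      Sequent.Valid R ⟨⟨φ₁, ξ⟩, V + alloc φ₂, ⟨ψ₁, ∅⟩⟩ ∧
      Sequent.Valid R ⟨⟨φ₂, ξ⟩, V + alloc φ₁, ⟨ψ₂, ∅⟩⟩ := by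
  obtain ⟨gen, hgen⟩ := exists_generic hcst
  obtain ⟨φ₁, φ₂, rfl, hgood, h₁, h₂⟩ := exists_generic_split hR hgen hv hax heq
  have hv₁ := valid_of_good hR fun st ha =>
    SumValid.good_of_generic hcst hR hv heq hgen hgood (st := st) ha
  exact ⟨φ₁, φ₂, rfl, h₁ hψ₁, h₂ hψ₂, hv₁, valid_ruleS hR hv hv₁⟩

/-! ### Existence of a possible rule application -/

/-- For a valid conclusion, the conditions about anti-axioms follow from the validity of the
premises. -/
theorem App.possible_of_valid (hcst : ∀ s, Finite (Sg.Cst s)) (hR : Standing R)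
    {sel : Selection Sg} {a : App Sg} (hs : a.Side R) (hax : ¬ a.concl.IsAxiom)
    (hv : a.concl.Valid R) (hp : ∀ P ∈ a.prems, P.Valid R) (hst : a.Strategy R sel) :
    a.Possible R sel :=
  ⟨hs, hax, fun h => h.not_valid hcst hR hv, fun P hP h => h.not_valid hcst hR (hp P hP), hst⟩

/-- An equation between two constants would identify them or be trivial, hence some side of every
equation is a variable. -/
theorem exists_possible_ruleR (hcst : ∀ s, Finite (Sg.Cst s)) (hR : Standing R)
    (sel : Selection Sg) {φ : Spatial Sg} {ξ : Pure Sg} {V : Multiset (LVar Sg)} {γ : SHeap Sg}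
    (hv : Sequent.Valid R ⟨⟨φ, ξ⟩, V, γ⟩) (hax : ¬ Sequent.IsAxiom (⟨⟨φ, ξ⟩, V, γ⟩ : Sequent Sg))
    (hsep : ConstantsSeparated ξ) (heq : ¬ EqFree ξ) :
    ∃ a : App Sg, a.concl = ⟨⟨φ, ξ⟩, V, γ⟩ ∧ a.Possible R sel := by
  have : ∃ s, ∃ (x : Sg.Var s) (t : Term Sg s), PAtom.eq s s(.var x, t) ∈ ξ := by
    simp only [EqFree, not_forall, not_not] at heq
    obtain ⟨s, z, hz⟩ := heq
    induction z using Sym2.ind with | _ t u =>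
    cases t with
    | var x => exact ⟨s, x, u, hz⟩
    | cst c =>
      cases u with
      | var y => exact ⟨s, y, .cst c, by rwa [Sym2.eq_swap]⟩
      | cst d =>
        obtain ⟨h1, h2⟩ := hsep s (.cst c) d (.rel _ _ hz)
        exact (h1 (h2 c rfl ▸ hz)).elim
  obtain ⟨s, x, t, hmem⟩ := this
  have hc : (App.ruleR φ (ξ.erase (.eq s s(.var x, t))) V γ s x t).concl = ⟨⟨φ, ξ⟩, V, γ⟩ := by
    rw [App.concl, Finset.insert_erase hmem]
  exact ⟨_, hc, App.possible_of_valid hcst hR (Finset.notMem_erase _ _) (hc ▸ hax) (hc ▸ hv)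
    (valid_ruleR (hc ▸ hv)) trivial⟩

/-- The only disequation between distinct terms that becomes trivial when `x` is replaced by `u` is
`x ≉ u`. -/
theorem ne_eq_of_subst_single_eq {s : Sg.Srt} {x : Sg.Var s} {u : Term Sg s} {s' : Sg.Srt}
    {a b : Term Sg s'} (h : a.subst (single x u) = b.subst (single x u)) (hne : a ≠ b) :
    PAtom.ne s' s(a, b) = .ne s s(.var x, u) := by
  by_cases hs : s' = s
  · subst hs
    rw [term_subst_single, term_subst_single] at h
    split_ifs at h with ha hb hb
    · exact (hne (ha.trans hb.symm)).elim
    · rw [ha, h]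
    · rw [hb, h, Sym2.eq_swap]
    · exact (hne h).elim
  · rw [term_subst_single_of_ne hs, term_subst_single_of_ne hs] at h
    exact (hne h).elim

/-- In a valid sequent, every conjunct of the right-hand side is entailed: otherwise, a generic
store, or the store obtained from it by identifying the two sides of a disequation, yields a
counter-model. -/
theorem entails_of_valid (hcst : ∀ s, Finite (Sg.Cst s)) (hR : Standing R)
    {φ ψ : Spatial Sg} {ξ ζ : Pure Sg} {V : Multiset (LVar Sg)}
    (hv : Sequent.Valid R ⟨⟨φ, ξ⟩, V, ⟨ψ, ζ⟩⟩)
    (hax : ¬ Sequent.IsAxiom (⟨⟨φ, ξ⟩, V, ⟨ψ, ζ⟩⟩ : Sequent Sg)) (heq : EqFree ξ) :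
    Entails ⟨φ, ξ⟩ V ζ := by
  obtain ⟨gen, hg⟩ := exists_generic hcst
  obtain ⟨w⟩ := univ_nonempty (Sg := Sg) Sg.loc
  have hadm : Adm φ ξ V gen := hg.adm hax heq
  have hholds : ∀ st : Store Sg, Adm φ ξ V st → PureHolds st ζ := fun st ha => by
    obtain ⟨h, m, _, hV, _⟩ := ha.exists_model hR Set.finite_empty (fun _ _ => id) w
    exact (valid_iff.1 hv st h m ha.1 hV ha.nodup_V).2
  intro e he
  cases e with
  | eq s z =>
    induction z using Sym2.ind with | _ t u =>
    have := hg.eval_injective s (holds_eq.1 (hholds gen hadm _ he))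
    exact Or.inr (Or.inl ⟨s, t, by rw [this]⟩)
  | ne s z =>
    -- it suffices to consider a disequation whose first term is a variable
    have key : ∀ (x : Sg.Var s) (u : Term Sg s), z = s(.var x, u) →
        PAtom.ne s z ∈ ξ ∨ ∃ x y : LVar Sg, PAtom.ne s z = .ne Sg.loc s(.var x, .var y) ∧
          {x, y} ≤ alloc φ + V := by
      rintro x u rfl
      by_contra hcon
      rw [not_or] at hcon
      have hev : ∀ s' (a b : Term Sg s'), (gen.comp (single x u)).eval a =
          (gen.comp (single x u)).eval b → a ≠ b → PAtom.ne s' s(a, b) = .ne s s(.var x, u) := by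
        intro s' a b h hne
        rw [← eval_subst, ← eval_subst] at h
        exact ne_eq_of_subst_single_eq (hg.eval_injective s' h) hne
      have ha : Adm φ ξ V (gen.comp (single x u)) := by
        constructor
        · intro e' he'
          cases e' with
          | eq s' z' => exact (heq s' z' he').elim
          | ne s' z' =>
            induction z' using Sym2.ind with | _ a b =>
            refine holds_ne.2 fun h => hcon.1 ?_
            rwa [← hev s' a b h fun hab => (not_isAxiom hax).2.1 s' b (hab ▸ he')]
        · refine Multiset.Nodup.map_on (fun y hy y' hy' h => ?_) (not_isAxiom hax).1
          by_contra hne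
          refine hcon.2 ⟨y, y', (hev _ (.var y) (.var y') h fun h' => hne ?_).symm, ?_⟩
          · cases h'; rfl
          · refine (Multiset.le_iff_subset (by simpa using hne)).2 fun z hz => ?_
            simp only [Multiset.insert_eq_cons, Multiset.mem_cons, Multiset.mem_singleton] at hz
            rcases hz with rfl | rfl
            · exact hy
            · exact hy'
      have hne := holds_ne.1 (hholds gen hadm _ he)
      refine holds_ne.1 (hholds _ ha _ he) ?_
      rw [← eval_subst, ← eval_subst, term_subst_single, term_subst_single, if_pos rfl]
      split_ifs <;> rfl
    induction z using Sym2.ind with | _ t u =>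
    cases t with
    | var x =>
      rcases key x u rfl with h | h
      · exact Or.inl h
      · exact Or.inr (Or.inr (Or.inr h))
    | cst c =>
      cases u with
      | var y =>
        rcases key y (.cst c) Sym2.eq_swap with h | h
        · exact Or.inl h
        · exact Or.inr (Or.inr (Or.inr h))
      | cst d =>
        refine Or.inr (Or.inr (Or.inl ⟨s, c, d, ?_, rfl⟩))
        rintro rfl
        exact holds_ne.1 (hholds gen hadm _ he) rfl

/-- All the conjuncts of the right-hand side are eliminated at once. -/
theorem exists_possible_ruleE (hcst : ∀ s, Finite (Sg.Cst s)) (hR : Standing R)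
    (sel : Selection Sg) {φ ψ : Spatial Sg} {ξ ζ : Pure Sg} {V : Multiset (LVar Sg)}
    (hv : Sequent.Valid R ⟨⟨φ, ξ⟩, V, ⟨ψ, ζ⟩⟩)
    (hax : ¬ Sequent.IsAxiom (⟨⟨φ, ξ⟩, V, ⟨ψ, ζ⟩⟩ : Sequent Sg)) (heq : EqFree ξ) (hζ : ζ ≠ ∅) :
    ∃ a : App Sg, a.concl = ⟨⟨φ, ξ⟩, V, ⟨ψ, ζ⟩⟩ ∧ a.Possible R sel := by
  have hc : (App.ruleE ⟨φ, ξ⟩ V ψ ∅ ζ).concl = ⟨⟨φ, ξ⟩, V, ⟨ψ, ζ⟩⟩ := by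
    rw [App.concl, Finset.empty_union]
  exact ⟨_, hc, App.possible_of_valid hcst hR
    ⟨hζ, Finset.disjoint_empty_left _, entails_of_valid hcst hR hv hax heq⟩ (hc ▸ hax) (hc ▸ hv)
    (valid_ruleE (hc ▸ hv)) trivial⟩

/-- The atom selected on the right-hand side is separated from the other ones. -/
theorem exists_possible_ruleS (hcst : ∀ s, Finite (Sg.Cst s)) (hR : Standing R)
    (sel : Selection Sg) {φ ψ : Spatial Sg} {ξ : Pure Sg} {V : Multiset (LVar Sg)}
    (hv : Sequent.Valid R ⟨⟨φ, ξ⟩, V, ⟨ψ, ∅⟩⟩)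
    (hax : ¬ Sequent.IsAxiom (⟨⟨φ, ξ⟩, V, ⟨ψ, ∅⟩⟩ : Sequent Sg)) (heq : EqFree ξ)
    (hψ : 1 < Multiset.card ψ) :
    ∃ a : App Sg, a.concl = ⟨⟨φ, ξ⟩, V, ⟨ψ, ∅⟩⟩ ∧ a.Possible R sel ∧ a.IsS ∧
      ∀ P ∈ a.prems, P.Valid R := by
  have hmem : sel.atom ψ.toFinset ∈ ψ := by
    refine Multiset.mem_toFinset.1 (sel.atom_mem _ ?_)
    obtain ⟨b, hb⟩ := Multiset.card_pos_iff_exists_mem.1 (show 0 < Multiset.card ψ by omega)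
    exact ⟨b, Multiset.mem_toFinset.2 hb⟩
  obtain ⟨β, hβ⟩ : ∃ β, sel.atom ψ.toFinset = β := ⟨_, rfl⟩
  rw [hβ] at hmem
  obtain ⟨ψ', rfl⟩ := Multiset.exists_cons_of_mem hmem
  rw [← Multiset.singleton_add] at hv hax hψ hβ ⊢
  have hψ' : ψ' ≠ 0 := by
    rintro rfl
    simp at hψ
  obtain ⟨φ₁, φ₂, rfl, h₁, h₂, hv₁, hv₂⟩ := exists_valid_split hcst hR hv hax heq (by simp) hψ'
  have hc : (App.ruleS φ₁ φ₂ ξ ξ V {β} ψ' ∅ ∅).concl = ⟨⟨φ₁ + φ₂, ξ⟩, V, ⟨{β} + ψ', ∅⟩⟩ := by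
    rw [App.concl, Finset.union_self, Finset.union_self]
  have hp : ∀ P ∈ (App.ruleS φ₁ φ₂ ξ ξ V {β} ψ' ∅ ∅).prems, P.Valid R := by
    simp only [App.prems, List.mem_cons, List.not_mem_nil, or_false, forall_eq_or_imp, forall_eq]
    exact ⟨hv₁, hv₂⟩
  exact ⟨_, hc, App.possible_of_valid hcst hR ⟨h₁, h₂⟩ (hc ▸ hax) (hc ▸ hv) hp
    ⟨rfl, rfl, rfl, by rw [hβ], fun _ => hv₁⟩, trivial, hp⟩

theorem exists_possible_ruleU (hcst : ∀ s, Finite (Sg.Cst s)) (hR : Standing R)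
    (sel : Selection Sg) {p : Sg.Pred} {x : LVar Sg} {ts} {φ : Spatial Sg} {β : Atom Sg}
    {ξ : Pure Sg} {V : Multiset (LVar Sg)}
    (hv : Sequent.Valid R ⟨⟨.pred p x ts ::ₘ φ, ξ⟩, V, ⟨{β}, ∅⟩⟩)
    (hax : ¬ Sequent.IsAxiom (⟨⟨.pred p x ts ::ₘ φ, ξ⟩, V, ⟨{β}, ∅⟩⟩ : Sequent Sg))
    (hβ : β.root = x) :
    ∃ a : App Sg, a.concl = ⟨⟨.pred p x ts ::ₘ φ, ξ⟩, V, ⟨{β}, ∅⟩⟩ ∧ a.Possible R sel := by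
  let S : Sequent Sg := ⟨⟨.pred p x ts ::ₘ φ, ξ⟩, V, ⟨{β}, ∅⟩⟩
  have : ∀ r : Rule Sg, ∃ l, r.head = p → RuleInst r S.vars (.pred p x ts) l := by
    intro r
    by_cases h : r.head = p
    · subst h
      obtain ⟨τ, f, _, _, _, _, _, hi⟩ := exists_ruleInst r S.vars_finite x ts
      exact ⟨_, fun _ => hi⟩
    · exact ⟨⟨0, ∅⟩, fun h' => (h h').elim⟩
  choose f hf using this
  let E := (R.filter fun r => r.head = p).toList.map fun r => (r, f r)
  have hfst : E.map Prod.fst = (R.filter fun r => r.head = p).toList := by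
    simp [E, Function.comp_def]
  have hs : (App.ruleU p x ts φ ξ V ⟨{β}, ∅⟩ E).Side R := by
    refine ⟨?_, fun r => ?_, fun q hq => ?_⟩
    · rw [hfst]; exact Finset.nodup_toList _
    · rw [hfst, Finset.mem_toList, Finset.mem_filter]
    · obtain ⟨r, hr, rfl⟩ := List.mem_map.1 hq
      rw [Finset.mem_toList, Finset.mem_filter] at hr
      exact hf r hr.2
  exact ⟨_, rfl, App.possible_of_valid hcst hR hs hax hv (valid_ruleU hs hv) ⟨rfl, β, rfl, hβ⟩⟩

/-- A points-to atom is entailed by no other formula with the same root than itself. -/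
theorem not_valid_pto (hcst : ∀ s, Finite (Sg.Cst s)) (hR : Standing R) {x : LVar Sg}
    {ys ys' : List (AnyTerm Sg)} {φ : Spatial Sg} {ξ : Pure Sg} {V : Multiset (LVar Sg)}
    (hax : ¬ Sequent.IsAxiom (⟨⟨.pto x ys ::ₘ φ, ξ⟩, V, ⟨{.pto x ys'}, ∅⟩⟩ : Sequent Sg))
    (heq : EqFree ξ) : ¬ Sequent.Valid R ⟨⟨.pto x ys ::ₘ φ, ξ⟩, V, ⟨{.pto x ys'}, ∅⟩⟩ := by
  intro hv
  obtain ⟨gen, hg⟩ := exists_generic hcst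
  obtain ⟨w⟩ := univ_nonempty (Sg := Sg) Sg.loc
  have ha : Adm (.pto x ys ::ₘ φ) ξ V gen := hg.adm hax heq
  obtain ⟨h, m, _, hV, _⟩ := ha.exists_model hR Set.finite_empty (fun _ _ => id) w
  have n := (valid_iff.1 hv gen h m ha.1 hV ha.nodup_V).1
  simp only [spEval_singleton, spEval_cons, Atom.eval] at n m
  obtain ⟨h', hx, rfl, m'⟩ := m.pto_cons_inv
  have hn := n.pto_inv
  apply hax
  left
  have hφ : φ = 0 := by
    refine Multiset.eq_zero_of_forall_notMem fun a haφ => ?_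
    have h1 := m'.alloc_mem hR.det (Multiset.mem_map_of_mem Atom.root haφ)
    have h2 : gen _ a.root ∈ (Finmap.singleton (gen _ x) (ys.map gen.evalAny) ∪ h' : Heap Sg) :=
      Finmap.mem_union.2 (Or.inr h1)
    rw [hn, Finmap.mem_singleton] at h2
    exact hx (h2 ▸ h1)
  subst hφ
  have hl := lookup_singleton_union (gen _ x) (ys.map gen.evalAny) h'
  rw [hn, Finmap.lookup_singleton_eq, Option.some.injEq] at hl
  rw [List.map_injective_iff.2 hg.evalAny_injective hl]
  exact ⟨rfl, Finset.empty_subset _⟩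

/-- In a generic model, the predicate atom on the right-hand side is unfolded by some rule, and the
values of the existential variables of this rule are the values of terms in the allocated tuple.
The disequations of the rule are entailed since the case analysis `C` has added the missing ones. -/
theorem exists_possible_ruleI (hcst : ∀ s, Finite (Sg.Cst s)) (hR : Standing R)
    (sel : Selection Sg) {p : Sg.Pred} {x : LVar Sg} {zs} {ys : List (AnyTerm Sg)}
    {φ : Spatial Sg} {ξ : Pure Sg} {V : Multiset (LVar Sg)}
    (hv : Sequent.Valid R ⟨⟨.pto x ys ::ₘ φ, ξ⟩, V, ⟨{.pred p x zs}, ∅⟩⟩)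
    (hax : ¬ Sequent.IsAxiom (⟨⟨.pto x ys ::ₘ φ, ξ⟩, V, ⟨{.pred p x zs}, ∅⟩⟩ : Sequent Sg))
    (heq : EqFree ξ)
    (hC : ∀ z ∈ alloc (.pto x ys ::ₘ φ), ∀ y : LVar Sg,
      (⟨Sg.loc, y⟩ : AnyVar Sg) ∈ (Atom.pred p x zs).vars → y ∉ alloc (.pto x ys ::ₘ φ) → y ∉ V →
      PAtom.ne Sg.loc s(.var z, .var y) ∈ ξ) :
    ∃ a : App Sg, a.concl = ⟨⟨.pto x ys ::ₘ φ, ξ⟩, V, ⟨{.pred p x zs}, ∅⟩⟩ ∧ a.Possible R sel := by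
  obtain ⟨gen, hg⟩ := exists_generic hcst
  obtain ⟨w⟩ := univ_nonempty (Sg := Sg) Sg.loc
  obtain ⟨h, m, hgm, hV, _⟩ := hg.exists_model hR hax heq w
  have hadm := hg.adm hax heq
  have n := (valid_iff.1 hv gen h m hadm.1 hV hadm.nodup_V).1
  simp only [spEval_singleton, spEval_cons, Atom.eval] at n m
  obtain ⟨h', hx, hh, _⟩ := m.pto_cons_inv
  obtain ⟨r, hr, v, hhead, hpure, n'⟩ := n.pred_inv
  obtain ⟨ysr, qs, hsh⟩ := hR.det.shape hr
  simp only [Rule.headVal, VAtom.pred.injEq] at hhead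
  obtain ⟨rfl, hvx, hvz⟩ := hhead
  replace hvz := fun i => congrFun (eq_of_heq hvz) i
  -- the record of the location of `x` in the generic model
  have hys : ysr.map v.evalAny = ys.map gen.evalAny := by
    have n'' := n'
    rw [spEval_body hsh] at n''
    obtain ⟨h'', _, hh'', _⟩ := n''.pto_cons_inv
    have h1 := lookup_singleton_union (v _ r.root) (ysr.map v.evalAny) h''
    rw [← hh'', hh, ← hvx, lookup_singleton_union, Option.some.injEq] at h1
    exact h1.symm
  obtain ⟨τ, f, hf, hτx, hτz, hτf, hfA, hi⟩ :=
    exists_ruleInst r (Atom.pred r.head x zs).vars_finite x zs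
  -- `σ` maps the copies of the existential variables to the terms of `ys` with the same value
  have hσ : ∀ s (y : Sg.Var s), ∃ t : Term Sg s,
      (∀ z, (⟨s, z⟩ : AnyVar Sg) ∉ r.formals → (⟨s, .var z⟩ : AnyTerm Sg) ∈ ysr → y = f s z →
        gen.eval t = v s z) ∧
      (t ≠ .var y → ∃ z, (⟨s, z⟩ : AnyVar Sg) ∉ r.formals ∧ (⟨s, .var z⟩ : AnyTerm Sg) ∈ ysr ∧
        y = f s z) := by
    intro s y
    by_cases hz : ∃ z, (⟨s, z⟩ : AnyVar Sg) ∉ r.formals ∧ (⟨s, .var z⟩ : AnyTerm Sg) ∈ ysr ∧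
        y = f s z
    · obtain ⟨z, hz1, hz2, rfl⟩ := hz
      have hmem := List.mem_map_of_mem (f := v.evalAny) hz2
      rw [hys] at hmem
      obtain ⟨⟨s', t⟩, _, ht⟩ := List.mem_map.1 hmem
      simp only [Store.evalAny, Sigma.mk.injEq] at ht
      obtain ⟨rfl, ht⟩ := ht
      refine ⟨t, fun z' _ _ hzz => ?_, fun _ => ⟨z, hz1, hz2, rfl⟩⟩
      rw [← hf _ hzz]
      exact eq_of_heq ht
    · exact ⟨.var y, fun z h1 h2 h3 => (hz ⟨z, h1, h2, h3⟩).elim, fun hne => (hne rfl).elim⟩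
  choose σ hσv hσd using hσ
  -- `σ` does not affect the arguments of the predicate atom
  have hσid : ∀ s (t : Term Sg s), (⟨s, t⟩ : AnyTerm Sg) ∈ (Atom.pred r.head x zs).terms →
      t.subst σ = t := by
    intro s t ht
    cases t with
    | cst c => rfl
    | var y =>
      by_contra hne
      obtain ⟨z, _, _, rfl⟩ := hσd s y hne
      exact hfA s z ht
  have hform : ∀ s (y : Sg.Var s), (⟨s, y⟩ : AnyVar Sg) ∈ r.formals →
      (⟨s, τ s y⟩ : AnyTerm Sg) ∈ (Atom.pred r.head x zs).terms ∧ gen.eval (τ s y) = v s y := by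
    intro s y hy
    rcases mem_formals.1 hy with h | ⟨i, h⟩ <;> cases h
    · rw [hτx]
      exact ⟨List.mem_cons_self, hvx⟩
    · rw [hτz]
      exact ⟨List.mem_cons_of_mem _ (List.mem_ofFn.2 ⟨i, rfl⟩), hvz i⟩
  have hval : ∀ s (y : Sg.Var s), ((⟨s, y⟩ : AnyVar Sg) ∈ r.formals ∨
      (⟨s, .var y⟩ : AnyTerm Sg) ∈ ysr) → gen.eval ((τ s y).subst σ) = v s y := by
    intro s y hy
    by_cases hy' : (⟨s, y⟩ : AnyVar Sg) ∈ r.formals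
    · obtain ⟨h1, h2⟩ := hform s y hy'
      rw [hσid _ _ h1, h2]
    · rw [hτf s y hy']
      exact hσv s (f s y) y hy' (hy.resolve_left hy') rfl
  have hus : (ysr.map (AnyTerm.subst τ)).map (AnyTerm.subst σ) = ys := by
    apply List.map_injective_iff.2 hg.evalAny_injective
    rw [← hys, List.map_map, List.map_map]
    refine List.map_congr_left fun t ht => ?_
    obtain ⟨s, y | c⟩ := t
    · change (⟨s, gen.eval ((τ s y).subst σ)⟩ : AnyVal Sg) = ⟨s, v s y⟩
      rw [hval s y (Or.inr ht)]
    · rfl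
  have hbody : r.body.subst τ =
      ⟨.pto x (ysr.map (AnyTerm.subst τ)) ::ₘ spSubst τ qs, puSubst τ r.body.pu⟩ := by
    have : τ.onLoc r.root = x := by simp only [Subst.onLoc, hτx, Term.toLVar]
    rw [SHeap.subst, hsh.sp_eq, spSubst, Multiset.map_cons, Atom.subst, this]
    rfl
  rw [hbody] at hi
  -- the images of the roots of the body are allocated on the left-hand side
  have halloc : ∀ z ∈ alloc qs, ((τ _ z).subst σ).toLVar ∈ alloc (.pto x ys ::ₘ φ) := by
    intro z hz
    obtain ⟨hzy, _⟩ := (hsh.alloc_iff z).1 hz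
    have hzt : lterm ((τ _ z).subst σ).toLVar ∈ ys := by
      rw [lterm, var_toLVar, ← hus, List.map_map]
      exact List.mem_map_of_mem (f := AnyTerm.subst σ ∘ AnyTerm.subst τ) hzy
    refine hgm _ (spVars_lhs_subset ⟨_, Multiset.mem_cons_self _ _, List.mem_cons_of_mem _ hzt⟩) ?_
    change gen.eval (.var ((τ _ z).subst σ).toLVar) ∈ h
    rw [var_toLVar, hval _ z (Or.inr hzy)]
    exact hsh.alloc_mem hR.det n' hz
  have hent : Entails ⟨.pto x ys ::ₘ φ, ξ⟩ V (puSubst σ (puSubst τ r.body.pu)) := by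
    intro e he
    obtain ⟨_, he', rfl⟩ := Finset.mem_image.1 he
    obtain ⟨e₀, he₀, rfl⟩ := Finset.mem_image.1 he'
    obtain ⟨a, b, rfl, _, hb, ha⟩ := hsh.pure e₀ he₀
    have hab := holds_ne.1 (hpure _ he₀)
    have hb' := halloc b hb
    have hva : gen.eval ((τ _ a).subst σ) = v _ a :=
      hval _ a (ha.imp id fun h => ((hsh.alloc_iff a).1 h).1)
    have hvb : gen.eval ((τ _ b).subst σ) = v _ b := hval _ b (Or.inr ((hsh.alloc_iff b).1 hb).1)
    have he : ((PAtom.ne Sg.loc s(.var a, .var b)).subst τ).subst σ =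
        .ne Sg.loc s(.var ((τ _ a).subst σ).toLVar, .var ((τ _ b).subst σ).toLVar) := by
      simp only [PAtom.subst, Sym2.map_mk, Term.subst, var_toLVar]
    rw [he]
    have hne : ((τ _ a).subst σ).toLVar ≠ ((τ _ b).subst σ).toLVar := by
      intro h
      apply hab
      change v _ a = v _ b
      rw [← hva, ← hvb, ← var_toLVar ((τ _ a).subst σ), h, var_toLVar]
    by_cases hmem : ((τ _ a).subst σ).toLVar ∈ alloc (.pto x ys ::ₘ φ) + V
    · refine Or.inr (Or.inr (Or.inr ⟨_, _, rfl, ?_⟩))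
      refine (Multiset.le_iff_subset (by simpa using hne)).2 fun z hz => ?_
      simp only [Multiset.insert_eq_cons, Multiset.mem_cons, Multiset.mem_singleton] at hz
      rcases hz with rfl | rfl
      · exact hmem
      · exact Multiset.mem_add.2 (Or.inl hb')
    · rw [Multiset.mem_add, not_or] at hmem
      left
      have ha' := ha.resolve_right fun h => hmem.1 (halloc a h)
      rw [Sym2.eq_swap]
      refine hC _ hb' _ ?_ hmem.1 hmem.2
      obtain ⟨h1, _⟩ := hform _ a ha'
      rwa [Atom.mem_vars_iff, var_toLVar, hσid _ _ h1]
  have hs : (App.ruleI x ys φ ξ V r.head zs 0 ∅ (ysr.map (AnyTerm.subst τ)) (spSubst τ qs)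
      (puSubst τ r.body.pu) σ).Side R := by
    refine ⟨⟨r, hr, hi⟩, fun s y hy => ?_, hus, hent⟩
    obtain ⟨z, hz1, hz2, rfl⟩ := hσd s y hy
    refine ⟨List.mem_map.2 ⟨_, hz2, ?_⟩, hfA s z⟩
    simp only [AnyTerm.subst, Term.subst, hτf s z hz1]
  have hc : (App.ruleI x ys φ ξ V r.head zs 0 ∅ (ysr.map (AnyTerm.subst τ)) (spSubst τ qs)
      (puSubst τ r.body.pu) σ).concl = ⟨⟨.pto x ys ::ₘ φ, ξ⟩, V, ⟨{.pred r.head x zs}, ∅⟩⟩ := rfl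
  exact ⟨_, hc, App.possible_of_valid hcst hR hs hax hv (valid_ruleI hR.det hs hv) ⟨rfl, rfl⟩⟩

/-- Some rule application is possible on every valid sequent that is not an axiom. -/
theorem exists_possible (hcst : ∀ s, Finite (Sg.Cst s)) (hR : Standing R) (sel : Selection Sg)
    {S : Sequent Sg} (hv : S.Valid R) (hsep : ConstantsSeparated S.lhs.pu) (hax : ¬ S.IsAxiom) :
    ∃ a : App Sg, a.concl = S ∧ a.Possible R sel := by
  obtain ⟨⟨φ, ξ⟩, V, ⟨ψ, ζ⟩⟩ := S
  by_cases heq : EqFree ξ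
  swap
  · exact exists_possible_ruleR hcst hR sel hv hax hsep heq
  by_cases hζ : ζ = ∅
  swap
  · exact exists_possible_ruleE hcst hR sel hv hax heq hζ
  subst hζ
  by_cases hψ : 1 < Multiset.card ψ
  · obtain ⟨a, hc, ha, _⟩ := exists_possible_ruleS hcst hR sel hv hax heq hψ
    exact ⟨a, hc, ha⟩
  have hanti := fun h => Sequent.IsAntiAxiom.not_valid hcst hR (S := ⟨⟨φ, ξ⟩, V, ⟨ψ, ∅⟩⟩)
    ⟨hax, heq, rfl, h⟩ hv
  have hψ0 : ψ ≠ 0 := by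
    rintro rfl
    refine hanti (Or.inr (Or.inl ⟨rfl, ?_⟩))
    rintro rfl
    exact hax (Or.inl ⟨rfl, Finset.empty_subset _⟩)
  have hcard : Multiset.card ψ = 1 := by
    have := Multiset.card_pos.2 hψ0
    omega
  obtain ⟨β, rfl⟩ := Multiset.card_eq_one.1 hcard
  have hroot : β.root ∈ alloc φ := by
    by_contra h
    exact hanti (Or.inl ⟨β.root, Multiset.mem_map_of_mem _ (Multiset.mem_singleton_self β), h⟩)
  obtain ⟨a, ha, har⟩ := Multiset.mem_map.1 hroot
  obtain ⟨φ, rfl⟩ := Multiset.exists_cons_of_mem ha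
  cases a with
  | pred p x ts => exact exists_possible_ruleU hcst hR sel hv hax har.symm
  | pto x ys =>
    cases β with
    | pto x' ys' =>
      obtain rfl : x = x' := har
      exact (not_valid_pto hcst hR hax heq hv).elim
    | pred p x' zs =>
      obtain rfl : x = x' := har
      by_cases hC : ∀ z ∈ alloc (.pto x ys ::ₘ φ), ∀ y : LVar Sg,
          (⟨Sg.loc, y⟩ : AnyVar Sg) ∈ (Atom.pred p x zs).vars → y ∉ alloc (.pto x ys ::ₘ φ) →
          y ∉ V → PAtom.ne Sg.loc s(.var z, .var y) ∈ ξ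
      · exact exists_possible_ruleI hcst hR sel hv hax heq hC
      · push Not at hC
        obtain ⟨z, hz, y, hy, hyφ, hyV, hne⟩ := hC
        have hc : (App.ruleC (.pto x ys ::ₘ φ) ξ V ⟨{.pred p x zs}, ∅⟩ z y).concl =
          ⟨⟨.pto x ys ::ₘ φ, ξ⟩, V, ⟨{.pred p x zs}, ∅⟩⟩ := rfl
        exact ⟨_, hc, App.possible_of_valid hcst hR trivial hax hv (valid_ruleC hv)
          ⟨rfl, ⟨_, rfl, trivial⟩, hz, Or.inl ⟨_, Multiset.mem_singleton_self _, hy⟩, hyφ, hyV,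
            hne⟩⟩

/-! ### Premises of possible rule applications -/

/-- The rules are invertible, except `S`, for which the strategy requires the validity of the first
premise if the conclusion is not narrow. -/
theorem App.prems_valid (hR : Standing R) {sel : Selection Sg} {a : App Sg}
    (ha : a.Possible R sel) (hv : a.concl.Valid R) (hS : ¬ (a.IsS ∧ a.concl.Narrow R)) :
    ∀ P ∈ a.prems, P.Valid R := by
  obtain ⟨hs, hax, _, _, hst⟩ := ha
  cases a with
  | ruleR => exact valid_ruleR hv
  | ruleE => exact valid_ruleE hv
  | ruleU => exact valid_ruleU hs hv
  | ruleI =>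
    obtain ⟨rfl, rfl⟩ := hst
    exact valid_ruleI hR.det hs hv
  | ruleW => exact valid_ruleW hR.det hs hax hv
  | ruleC => exact valid_ruleC hv
  | ruleV => exact valid_ruleV hs hax hv
  | ruleS φ₁ φ₂ ξ₁ ξ₂ V ψ₁ ψ₂ ζ₁ ζ₂ =>
    obtain ⟨rfl, rfl, rfl, _, hval⟩ := hst
    have hv₁ := hval fun hn => hS ⟨trivial, hn⟩
    simp only [App.concl, Finset.union_self] at hv
    simp only [App.prems, List.mem_cons, List.not_mem_nil, or_false, forall_eq_or_imp, forall_eq]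
    exact ⟨hv₁, valid_ruleS hR hv hv₁⟩

theorem App.prems_separated (hdet : LocDeterministic R) {a : App Sg} (hs : a.Side R)
    (h : ConstantsSeparated a.concl.lhs.pu) : ∀ P ∈ a.prems, ConstantsSeparated P.lhs.pu := by
  cases a with
  | ruleR =>
    simp only [App.prems, List.mem_singleton, forall_eq]
    exact h.ruleR hs
  | ruleE =>
    simp only [App.prems, List.mem_singleton, forall_eq]
    exact h
  | ruleU p x ts φ ξ V γ E =>
    simp only [App.prems, List.mem_map]
    rintro _ ⟨⟨r, l⟩, hq, rfl⟩
    have hr : r ∈ R := ((hs.2.1 r).1 (List.mem_map_of_mem hq)).1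
    obtain ⟨τ, hl, _⟩ := (hs.2.2 _ hq).inv
    refine h.mono fun s e he => (Finset.mem_union.1 he).resolve_left fun he => ?_
    dsimp only at hl he
    rw [hl] at he
    obtain ⟨e₀, he₀, hee⟩ := Finset.mem_image.1 he
    obtain ⟨y, z, rfl⟩ := hdet.2.2 r hr e₀ he₀
    cases hee
  | ruleI =>
    simp only [App.prems, List.mem_singleton, forall_eq]
    exact h
  | ruleW =>
    simp only [App.prems, List.mem_singleton, forall_eq]
    exact h.of_subset Finset.subset_union_left
  | ruleC =>
    simp only [App.prems, List.mem_cons, List.not_mem_nil, or_false, forall_eq_or_imp, forall_eq]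
    refine ⟨h.ruleC, h.mono fun s e he => ?_⟩
    exact (Finset.mem_insert.1 he).resolve_left fun h => by cases h
  | ruleV =>
    simp only [App.prems, List.mem_singleton, forall_eq]
    exact h
  | ruleS =>
    simp only [App.prems, List.mem_cons, List.not_mem_nil, or_false, forall_eq_or_imp, forall_eq]
    exact ⟨h.of_subset Finset.subset_union_left, h.of_subset Finset.subset_union_right⟩

/-- Every rule application has a premise: for unfolding, this is because predicate symbols are
productive. -/
theorem App.prems_ne_nil (hR : Standing R) {a : App Sg} (hs : a.Side R) : a.prems ≠ [] := by
  cases a with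
  | ruleU p x ts φ ξ V γ E =>
    obtain ⟨r, hr, hp⟩ : ∃ r ∈ R, r.head = p := by
      cases hR.prod p with
      | mk r hr _ => exact ⟨r, hr, rfl⟩
    have hE := (hs.2.1 r).2 ⟨hr, hp⟩
    rw [App.prems, Ne, List.map_eq_nil_iff]
    rintro rfl
    simp at hE
  | _ => simp [App.prems]

/-- If the rule `S` is possible on a narrow sequent, then the right-hand side has at least two
atoms, because the second premise is not an anti-axiom. -/
theorem card_of_possible_ruleS {sel : Selection Sg} {φ₁ φ₂ ψ₁ ψ₂ : Spatial Sg}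
    {ξ₁ ξ₂ ζ₁ ζ₂ : Pure Sg} {V : Multiset (LVar Sg)}
    (ha : (App.ruleS φ₁ φ₂ ξ₁ ξ₂ V ψ₁ ψ₂ ζ₁ ζ₂).Possible R sel)
    (heq : EqFree (ξ₁ ∪ ξ₂)) : 1 < Multiset.card (ψ₁ + ψ₂) := by
  obtain ⟨hs, hax, _, hanti, rfl, rfl, rfl, hψ₁, _⟩ := ha
  simp only [App.concl, Finset.union_self] at hax heq
  have hψ₂ : ψ₂ ≠ 0 := by
    rintro rfl
    refine hanti _ (List.mem_cons_of_mem _ List.mem_cons_self) ⟨?_, heq, rfl, Or.inr (Or.inl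
      ⟨rfl, hs.2⟩)⟩
    obtain ⟨hnd, hne, _⟩ := not_isAxiom hax
    have hnd' : (alloc φ₂ + (V + alloc φ₁)).Nodup := by
      rw [alloc_add] at hnd
      rwa [show alloc φ₂ + (V + alloc φ₁) = alloc φ₁ + alloc φ₂ + V by abel]
    rw [Multiset.nodup_add, Multiset.disjoint_left] at hnd'
    rintro (h | ⟨s, t, h⟩ | h | ⟨x, h, h'⟩ | h)
    · exact hs.2 h.1
    · exact hne s t h
    · exact h hnd'.1
    · exact hnd'.2.2 h h'
    · exact h hnd'.2.1
  rw [Multiset.card_add, hψ₁, Multiset.card_singleton]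
  have := Multiset.card_pos.2 hψ₂
  omega

/-- On every valid sequent that is not an axiom, there is an admissible rule application with valid
premises. -/
theorem exists_admissible (hcst : ∀ s, Finite (Sg.Cst s)) (hR : Standing R) (sel : Selection Sg)
    {S : Sequent Sg} (hv : S.Valid R) (hsep : ConstantsSeparated S.lhs.pu) (hax : ¬ S.IsAxiom) :
    ∃ a : App Sg, a.concl = S ∧ a.Admissible R sel ∧ ∀ P ∈ a.prems, P.Valid R := by
  -- a possible application of the highest priority
  obtain ⟨a, ⟨hc, ha⟩, hmax⟩ : ∃ a : App Sg, (a.concl = S ∧ a.Possible R sel) ∧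
      ∀ b : App Sg, b.concl = S ∧ b.Possible R sel → b.priority ≤ a.priority := by
    let Q : Set ℕ := {n | ∃ a : App Sg, (a.concl = S ∧ a.Possible R sel) ∧ a.priority = n}
    have hQ : Q.Nonempty := by
      obtain ⟨a, ha⟩ := exists_possible hcst hR sel hv hsep hax
      exact ⟨_, a, ha, rfl⟩
    have hb : BddAbove Q := by
      refine ⟨7, ?_⟩
      rintro _ ⟨a, _, rfl⟩
      cases a <;> simp [App.priority]
    obtain ⟨a, ha, haQ⟩ := Nat.sSup_mem hQ hb
    exact ⟨a, ha, fun b hb' => haQ ▸ le_csSup hb ⟨b, hb', rfl⟩⟩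
  by_cases hS : a.IsS ∧ S.Narrow R
  · obtain ⟨haS, hn⟩ := hS
    cases a with
    | ruleS φ₁ φ₂ ξ₁ ξ₂ V ψ₁ ψ₂ ζ₁ ζ₂ =>
      subst hc
      have hcard := card_of_possible_ruleS ha hn.1.1
      obtain ⟨_, _, _, _, rfl, rfl, rfl, _, _⟩ := ha
      simp only [App.concl, Finset.union_self] at hv hax hn hmax ⊢
      obtain ⟨b, hbc, hb, hbS, hbv⟩ := exists_possible_ruleS hcst hR sel hv hax hn.1.1 hcard
      refine ⟨b, hbc, ⟨hb, fun c hc' hc => ?_, Or.inl ⟨hbS, hbc ▸ hn⟩⟩, hbv⟩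
      cases b with
      | ruleS => exact hmax c ⟨hc'.trans hbc, hc⟩
      | _ => exact hbS.elim
    | _ => exact haS.elim
  · obtain ⟨hbc, hbp, hb⟩ := sel.app_mem
      {b | b.concl = S ∧ b.priority = a.priority ∧ b.Possible R sel} ⟨a, hc, rfl, ha⟩
    generalize hsel : sel.app {b | b.concl = S ∧ b.priority = a.priority ∧ b.Possible R sel} = b
      at hbc hbp hb
    refine ⟨b, hbc, ⟨hb, fun c hc' hc => hbp ▸ hmax c ⟨hc'.trans hbc, hc⟩, Or.inr ?_⟩,
      b.prems_valid hR hb (hbc ▸ hv) ?_⟩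
    · rw [hbc, hbp, hsel]
    · rintro ⟨hbS, hn⟩
      refine hS ⟨?_, hbc ▸ hn⟩
      cases b with
      | ruleS => cases a <;> simp_all [App.priority, App.IsS]
      | _ => exact hbS.elim

/-! ### Proof trees -/

/-- The labels of the tree obtained from the root `S` by repeatedly applying the rules given by
`next`. -/
noncomputable def treeLabel (next : Sequent Sg → Option (App Sg)) (S : Sequent Sg) :
    List ℕ → Option (Sequent Sg)
  | [] => some S
  | i :: π => ((treeLabel next S π).bind next).bind fun a => a.prems[i]?

/-- The tree is obtained by choosing an admissible rule application with valid premises for every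
valid sequent that is not an axiom. -/
theorem exists_proofTree (hcst : ∀ s, Finite (Sg.Cst s)) (hR : Standing R) (sel : Selection Sg)
    {S : Sequent Sg} (hv : S.Valid R) (hsep : ConstantsSeparated S.lhs.pu) :
    ∃ T : ProofTree R, T.label [] = some S ∧ T.Admissible sel ∧ T.FullyExpanded := by
  have : ∀ S : Sequent Sg, ∃ o : Option (App Sg), S.Valid R → ConstantsSeparated S.lhs.pu →
      (o = none → S.IsAxiom) ∧ ∀ a, o = some a → a.concl = S ∧ a.Admissible R sel ∧
        ∀ P ∈ a.prems, P.Valid R := by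
    intro S
    by_cases hax : S.IsAxiom
    · exact ⟨none, fun _ _ => ⟨fun _ => hax, nofun⟩⟩
    · by_cases h : S.Valid R ∧ ConstantsSeparated S.lhs.pu
      · obtain ⟨a, ha⟩ := exists_admissible hcst hR sel h.1 h.2 hax
        exact ⟨some a, fun _ _ => ⟨nofun, fun _ h => Option.some.inj h ▸ ha⟩⟩
      · exact ⟨none, fun h₁ h₂ => (h ⟨h₁, h₂⟩).elim⟩
  choose next hnext using this
  have hinv : ∀ π S', treeLabel next S π = some S' →
      S'.Valid R ∧ ConstantsSeparated S'.lhs.pu := by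
    intro π
    induction π with
    | nil =>
      intro S' h
      cases h
      exact ⟨hv, hsep⟩
    | cons i π ih =>
      intro S' h
      obtain ⟨a, ha, hi⟩ := Option.bind_eq_some_iff.1 h
      obtain ⟨S₀, hS₀, ha⟩ := Option.bind_eq_some_iff.1 ha
      obtain ⟨hv₀, hs₀⟩ := ih S₀ hS₀
      obtain ⟨hc, hadm, hp⟩ := (hnext S₀ hv₀ hs₀).2 a ha
      have hmem := List.mem_of_getElem? hi
      exact ⟨hp S' hmem, a.prems_separated hR.det hadm.1.1 (hc ▸ hs₀) S' hmem⟩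
  have hstep : ∀ π a, (treeLabel next S π).bind next = some a →
      treeLabel next S π = some a.concl ∧ a.Admissible R sel := by
    intro π a h
    obtain ⟨S₀, hS₀, ha⟩ := Option.bind_eq_some_iff.1 h
    obtain ⟨hv₀, hs₀⟩ := hinv π S₀ hS₀
    obtain ⟨hc, hadm, _⟩ := (hnext S₀ hv₀ hs₀).2 a ha
    exact ⟨hc ▸ hS₀, hadm⟩
  refine ⟨⟨treeLabel next S, fun π => (treeLabel next S π).bind next, by simp [treeLabel],
    fun π a h => ⟨(hstep π a h).1, (hstep π a h).2.1.1⟩, fun _ _ => rfl⟩, rfl,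
    fun π a h => (hstep π a h).2, fun π S' hS' hleaf => ?_⟩
  change treeLabel next S π = some S' at hS'
  obtain ⟨hv', hs'⟩ := hinv π S' hS'
  refine (hnext S' hv' hs').1 ?_
  by_contra hne
  obtain ⟨a, ha⟩ := Option.ne_none_iff_exists'.1 hne
  obtain ⟨P, hP⟩ := List.exists_mem_of_ne_nil _ (a.prems_ne_nil hR (hstep π a (by
    rw [hS']; exact ha)).2.1.1)
  obtain ⟨i, hi⟩ := List.mem_iff_getElem?.1 hP
  have := hleaf i
  change ((treeLabel next S π).bind next).bind (fun a => a.prems[i]?) = none at this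
  rw [hS', Option.bind_some, ha, Option.bind_some, hi] at this
  cases this

end SL

theorem mainTheorem3 (Sg : SL.Signature) (hcst : ∀ s, Finite (Sg.Cst s))
    (R : Finset (SL.Rule Sg)) (hdet : SL.LocDeterministic R)
    (hprod : ∀ p, SL.Productive R p) (huse : SL.NoUselessParam R)
    (sel : SL.Selection Sg) (S : SL.Sequent Sg) (hvalid : S.Valid R)
    (hsep : SL.ConstantsSeparated S.lhs.pu) :
    (∃ T : SL.ProofTree R, T.label [] = some S ∧ T.Admissible sel ∧ T.FullyExpanded) ∧
    (¬ S.IsAxiom → ∃ a : SL.App Sg, a.concl = S ∧ a.Admissible R sel ∧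
      ∀ P ∈ a.prems, P.Valid R) :=
  have hR : SL.Standing R := ⟨hdet, hprod, huse⟩
  ⟨SL.exists_proofTree hcst hR sel hvalid hsep, SL.exists_admissible hcst hR sel hvalid hsep⟩
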